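/- **Notation.** Points of $\mathbb{R}^2$ are written $x=(x_1,x_2)$, and $d(x,y)=|x_1-y_1|+|x_2-y_2|^{1/2}$. For a function $g$ on $\mathbb{R}^2$ put $\|g\|=\sup_x|g(x)|$, $[g]_\alpha=\sup_{x\neq y}|g(x)-g(y)|/d(x,y)^\alpha$ and $\|g\|_\alpha=\|g\|+[g]_\alpha$; $g\in C^\alpha(\mathbb{R}^2)$ means $\|g\|_\alpha<\infty$. For $T>0$ let $\psi_T$ be the Schwartz function with $\int_{\mathbb{R}^2}\psi_T(x)e^{-ik\cdot x}\,dx=\exp(-T(k_1^4+k_2^2))$, and write $g_T=g*\psi_T$ for a function or a tempered distribution $g$. For a family of distributions $f(\cdot,a_0)$, $a_0\in[\lambda,1]$, that is differentiable in $a_0$ in the sense of distributions, put $$\|f\|_{\alpha-2,1}=\sup_{a_0\in[\lambda,1]}\ \max_{m\in\{0,1\}}\ \sup_{0<T\le 1}(T^{1/4})^{2-\alpha}\,\big\|\big(\partial_{a_0}^m f(\cdot,a_0)\big)_T\big\|.$$ "Periodic" means periodic with period $1$. **Lemma.** Let $\alpha\in(\tfrac12,1)$ and $\lambda>0$. There are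 constants $\delta>0$ and $C>0$, depending only on $\alpha$ and $\lambda$, such that the following holds. Let $I\in\mathbb{N}$, and for $i=1,\dots,I$ let $f_i(\cdot,a_0)$, $a_0\in[\lambda,1]$, be a family of real space-time periodic distributions on $\mathbb{R}^2$, differentiable in $a_0$, and $N_i\in\mathbb{R}$ a constant, with $$\|f_i\|_{\alpha-2,1}\le N_i .$$ For $a_0\in[\lambda,1]$ let $v_i(\cdot,a_0)\in C^\alpha(\mathbb{R}^2)$ be the space-time periodic distributional solution of $$(\partial_2-a_0\partial_1^2+1)\,v_i(\cdot,a_0)=f_i(\cdot,a_0)\quad\text{in }\mathbb{R}^2 .$$ Let $a:\mathbb{R}^2\to[\lambda,1]$ satisfy $[a]_\alpha\le\delta$ and let $\sigma_1,\dots,\sigma_I\in C^\alpha(\mathbb{R}^2)$. Let $u\in C^\alpha(\mathbb{R}^2)$ be periodic in $x_1$ and modelled after $(v_1,\dots,v_I)$ according to $a$ and $(\sigma_1,\dots,\sigma_I)$; that is, there is a function $\nu$ on $\mathbb{R}^2$ for which $$M:=\sup_{x\ne y}\frac{\big|u(y)-u(x)-\sum_{i=1}^I\sigma_i(x)\big(v_i(y,a(x))-v_i(x,a(x))\big)-\nu(x)(y-x)_1\big|}{d(x,y)^{2\alpha}}<\infty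 .$$ Suppose that for some $K\in\mathbb{R}$ $$\sup_{0<T\le1}(T^{1/4})^{2-2\alpha}\,\Big\|(\partial_2-a\,\partial_1^2+1)u_T-\sum_{i=1}^I\sigma_i\,E f_{iT}\Big\|\le K,$$ where $(Ef_{iT})(x)=f_{iT}(x,a(x))$ is the evaluation of $(f_i(\cdot,a_0))_T$ at $(x,a(x))$. Then $$M+\|u\|_\alpha\ \le\ C\Big(K+\sum_{i=1}^I\|\sigma_i\|_\alpha N_i\Big).$$ -/

import Mathlib

open scoped ENNReal SchwartzMap FourierTransform LineDeriv

namespace ParabolicSafonov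

noncomputable section

/-- The space-time plane `ℝ²`; the coordinate `x 0` is the space variable `x₁` and the coordinate
`x 1` is the time variable `x₂`. -/
abbrev Plane : Type := EuclideanSpace ℝ (Fin 2)

/-- The unit vector in the direction of `x₁`. -/
def e₁ : Plane := EuclideanSpace.single 0 1

/-- The unit vector in the direction of `x₂`. -/
def e₂ : Plane := EuclideanSpace.single 1 1

/-- The parabolic distance `d(x, y) = |x₁ - y₁| + |x₂ - y₂|^{1/2}`. -/
def pdist (x y : Plane) : ℝ := |x 0 - y 0| + Real.sqrt |x 1 - y 1|

/-! ### Sup norm and parabolic Hölder norms, with values in `[0, ∞]` -/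

/-- `‖g‖ = sup_x |g x|`. -/
def supNorm (g : Plane → ℝ) : ℝ≥0∞ := ⨆ x, ENNReal.ofReal |g x|

/-- `[g]_α = sup_{x ≠ y} |g x - g y| / d(x, y)^α`. -/
def holderSeminorm (α : ℝ) (g : Plane → ℝ) : ℝ≥0∞ :=
  ⨆ (x : Plane) (y : Plane) (_ : x ≠ y), ENNReal.ofReal (|g x - g y| / pdist x y ^ α)

/-- `‖g‖_α = ‖g‖ + [g]_α`. -/
def holderNorm (α : ℝ) (g : Plane → ℝ) : ℝ≥0∞ := supNorm g + holderSeminorm α g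

/-- `g ∈ C^α(ℝ²)` in the parabolic sense. -/
def MemHolder (α : ℝ) (g : Plane → ℝ) : Prop := holderNorm α g < ∞

/-! ### The convolution kernel -/

/-- The symbol of `∂₁⁴ - ∂₂²` for the Fourier transform `∫ g(x) exp(-2πi k·x) dx`. -/
def kernelSymbol (k : Plane) : ℝ := (2 * Real.pi * k 0) ^ 4 + (2 * Real.pi * k 1) ^ 2

theorem kernelSymbol_hasTemperateGrowth : kernelSymbol.HasTemperateGrowth := by
  have h : ∀ i : Fin 2, (fun k : Plane => k i).HasTemperateGrowth := fun i =>
    (EuclideanSpace.proj i : Plane →L[ℝ] ℝ).hasTemperateGrowth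
  have hc : ∀ i : Fin 2, (fun k : Plane => 2 * Real.pi * k i).HasTemperateGrowth := fun i =>
    (Function.HasTemperateGrowth.const (2 * Real.pi)).mul (h i)
  exact ((hc 0).pow 4).add ((hc 1).pow 2)

theorem le_kernelSymbol (k : Plane) : (1 + ‖k‖) - 3 ≤ kernelSymbol k := by
  have hn : ‖k‖ ^ 2 = k 0 ^ 2 + k 1 ^ 2 := by
    rw [EuclideanSpace.norm_sq_eq]; simp [Fin.sum_univ_two]
  have hpi : 1 ≤ 2 * Real.pi := by linarith [Real.pi_gt_three]
  have h0 : k 0 ^ 2 ≤ (2 * Real.pi * k 0) ^ 2 := by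
    rw [mul_pow]; nlinarith [sq_nonneg (k 0), one_le_pow₀ hpi (n := 2)]
  have h1 : k 1 ^ 2 ≤ (2 * Real.pi * k 1) ^ 2 := by
    rw [mul_pow]; nlinarith [sq_nonneg (k 1), one_le_pow₀ hpi (n := 2)]
  have h4 : (2 * Real.pi * k 0) ^ 2 - 1 ≤ (2 * Real.pi * k 0) ^ 4 := by
    nlinarith [sq_nonneg ((2 * Real.pi * k 0) ^ 2 - 1), sq_nonneg (2 * Real.pi * k 0)]
  unfold kernelSymbol
  nlinarith [sq_nonneg (‖k‖ - 1), norm_nonneg k]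

/-- `exp(-T (∂₁⁴ - ∂₂²))` on the Fourier side, as a Schwartz function. -/
def kernelHat (T : ℝ) (hT : 0 < T) : 𝓢(Plane, ℝ) where
  toFun k := Real.exp (-T * kernelSymbol k)
  smooth' := Real.contDiff_exp.comp (contDiff_const.mul kernelSymbol_hasTemperateGrowth.1)
  decay' := by
    intro m n
    obtain ⟨l, C, hC0, hC⟩ := kernelSymbol_hasTemperateGrowth.norm_iteratedFDeriv_le_uniform n
    set A : ℝ := max 1 T with hA
    have hA1 : 1 ≤ A := le_max_left _ _
    set q : ℕ := m + l * n
    refine ⟨n.factorial * A ^ n * (1 + C) ^ n * (Real.exp (3 * T) * (q.factorial / T ^ q)),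
      fun x => ?_⟩
    have hg : ContDiff ℝ (⊤ : ℕ∞) (fun t : ℝ => Real.exp (-T * t)) :=
      Real.contDiff_exp.comp (contDiff_const.mul contDiff_id)
    have hs : 1 ≤ 1 + ‖x‖ := by linarith [norm_nonneg x]
    have key := norm_iteratedFDeriv_comp_le (n := n) hg kernelSymbol_hasTemperateGrowth.1
      (by exact_mod_cast le_top) x
      (C := A ^ n * Real.exp (-T * kernelSymbol x)) (D := (1 + C) * (1 + ‖x‖) ^ l)
      (by
        intro i hi
        rw [norm_iteratedFDeriv_eq_norm_iteratedDeriv, iteratedDeriv_exp_const_mul, norm_mul,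
          norm_pow, Real.norm_eq_abs, Real.norm_eq_abs, abs_neg, abs_of_pos hT, Real.abs_exp]
        gcongr
        calc T ^ i ≤ A ^ i := by gcongr; exact le_max_right _ _
          _ ≤ A ^ n := pow_le_pow_right₀ hA1 hi)
      (by
        intro i hi1 hin
        have hD : 1 ≤ (1 + C) * (1 + ‖x‖) ^ l := by
          have := one_le_pow₀ hs (n := l)
          nlinarith
        calc _ ≤ C * (1 + ‖x‖) ^ l := hC i hin x
          _ ≤ (1 + C) * (1 + ‖x‖) ^ l := by gcongr; linarith
          _ ≤ _ := le_self_pow₀ hD (by omega))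
    have hexp : (1 + ‖x‖) ^ q * Real.exp (-T * kernelSymbol x)
        ≤ Real.exp (3 * T) * (q.factorial / T ^ q) := by
      have h1 : Real.exp (-T * kernelSymbol x)
          ≤ Real.exp (3 * T) * Real.exp (-(T * (1 + ‖x‖))) := by
        rw [← Real.exp_add, Real.exp_le_exp]
        nlinarith [le_kernelSymbol x]
      have h2 := Real.pow_div_factorial_le_exp (T * (1 + ‖x‖)) (by positivity) q
      rw [div_le_iff₀ (by positivity), mul_pow] at h2
      have h3 : (1 + ‖x‖) ^ q * Real.exp (-(T * (1 + ‖x‖))) ≤ q.factorial / T ^ q := by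
        rw [le_div_iff₀ (by positivity), Real.exp_neg, mul_assoc, mul_comm, mul_assoc,
          inv_mul_le_iff₀ (Real.exp_pos _)]
        exact h2
      calc _ ≤ (1 + ‖x‖) ^ q * (Real.exp (3 * T) * Real.exp (-(T * (1 + ‖x‖)))) := by gcongr
        _ = Real.exp (3 * T) * ((1 + ‖x‖) ^ q * Real.exp (-(T * (1 + ‖x‖)))) := by ring
        _ ≤ _ := by gcongr
    calc _ ≤ (1 + ‖x‖) ^ m * (n.factorial * (A ^ n * Real.exp (-T * kernelSymbol x))
              * ((1 + C) * (1 + ‖x‖) ^ l) ^ n) := by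
            gcongr
            · linarith
            · exact key
      _ = n.factorial * A ^ n * (1 + C) ^ n
            * ((1 + ‖x‖) ^ q * Real.exp (-T * kernelSymbol x)) := by
            simp only [q, mul_pow, pow_add, pow_mul]; ring
      _ ≤ _ := by gcongr

/-- The kernel `ψ_T`: the inverse Fourier transform of `exp(-T (k₁⁴ + k₂²))` (angular frequencies).
The kernel is real-valued because the symbol is even; it is normalised by `∫ ψ_T = 1`. -/
def psi (T : ℝ) (hT : 0 < T) : 𝓢(Plane, ℝ) :=
  SchwartzMap.postcompCLM (𝕜 := ℝ) Complex.reCLM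
    (𝓕⁻ (SchwartzMap.postcompCLM (𝕜 := ℝ) Complex.ofRealCLM (kernelHat T hT)))

/-- The Schwartz function `y ↦ ψ_T(x - y)`. -/
def psiAt (T : ℝ) (hT : 0 < T) (x : Plane) : 𝓢(Plane, ℝ) :=
  SchwartzMap.compSubConstCLM ℝ x
    (SchwartzMap.compCLMOfContinuousLinearEquiv ℝ (ContinuousLinearEquiv.neg ℝ) (psi T hT))

theorem psiAt_apply (T : ℝ) (hT : 0 < T) (x y : Plane) :
    psiAt T hT x y = psi T hT (x - y) := by
  simp [psiAt]

/-! ### Distributions -/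

/-- Real tempered distributions on `ℝ²` (all periodic distributions are tempered). -/
abbrev Distr : Type := 𝓢(Plane, ℝ) →L[ℝ] ℝ

/-- `f_T = f ∗ ψ_T` for a distribution `f`. -/
def Distr.mollify (f : Distr) (T : ℝ) (hT : 0 < T) (x : Plane) : ℝ := f (psiAt T hT x)

/-- `f` is periodic with period `1` in both variables. -/
def Distr.IsPeriodic (f : Distr) : Prop :=
  (∀ φ : 𝓢(Plane, ℝ), f (SchwartzMap.compSubConstCLM ℝ e₁ φ) = f φ) ∧
    ∀ φ : 𝓢(Plane, ℝ), f (SchwartzMap.compSubConstCLM ℝ e₂ φ) = f φ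

/-- `‖f‖_{-β} = sup_{0 < T ≤ 1} (T^{1/4})^β ‖f_T‖`. -/
def negNorm (β : ℝ) (f : Distr) : ℝ≥0∞ :=
  ⨆ (T : ℝ) (hT : 0 < T) (_ : T ≤ 1),
    ENNReal.ofReal ((T ^ (1 / 4 : ℝ)) ^ β) * supNorm (f.mollify T hT)

/-- `f'(·, a₀)` is the derivative of the family `f(·, a₀)` with respect to the parameter
`a₀ ∈ [lam, 1]`, in the sense of distributions. -/
def HasParamDeriv (lam : ℝ) (f f' : ℝ → Distr) : Prop :=
  ∀ a₀ ∈ Set.Icc lam 1, ∀ φ : 𝓢(Plane, ℝ),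
    HasDerivWithinAt (fun b => f b φ) (f' a₀ φ) (Set.Icc lam 1) a₀

/-- `‖f‖_{-β,1}`, the supremum over `a₀ ∈ [lam, 1]` of the `‖·‖_{-β}`-norms of `f(·, a₀)` and of
its parameter derivative `f'(·, a₀)`. -/
def negNormOne (lam β : ℝ) (f f' : ℝ → Distr) : ℝ≥0∞ :=
  ⨆ a₀ ∈ Set.Icc lam 1, max (negNorm β (f a₀)) (negNorm β (f' a₀))

/-! ### Functions on the plane -/

/-- `g` is periodic with period `1` in `x₁`. -/
def IsX₁Periodic (g : Plane → ℝ) : Prop := ∀ x, g (x + e₁) = g x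

/-- `g` is periodic with period `1` in `x₁` and in `x₂`. -/
def IsSpaceTimePeriodic (g : Plane → ℝ) : Prop :=
  ∀ x, g (x + e₁) = g x ∧ g (x + e₂) = g x

/-- `g_T = g ∗ ψ_T` for a function `g`. -/
def mollify (g : Plane → ℝ) (T : ℝ) (hT : 0 < T) (x : Plane) : ℝ :=
  ∫ y, g y * psi T hT (x - y)

/-- `v` solves `(∂₂ - a₀ ∂₁² + 1) v = f` on `ℝ²` in the sense of distributions. -/
def SolvesFrozen (a₀ : ℝ) (f : Distr) (v : Plane → ℝ) : Prop :=
  ∀ φ : 𝓢(Plane, ℝ),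
    ∫ x, v x * (-(∂_{e₂} φ) x - a₀ * (∂_{e₁} (∂_{e₁} φ)) x + φ x) = f φ

/-- The classical expression `(∂₂ - a ∂₁² + 1) w` at the point `x`. -/
def parabolicOp (a w : Plane → ℝ) (x : Plane) : ℝ :=
  lineDeriv ℝ w x e₂ - a x * lineDeriv ℝ (fun z => lineDeriv ℝ w z e₁) x e₁ + w x

/-- The modelling constant of `u` after `(v_1, …, v_I)` according to `a` and `(σ_1, …, σ_I)`,
with respect to `ν`:
`sup_{x ≠ y} |u y - u x - ∑ i, σ_i x (v_i(y, a x) - v_i(x, a x)) - ν x (y - x)₁| / d(x, y)^{2α}`. -/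
def modellingConst {I : ℕ} (α : ℝ) (u : Plane → ℝ) (v : Fin I → ℝ → Plane → ℝ) (a : Plane → ℝ)
    (σ : Fin I → Plane → ℝ) (ν : Plane → ℝ) : ℝ≥0∞ :=
  ⨆ (x : Plane) (y : Plane) (_ : x ≠ y),
    ENNReal.ofReal (|u y - u x - ∑ i, σ i x * (v i (a x) y - v i (a x) x) - ν x * (y - x) 0|
      / pdist x y ^ (2 * α))

/-- `sup_{0 < T ≤ 1} (T^{1/4})^{2 - 2α} ‖(∂₂ - a ∂₁² + 1) u_T - ∑ i, σ_i E f_{iT}‖`, where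
`(E f_{iT})(x) = f_{iT}(x, a x)`. -/
def approxError {I : ℕ} (α : ℝ) (u a : Plane → ℝ) (σ : Fin I → Plane → ℝ)
    (f : Fin I → ℝ → Distr) : ℝ≥0∞ :=
  ⨆ (T : ℝ) (hT : 0 < T) (_ : T ≤ 1),
    ENNReal.ofReal ((T ^ (1 / 4 : ℝ)) ^ (2 - 2 * α)) *
      supNorm (fun x => parabolicOp a (mollify u T hT) x
        - ∑ i, σ i x * (f i (a x)).mollify T hT x)

end

end ParabolicSafonov

open ParabolicSafonov

namespace ParabolicSafonov

open MeasureTheory Filter Topology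

noncomputable section

/-! Write `X` for the sum of `‖σ_i‖_α N_i`. The proof is a Schauder estimate by affine
approximation. Around a base point `x`, the function `w = u - ∑ σ_i(x) v_i(·, a(x))` has to be
affine in `x₁` up to order `2α`. After mollification at scale `ρ = T^{1/4}`, `(∂₂ - a(x) ∂₁²) w_ρ`
at `y` consists of the assumed error `K ρ^{2α-2}`, of the errors made by replacing `a(y)`, `σ_i(y)`
by their values at `x`, which are of size `(X + δ [u]_α) d(y,x)^α ρ^{α-2}`, and of a bounded
zero-order term (`abs_heat_frozenPart_le`).

On a parabolic cylinder of size `R`, a function is compared with the heat evolution of its slice at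
time `-R²`, written as a Gaussian average. The evolution is smooth, hence affine up to a factor
`(r/R)²` at scale `r`, and a right-hand side of size `H` costs `R² H` (`heat_taylor`). With `ρ =
r/L` and `R = L r`, the mollification error and the Taylor remainder reproduce the modelling
constant `M` with the small factor `L^{-2α} + L^{-(2-2α)}`, and all other quantities carry at most a
factor `L⁴` (`exists_affine_approx`). Because `2α > 1`, the slopes found at dyadic scales converge,
and the limit can only be `ν(x)` (`abs_sub_le_of_affine_approx`). For distances above one,
periodicity in `x₁` controls `ν`. Absorbing the small multiple of `M` gives `M ≤ C (K + X + ‖u‖ + δ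
[u]_α)` (`modelled_bound`).

Two further inequalities close the estimate. The modelling bound gives `[u]_α ≤ C (M + X + ‖u‖)`
(`holder_bound`), so that a small `δ` absorbs `δ [u]_α`. The maximum principle applied to `u_ρ`
gives `‖u‖ ≤ (K + X) ρ^{α-2} + C [u]_α ρ^α` (`sup_bound`), so that a small `ρ` absorbs the remaining
`‖u‖`. All absorptions start from finite constants (`absorb`).

The same comparison with exponent `α` yields the constant-coefficient bounds for `v_i`; applied to
`v_i(·, a₀) - v_i(·, a₁)` it yields Lipschitz dependence on the parameter (`schauder_family`), which
is needed when the base point is moved. -/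

/-! ### Parabolic dilations -/

/-- The parabolic dilation `(x₁, x₂) ↦ (c x₁, c² x₂)`. -/
def parDil (c : ℝ) (hc : c ≠ 0) : Plane ≃L[ℝ] Plane :=
  LinearEquiv.toContinuousLinearEquiv
    { toFun := fun z => !₂[c * z 0, c ^ 2 * z 1]
      invFun := fun z => !₂[c⁻¹ * z 0, (c⁻¹) ^ 2 * z 1]
      map_add' := fun x y => by ext i; fin_cases i <;> simp [mul_add]
      map_smul' := fun r x => by ext i; fin_cases i <;> simp <;> ring
      left_inv := fun x => by ext i; fin_cases i <;> simp [hc]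
      right_inv := fun x => by ext i; fin_cases i <;> simp [hc] }

@[simp] theorem parDil_apply_zero (c : ℝ) (hc : c ≠ 0) (z : Plane) :
    parDil c hc z 0 = c * z 0 := rfl

@[simp] theorem parDil_apply_one (c : ℝ) (hc : c ≠ 0) (z : Plane) :
    parDil c hc z 1 = c ^ 2 * z 1 := rfl

theorem det_parDil (c : ℝ) (hc : c ≠ 0) :
    LinearMap.det ((parDil c hc : Plane →L[ℝ] Plane) : Plane →ₗ[ℝ] Plane) = c ^ 3 := by
  have h : ((parDil c hc : Plane →L[ℝ] Plane) : Plane →ₗ[ℝ] Plane)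
      = Matrix.toLpLin 2 2 (Matrix.diagonal ![c, c ^ 2]) := by
    ext z i
    fin_cases i <;> simp [Matrix.mulVec_diagonal]
  rw [h, LinearMap.det_toLpLin, Matrix.det_diagonal]
  simp [Fin.prod_univ_two]; ring

theorem integral_comp_parDil {E : Type*} [NormedAddCommGroup E] [NormedSpace ℝ E]
    (c : ℝ) (hc : 0 < c) (F : Plane → E) :
    ∫ z, F (parDil c hc.ne' z) = (c ^ 3)⁻¹ • ∫ z, F z := by
  have h0 : LinearMap.det ((parDil c hc.ne' : Plane →L[ℝ] Plane) : Plane →ₗ[ℝ] Plane) ≠ 0 := by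
    rw [det_parDil]; positivity
  have h := Measure.map_linearMap_addHaar_eq_smul_addHaar (volume : Measure Plane) h0
  rw [det_parDil, abs_of_pos (by positivity)] at h
  have h2 : ∫ z, F z ∂(Measure.map (parDil c hc.ne') volume) = ∫ z, F (parDil c hc.ne' z) :=
    (parDil c hc.ne').toHomeomorph.measurableEmbedding.integral_map F
  rw [← h2]
  have h3 : Measure.map (parDil c hc.ne') (volume : Measure Plane)
      = ENNReal.ofReal ((c ^ 3)⁻¹) • volume := h
  rw [h3, integral_smul_measure, ENNReal.toReal_ofReal (by positivity)]

/-! ### The kernel -/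

theorem psi_apply (T : ℝ) (hT : 0 < T) (z : Plane) :
    psi T hT z = (∫ v : Plane, 𝐞 (inner ℝ v z) • ((kernelHat T hT v : ℝ) : ℂ)).re := by
  change (𝓕⁻ (SchwartzMap.postcompCLM (𝕜 := ℝ) Complex.ofRealCLM (kernelHat T hT)) z).re = _
  rw [SchwartzMap.fourierInv_coe, Real.fourierInv_eq]
  rfl

theorem kernelHat_apply (T : ℝ) (hT : 0 < T) (v : Plane) :
    kernelHat T hT v = Real.exp (-T * kernelSymbol v) := rfl

/-- The symbol is even. This symmetry later makes the first moments of the kernel vanish. -/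
theorem psi_neg (T : ℝ) (hT : 0 < T) (z : Plane) : psi T hT (-z) = psi T hT z := by
  rw [psi_apply, psi_apply, ← integral_neg_eq_self]
  congr 2
  ext v
  have : kernelSymbol (-v) = kernelSymbol v := by
    simp only [kernelSymbol, PiLp.neg_apply]; ring
  simp [kernelHat_apply, this]

/-- Fourier inversion evaluated at frequency zero, where the symbol vanishes. -/
theorem integral_psi (T : ℝ) (hT : 0 < T) : ∫ z, psi T hT z = 1 := by
  set g : 𝓢(Plane, ℂ) := SchwartzMap.postcompCLM (𝕜 := ℝ) Complex.ofRealCLM (kernelHat T hT)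
  have h1 : ∫ z, (𝓕⁻ g) z = 1 := by
    have h := congrArg (fun F : 𝓢(Plane, ℂ) => F 0)
      (FourierTransform.fourier_fourierInv_eq g : 𝓕 (𝓕⁻ g) = g)
    simp only [SchwartzMap.fourier_coe, Real.fourier_eq] at h
    simpa [g, kernelHat_apply, kernelSymbol] using h
  have h2 : ∫ z, psi T hT z = (∫ z, (𝓕⁻ g) z).re := by
    have := integral_re (𝕜 := ℂ) ((𝓕⁻ g).integrable (μ := volume))
    exact this
  rw [h2, h1]; rfl

/-- The symbol is homogeneous of degree four under parabolic dilations, so `T = ρ⁴` corresponds to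
length scale `ρ`; the prefactor is the Jacobian of the dilation in the Fourier integral. -/
theorem psi_pow_four (ρ : ℝ) (hρ : 0 < ρ) (hT : 0 < ρ ^ 4) :
    psi (ρ ^ 4) hT = (ρ⁻¹) ^ 3 • SchwartzMap.compCLMOfContinuousLinearEquiv ℝ
      (parDil ρ⁻¹ (inv_ne_zero hρ.ne')) (psi 1 one_pos) := by
  ext z
  simp only [smul_apply, SchwartzMap.compCLMOfContinuousLinearEquiv_apply,
    Function.comp_apply, smul_eq_mul]
  rw [psi_apply, psi_apply]
  have h := integral_comp_parDil ρ hρ (fun v : Plane =>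
    𝐞 (inner ℝ v (parDil ρ⁻¹ (inv_ne_zero hρ.ne') z)) • ((kernelHat 1 one_pos v : ℝ) : ℂ))
  have h2 : ∀ v : Plane, 𝐞 (inner ℝ (parDil ρ hρ.ne' v) (parDil ρ⁻¹ (inv_ne_zero hρ.ne') z)) •
      ((kernelHat 1 one_pos (parDil ρ hρ.ne' v) : ℝ) : ℂ)
      = 𝐞 (inner ℝ v z) • ((kernelHat (ρ ^ 4) hT v : ℝ) : ℂ) := by
    intro v
    have e1 : inner ℝ (parDil ρ hρ.ne' v) (parDil ρ⁻¹ (inv_ne_zero hρ.ne') z) = inner ℝ v z := by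
      simp [PiLp.inner_apply, Fin.sum_univ_two]
      field_simp
    have e2 : kernelHat 1 one_pos (parDil ρ hρ.ne' v) = kernelHat (ρ ^ 4) hT v := by
      simp only [kernelHat_apply, kernelSymbol, parDil_apply_zero, parDil_apply_one]
      congr 1; ring
    rw [e1, e2]
  simp only [h2] at h
  rw [h, Complex.smul_re, smul_eq_mul, inv_pow]

/-- The pointwise parabolic scaling of the kernel and its second space derivative. -/
theorem psi_pow_four_apply (ρ : ℝ) (hρ : 0 < ρ) (hT : 0 < ρ ^ 4) (z : Plane) :
    psi (ρ ^ 4) hT z = (ρ⁻¹) ^ 3 * psi 1 one_pos (parDil ρ⁻¹ (inv_ne_zero hρ.ne') z) := by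
  rw [psi_pow_four ρ hρ hT]; rfl

theorem parDil_e₁ (c : ℝ) (hc : c ≠ 0) : parDil c hc e₁ = c • e₁ := by
  ext i; fin_cases i <;> simp [e₁]

theorem deriv_deriv_psi_pow_four_apply (ρ : ℝ) (hρ : 0 < ρ) (hT : 0 < ρ ^ 4) (z : Plane) :
    (∂_{e₁} (∂_{e₁} (psi (ρ ^ 4) hT))) z = (ρ⁻¹) ^ 5 *
      (∂_{e₁} (∂_{e₁} (psi 1 one_pos))) (parDil ρ⁻¹ (inv_ne_zero hρ.ne') z) := by
  rw [psi_pow_four ρ hρ hT]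
  simp only [LineDeriv.lineDerivOp_smul, SchwartzMap.lineDerivOp_compCLMOfContinuousLinearEquiv,
    parDil_e₁, LineDeriv.lineDerivOp_left_smul, map_smul]
  simp only [smul_apply, SchwartzMap.compCLMOfContinuousLinearEquiv_apply,
    Function.comp_apply, smul_eq_mul]
  ring

/-! ### The parabolic gauge -/

/-- The parabolic gauge `|x₁| + |x₂|^{1/2}`. -/
def pnorm (z : Plane) : ℝ := |z 0| + Real.sqrt |z 1|

theorem pdist_eq_pnorm (x y : Plane) : pdist x y = pnorm (x - y) := rfl

theorem pnorm_nonneg (z : Plane) : 0 ≤ pnorm z := by unfold pnorm; positivity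

theorem pdist_nonneg (x y : Plane) : 0 ≤ pdist x y := pnorm_nonneg (x - y)

theorem pnorm_neg (z : Plane) : pnorm (-z) = pnorm z := by simp [pnorm]

theorem pdist_comm (x y : Plane) : pdist x y = pdist y x := by
  rw [pdist_eq_pnorm, pdist_eq_pnorm, ← pnorm_neg, neg_sub]

theorem pnorm_parDil (c : ℝ) (hc : 0 < c) (z : Plane) :
    pnorm (parDil c hc.ne' z) = c * pnorm z := by
  simp only [pnorm, parDil_apply_zero, parDil_apply_one, abs_mul, abs_of_pos hc,
    abs_of_pos (pow_pos hc 2)]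
  rw [Real.sqrt_mul (by positivity), Real.sqrt_sq hc.le]; ring

theorem abs_apply_le_norm (z : Plane) (i : Fin 2) : |z i| ≤ ‖z‖ := PiLp.norm_apply_le z i

theorem abs_apply_zero_le_pnorm (z : Plane) : |z 0| ≤ pnorm z := by
  unfold pnorm; linarith [Real.sqrt_nonneg |z 1|]

theorem pnorm_le (z : Plane) : pnorm z ≤ 2 * (1 + ‖z‖) := by
  have h0 := abs_apply_le_norm z 0
  have h1 := abs_apply_le_norm z 1
  have h2 : √|z 1| ≤ 1 + ‖z‖ := by
    refine Real.sqrt_le_iff.2 ⟨by positivity, ?_⟩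
    nlinarith [norm_nonneg z]
  unfold pnorm; linarith

/-- One polynomial weight serves for every exponent in `[0, 2]`, so a single moment constant covers
both `α` and `2α`. -/
theorem pnorm_rpow_le (z : Plane) {β : ℝ} (h0 : 0 ≤ β) (h2 : β ≤ 2) :
    pnorm z ^ β ≤ (2 * (1 + ‖z‖)) ^ 2 := by
  calc pnorm z ^ β ≤ (2 * (1 + ‖z‖)) ^ β :=
        Real.rpow_le_rpow (pnorm_nonneg z) (pnorm_le z) h0
    _ ≤ (2 * (1 + ‖z‖)) ^ (2 : ℝ) :=
        Real.rpow_le_rpow_of_exponent_le (by linarith [norm_nonneg z]) h2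
    _ = _ := by norm_cast

theorem continuous_pnorm : Continuous pnorm := by
  unfold pnorm; fun_prop

theorem pnorm_eq_zero {z : Plane} (h : pnorm z = 0) : z = 0 := by
  unfold pnorm at h
  have h0 : |z 0| = 0 := by linarith [abs_nonneg (z 0), Real.sqrt_nonneg |z 1|]
  have h1 : √|z 1| = 0 := by linarith [abs_nonneg (z 0), Real.sqrt_nonneg |z 1|]
  rw [Real.sqrt_eq_zero (abs_nonneg _)] at h1
  ext i; fin_cases i
  · simpa using h0
  · simpa using h1

theorem pdist_self (x : Plane) : pdist x x = 0 := by simp [pdist]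

theorem pdist_pos {x y : Plane} (h : x ≠ y) : 0 < pdist x y :=
  lt_of_le_of_ne (pdist_nonneg x y) fun h0 => h (sub_eq_zero.1 (pnorm_eq_zero h0.symm))

/-! ### Moments of Schwartz functions -/

theorem integrable_schwartz_weight (φ : 𝓢(Plane, ℝ)) :
    Integrable (fun z => |φ z| * (2 * (1 + ‖z‖)) ^ 2) := by
  have h : ∀ k, Integrable (fun z => ‖z‖ ^ k * ‖φ z‖) := fun k => φ.integrable_pow_mul volume k
  refine ((((h 0).const_mul 4).add ((h 1).const_mul 8)).add ((h 2).const_mul 4)).congr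
    (ae_of_all _ fun z => ?_)
  simp only [Pi.add_apply, Real.norm_eq_abs]; ring

/-- The weighted `L¹` norm controlling all parabolic moments of order at most two. -/
def momConst (φ : 𝓢(Plane, ℝ)) : ℝ := ∫ z, |φ z| * (2 * (1 + ‖z‖)) ^ 2

theorem momConst_nonneg (φ : 𝓢(Plane, ℝ)) : 0 ≤ momConst φ :=
  integral_nonneg fun z => by positivity

theorem integrable_moment (φ : 𝓢(Plane, ℝ)) {β : ℝ} (h0 : 0 ≤ β) (h2 : β ≤ 2) :
    Integrable (fun z => |φ z| * pnorm z ^ β) := by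
  refine (integrable_schwartz_weight φ).mono' ?_ (ae_of_all _ fun z => ?_)
  · exact (φ.continuous.abs.mul
      (continuous_pnorm.rpow_const fun _ => Or.inr h0)).aestronglyMeasurable
  · rw [Real.norm_of_nonneg (mul_nonneg (abs_nonneg _) (Real.rpow_nonneg (pnorm_nonneg z) _))]
    exact mul_le_mul_of_nonneg_left (pnorm_rpow_le z h0 h2) (abs_nonneg _)

theorem integral_moment_le (φ : 𝓢(Plane, ℝ)) {β : ℝ} (h0 : 0 ≤ β) (h2 : β ≤ 2) :
    ∫ z, |φ z| * pnorm z ^ β ≤ momConst φ :=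
  integral_mono (integrable_moment φ h0 h2) (integrable_schwartz_weight φ) fun z =>
    mul_le_mul_of_nonneg_left (pnorm_rpow_le z h0 h2) (abs_nonneg _)

/-- If `χ = ρ^{-3-k} φ(z₁/ρ, z₂/ρ²)` then its moment of order `β` is at most a constant
times `ρ^{β-k}`. -/
theorem integral_moment_scaled_le {φ χ : 𝓢(Plane, ℝ)} {ρ : ℝ} (hρ : 0 < ρ) (k : ℕ)
    (h : ∀ z, χ z = (ρ⁻¹) ^ (3 + k) * φ (parDil ρ⁻¹ (inv_ne_zero hρ.ne') z))
    {β : ℝ} (h0 : 0 ≤ β) (h2 : β ≤ 2) :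
    ∫ z, |χ z| * pnorm z ^ β ≤ momConst φ * (ρ ^ β * (ρ⁻¹) ^ k) := by
  have hi : 0 < ρ⁻¹ := inv_pos.2 hρ
  have e : ∀ z, |χ z| * pnorm z ^ β = ((ρ⁻¹) ^ (3 + k) * ρ ^ β) *
      (|φ (parDil ρ⁻¹ hi.ne' z)| * pnorm (parDil ρ⁻¹ hi.ne' z) ^ β) := by
    intro z
    rw [h, abs_mul, abs_of_pos (by positivity), pnorm_parDil _ hi,
      Real.mul_rpow hi.le (pnorm_nonneg z), Real.inv_rpow hρ.le]
    have := (Real.rpow_pos_of_pos hρ β).ne'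
    field_simp
  simp only [e]
  rw [integral_const_mul, integral_comp_parDil ρ⁻¹ hi (fun z => |φ z| * pnorm z ^ β), smul_eq_mul]
  have h3 := integral_moment_le φ h0 h2
  have h4 : (ρ⁻¹) ^ (3 + k) * ρ ^ β * (((ρ⁻¹) ^ 3)⁻¹ * ∫ z, |φ z| * pnorm z ^ β)
      = (∫ z, |φ z| * pnorm z ^ β) * (ρ ^ β * (ρ⁻¹) ^ k) := by
    rw [pow_add]; field_simp
  rw [h4]
  exact mul_le_mul_of_nonneg_right h3 (by positivity)

/-- Integration of a function with two-power parabolic growth against a scaled kernel. -/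
theorem abs_integral_mul_scaled_le {φ χ : 𝓢(Plane, ℝ)} {ρ : ℝ} (hρ : 0 < ρ) (k : ℕ)
    (h : ∀ z, χ z = (ρ⁻¹) ^ (3 + k) * φ (parDil ρ⁻¹ (inv_ne_zero hρ.ne') z))
    {β γ A B : ℝ} (h0 : 0 ≤ β) (h2 : β ≤ 2) (h0' : 0 ≤ γ) (h2' : γ ≤ 2)
    (hA : 0 ≤ A) (hB : 0 ≤ B)
    (g : Plane → ℝ)
    (hg : ∀ z, |g z| ≤ A * pnorm z ^ β + B * pnorm z ^ γ) :
    |∫ z, g z * χ z| ≤ momConst φ * (A * ρ ^ β + B * ρ ^ γ) * (ρ⁻¹) ^ k := by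
  have hI : ∀ D δ : ℝ, 0 ≤ δ → δ ≤ 2 → Integrable (fun z => D * (|χ z| * pnorm z ^ δ)) :=
    fun D δ h h' => (integrable_moment χ h h').const_mul D
  have hh : ∀ z, ‖g z * χ z‖ ≤ A * (|χ z| * pnorm z ^ β) + B * (|χ z| * pnorm z ^ γ) := by
    intro z
    rw [Real.norm_eq_abs, abs_mul]
    nlinarith [mul_le_mul_of_nonneg_right (hg z) (abs_nonneg (χ z))]
  have hint := (hI A β h0 h2).add (hI B γ h0' h2')
  have h4 := norm_integral_le_of_norm_le hint (ae_of_all _ hh)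
  rw [integral_add' (hI A β h0 h2) (hI B γ h0' h2'), integral_const_mul, integral_const_mul] at h4
  have h5 := mul_le_mul_of_nonneg_left (integral_moment_scaled_le hρ k h h0 h2) hA
  have h6 := mul_le_mul_of_nonneg_left (integral_moment_scaled_le hρ k h h0' h2') hB
  rw [Real.norm_eq_abs] at h4
  calc _ ≤ _ := h4
    _ ≤ _ := add_le_add h5 h6
    _ = _ := by ring

/-! ### Convolution of a bounded continuous function with a Schwartz function -/

/-- The convolution `g ∗ φ`. -/
def conv (g : Plane → ℝ) (φ : 𝓢(Plane, ℝ)) (x : Plane) : ℝ := ∫ y, g y * φ (x - y)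

theorem conv_eq (g : Plane → ℝ) (φ : 𝓢(Plane, ℝ)) (x : Plane) :
    conv g φ x = ∫ z, g (x - z) * φ z := by
  rw [conv, ← integral_sub_left_eq_self (fun z => g (x - z) * φ z) volume x]
  simp

theorem integrable_conv {g : Plane → ℝ} (hg : Continuous g) {B : ℝ} (hB : ∀ x, |g x| ≤ B)
    (φ : 𝓢(Plane, ℝ)) (x : Plane) : Integrable (fun y => g y * φ (x - y)) :=
  (φ.integrable.comp_sub_left x).bdd_mul hg.aestronglyMeasurable
    (ae_of_all _ fun y => by simpa using hB y)

theorem integrable_conv' {g : Plane → ℝ} (hg : Continuous g) {B : ℝ} (hB : ∀ x, |g x| ≤ B)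
    (φ : 𝓢(Plane, ℝ)) (x : Plane) : Integrable (fun z => g (x - z) * φ z) :=
  φ.integrable.bdd_mul (by fun_prop : Continuous fun z => g (x - z)).aestronglyMeasurable
    (ae_of_all _ fun y => by simpa using hB (x - y))

theorem abs_conv_le {g : Plane → ℝ} {B : ℝ} (hB : ∀ x, |g x| ≤ B)
    (φ : 𝓢(Plane, ℝ)) (x : Plane) : |conv g φ x| ≤ B * ∫ z, |φ z| := by
  rw [conv_eq, ← integral_const_mul, ← Real.norm_eq_abs]
  have hφ : Integrable (fun z => |φ z|) := φ.integrable.abs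
  refine norm_integral_le_of_norm_le (hφ.const_mul B) (ae_of_all _ fun z => ?_)
  rw [Real.norm_eq_abs, abs_mul]
  exact mul_le_mul_of_nonneg_right (hB _) (abs_nonneg _)

/-- Differentiation under the integral. The dominating function has to be uniform for base points in
a unit ball; fourth-order decay of the derivative leaves `(1 + ‖x - y‖)^{-3}`, which is integrable
in dimension two. -/
theorem hasFDerivAt_conv {g : Plane → ℝ} (hg : Continuous g) {B : ℝ} (hB : ∀ x, |g x| ≤ B)
    (φ : 𝓢(Plane, ℝ)) (x : Plane) :
    ∃ L : Plane →L[ℝ] ℝ, HasFDerivAt (conv g φ) L x ∧ ∀ m, L m = conv g (∂_{m} φ) x := by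
  obtain ⟨C, hC0, hC⟩ : ∃ C, 0 ≤ C ∧ ∀ z, ‖z‖ ^ 4 * ‖fderiv ℝ φ z‖ + ‖fderiv ℝ φ z‖ ≤ C := by
    obtain ⟨C₁, h1, h1'⟩ := (SchwartzMap.fderivCLM ℝ Plane ℝ φ).decay 4 0
    obtain ⟨C₂, h2, h2'⟩ := (SchwartzMap.fderivCLM ℝ Plane ℝ φ).decay 0 0
    refine ⟨C₁ + C₂, by positivity, fun z => ?_⟩
    have := h1' z
    have := h2' z
    simp only [norm_iteratedFDeriv_zero, SchwartzMap.fderivCLM_apply, pow_zero, one_mul] at *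
    linarith
  have hB0 : 0 ≤ B := (abs_nonneg _).trans (hB 0)
  have hcont : Continuous (fun z => fderiv ℝ φ z) :=
    (SchwartzMap.fderivCLM ℝ Plane ℝ φ).continuous
  have hint : Integrable (fun y => B * (C * 64 * (1 + ‖x - y‖) ^ (-(3 : ℝ)))) := by
    refine ((Integrable.comp_sub_left (f := fun z : Plane => (1 + ‖z‖) ^ (-(3 : ℝ))) ?_ x).const_mul
      (C * 64)).const_mul B
    exact integrable_one_add_norm (by simp; norm_num)
  have key : ∀ z w : Plane, ‖z - w‖ ≤ 1 →
      ‖fderiv ℝ φ w‖ ≤ C * 64 * (1 + ‖z‖) ^ (-(3 : ℝ)) := by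
    intro z w hzw
    have h1 : 1 + ‖z‖ ≤ 2 + ‖w‖ := by
      have := norm_le_norm_add_norm_sub' z w
      linarith
    have h2 : (1 + ‖z‖) ^ 3 ≤ 64 * (‖w‖ ^ 4 + 1) := by
      have hw := norm_nonneg w
      calc (1 + ‖z‖) ^ 3 ≤ (2 + ‖w‖) ^ 3 := by gcongr
        _ ≤ _ := by
          nlinarith [sq_nonneg (‖w‖ - 1), sq_nonneg (‖w‖ ^ 2 - ‖w‖), sq_nonneg (‖w‖ ^ 2 - 1),
            pow_nonneg hw 3]
    rw [Real.rpow_neg (by positivity), ← div_eq_mul_inv, le_div_iff₀ (by positivity)]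
    have h3 : (1 + ‖z‖) ^ (3 : ℝ) = (1 + ‖z‖) ^ 3 := by norm_cast
    rw [h3]
    calc ‖fderiv ℝ φ w‖ * (1 + ‖z‖) ^ 3 ≤ ‖fderiv ℝ φ w‖ * (64 * (‖w‖ ^ 4 + 1)) := by gcongr
      _ = 64 * (‖w‖ ^ 4 * ‖fderiv ℝ φ w‖ + ‖fderiv ℝ φ w‖) := by ring
      _ ≤ 64 * C := by gcongr; exact hC w
      _ = _ := by ring
  have hm : Continuous fun y => g y • fderiv ℝ φ (x - y) := by fun_prop
  have hbd : ∀ᵐ y : Plane, ∀ x' ∈ Metric.ball x 1,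
      ‖g y • fderiv ℝ φ (x' - y)‖ ≤ B * (C * 64 * (1 + ‖x - y‖) ^ (-(3 : ℝ))) := by
    refine ae_of_all _ fun y x' hx' => ?_
    rw [norm_smul]
    refine mul_le_mul (hB y) (key _ _ ?_) (norm_nonneg _) hB0
    rw [sub_sub_sub_cancel_right, ← dist_eq_norm, dist_comm]
    exact (Metric.mem_ball.1 hx').le
  have main := hasFDerivAt_integral_of_dominated_of_fderiv_le (μ := (volume : Measure Plane))
    (F := fun x y => g y * φ (x - y)) (F' := fun x y => g y • fderiv ℝ φ (x - y)) (x₀ := x)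
    (Metric.ball_mem_nhds x one_pos)
    (Eventually.of_forall fun x' => (integrable_conv hg hB φ x').aestronglyMeasurable)
    (integrable_conv hg hB φ x) hm.aestronglyMeasurable hbd hint
    (ae_of_all _ fun y x' _ => by
      have h1 : HasFDerivAt (fun x => φ (x - y)) (fderiv ℝ φ (x' - y)) x' := by
        have h2 := (φ.hasFDerivAt (x' - y)).comp x' ((hasFDerivAt_id x').sub_const y)
        rwa [ContinuousLinearMap.comp_id] at h2
      exact h1.const_mul (g y))
  refine ⟨_, main, fun m => ?_⟩
  rw [ContinuousLinearMap.integral_apply]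
  · rfl
  · exact hint.mono' hm.aestronglyMeasurable (hbd.mono fun y hy =>
      hy x (Metric.mem_ball_self one_pos))

theorem lineDeriv_conv {g : Plane → ℝ} (hg : Continuous g) {B : ℝ} (hB : ∀ x, |g x| ≤ B)
    (φ : 𝓢(Plane, ℝ)) (x m : Plane) : lineDeriv ℝ (conv g φ) x m = conv g (∂_{m} φ) x := by
  obtain ⟨L, hL, hm⟩ := hasFDerivAt_conv hg hB φ x
  rw [← hm, (hL.hasLineDerivAt m).lineDeriv]

theorem conv_sub_left {g h : Plane → ℝ} (φ : 𝓢(Plane, ℝ)) (x : Plane)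
    (hg : Integrable (fun y => g y * φ (x - y))) (hh : Integrable (fun y => h y * φ (x - y))) :
    conv (fun y => g y - h y) φ x = conv g φ x - conv h φ x := by
  simp only [conv, sub_mul]
  exact integral_sub hg hh

theorem conv_sum_mul_left {I : ℕ} (c : Fin I → ℝ) {g : Fin I → Plane → ℝ} (φ : 𝓢(Plane, ℝ))
    (x : Plane) (hg : ∀ i, Integrable (fun y => g i y * φ (x - y))) :
    conv (fun y => ∑ i, c i * g i y) φ x = ∑ i, c i * conv (g i) φ x := by
  simp only [conv, Finset.sum_mul, mul_assoc]
  rw [integral_finsetSum _ fun i _ => (hg i).const_mul (c i)]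
  simp only [integral_const_mul]

/-! ### The standard Gaussian measure -/

/-- The standard Gaussian measure on the line. -/
abbrev gauss : Measure ℝ := ProbabilityTheory.gaussianReal 0 1

/-- The exponent four suffices throughout: quadratic growth of the data meets at most the quadratic
factor `z² - 1` coming from two integrations by parts. -/
theorem integrable_gauss_weight : Integrable (fun z : ℝ => (1 + |z|) ^ 4) gauss := by
  have h1 : MemLp (fun z : ℝ => 1 + |z|) 4 gauss := by
    have h := (ProbabilityTheory.memLp_id_gaussianReal' (μ := 0) (v := 1) 4 (by simp)).norm
    exact (memLp_const (1 : ℝ)).add h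
  have h2 := h1.integrable_norm_pow (p := 4) (by norm_num)
  refine h2.congr (ae_of_all _ fun z => ?_)
  simp only [Real.norm_eq_abs]
  rw [abs_of_nonneg (by positivity : (0 : ℝ) ≤ 1 + |z|)]

/-- The fourth Gaussian moment of `1 + |z|`. -/
def gaussConst : ℝ := ∫ z, (1 + |z|) ^ 4 ∂gauss

theorem one_le_gaussConst : 1 ≤ gaussConst := by
  have h : ∫ _ : ℝ, (1 : ℝ) ∂gauss ≤ gaussConst :=
    integral_mono (integrable_const _) integrable_gauss_weight fun z =>
      one_le_pow₀ (by linarith [abs_nonneg z])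
  simpa using h

theorem integrable_gauss {h : ℝ → ℝ} (hc : Continuous h) {B : ℝ}
    (hB : ∀ z, |h z| ≤ B * (1 + |z|) ^ 4) : Integrable h gauss :=
  (integrable_gauss_weight.const_mul B).mono' hc.aestronglyMeasurable (ae_of_all _ hB)

theorem abs_integral_gauss_le {h : ℝ → ℝ} {B : ℝ}
    (hB : ∀ z, |h z| ≤ B * (1 + |z|) ^ 4) : |∫ z, h z ∂gauss| ≤ B * gaussConst := by
  rw [gaussConst, ← integral_const_mul, ← Real.norm_eq_abs]
  exact norm_integral_le_of_norm_le (integrable_gauss_weight.const_mul B) (ae_of_all _ hB)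

theorem integrable_gauss_iff {h : ℝ → ℝ} : Integrable h gauss ↔
    Integrable (fun z => ProbabilityTheory.gaussianPDFReal 0 1 z * h z) := by
  rw [gauss, ProbabilityTheory.gaussianReal_of_var_ne_zero 0 one_ne_zero]
  rw [integrable_withDensity_iff_integrable_smul' (by fun_prop)
    (by simp [ProbabilityTheory.gaussianPDF])]
  simp [ProbabilityTheory.toReal_gaussianPDF]

/-- Gaussian integration by parts. -/
theorem integral_gauss_mul_id {g g' : ℝ → ℝ} (hg : ∀ z, HasDerivAt g (g' z) z)
    (h0 : Integrable g gauss) (h1 : Integrable g' gauss)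
    (h2 : Integrable (fun z => z * g z) gauss) :
    ∫ z, z * g z ∂gauss = ∫ z, g' z ∂gauss := by
  have hd : ∀ z, HasDerivAt (ProbabilityTheory.gaussianPDFReal 0 1)
      (ProbabilityTheory.gaussianPDFReal 0 1 z * (-z)) z := by
    intro z
    rw [ProbabilityTheory.gaussianPDFReal_def]
    have e : HasDerivAt (fun x : ℝ => -(x - 0) ^ 2 / (2 * ((1 : NNReal) : ℝ))) (-z) z := by
      have := (((hasDerivAt_id z).sub_const 0).pow 2).neg.div_const (2 * ((1 : NNReal) : ℝ))
      refine this.congr_deriv ?_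
      simp only [id_eq, NNReal.coe_one]
      push_cast; ring
    refine ((e.exp).const_mul _).congr_deriv ?_
    ring
  rw [integrable_gauss_iff] at h0 h1 h2
  -- The derivative of density times `g` has integral zero, and the density has derivative `-z`
  -- times itself.
  have key := integral_eq_zero_of_hasDerivAt_of_integrable
    (fun z => (hd z).mul (hg z)) ?_ h0
  · rw [ProbabilityTheory.integral_gaussianReal_eq_integral_smul one_ne_zero,
      ProbabilityTheory.integral_gaussianReal_eq_integral_smul one_ne_zero]
    simp only [smul_eq_mul]
    rw [← sub_eq_zero, ← integral_sub h2 h1, ← neg_eq_zero, ← integral_neg]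
    refine Eq.trans (integral_congr_ae (ae_of_all _ fun z => ?_)) key
    simp only []; ring
  · refine (h1.sub h2).congr (ae_of_all _ fun z => ?_)
    simp only [Pi.sub_apply]; ring

/-! ### The heat flow along backward parabolas -/

/-- `w` is a function of time and space of at most linear growth, with bounded first derivatives
`wt`, `wp` and a bounded second space derivative `wpp`. -/
structure HeatReg (B : ℝ) (w wt wp wpp : ℝ → ℝ → ℝ) : Prop where
  hasFDerivAt : ∀ t p, HasFDerivAt (fun q : ℝ × ℝ => w q.1 q.2)
    (wt t p • ContinuousLinearMap.fst ℝ ℝ ℝ + wp t p • ContinuousLinearMap.snd ℝ ℝ ℝ) (t, p)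
  hasDerivAt : ∀ t p, HasDerivAt (wp t) (wpp t p) p
  continuous_wt : ∀ t, Continuous (wt t)
  continuous_wpp : ∀ t, Continuous (wpp t)
  bound : ∀ t p, |w t p| ≤ B * (1 + |p|)
  bound_wt : ∀ t p, |wt t p| ≤ B
  bound_wp : ∀ t p, |wp t p| ≤ B
  bound_wpp : ∀ t p, |wpp t p| ≤ B

namespace HeatReg

variable {B : ℝ} {w wt wp wpp : ℝ → ℝ → ℝ}

theorem nonneg (h : HeatReg B w wt wp wpp) : 0 ≤ B := (abs_nonneg _).trans (h.bound_wt 0 0)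

theorem hasDerivAt_space (h : HeatReg B w wt wp wpp) (t p : ℝ) : HasDerivAt (w t) (wp t p) p := by
  have h1 := (h.hasFDerivAt t p).comp_hasDerivAt p
    ((hasDerivAt_const p t).prodMk (hasDerivAt_id p))
  simpa [Function.comp_def] using h1

theorem continuous (h : HeatReg B w wt wp wpp) (t : ℝ) : Continuous (w t) :=
  continuous_iff_continuousAt.2 fun p => (h.hasDerivAt_space t p).continuousAt

theorem continuous_wp (h : HeatReg B w wt wp wpp) (t : ℝ) : Continuous (wp t) :=
  continuous_iff_continuousAt.2 fun p => (h.hasDerivAt t p).continuousAt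

/-- Extending one time slice constantly in time makes the flow formula applicable to the pure heat
evolution of that slice. -/
theorem steady (h : HeatReg B w wt wp wpp) (t : ℝ) :
    HeatReg B (fun _ => w t) (fun _ _ => 0) (fun _ => wp t) (fun _ => wpp t) where
  hasFDerivAt := fun s p => by
    have := (h.hasDerivAt_space t p).comp_hasFDerivAt (s, p)
      (hasFDerivAt_snd (𝕜 := ℝ) (E := ℝ) (F := ℝ))
    simpa [Function.comp_def] using this
  hasDerivAt := fun _ p => h.hasDerivAt t p
  continuous_wt := fun _ => continuous_const
  continuous_wpp := fun _ => h.continuous_wpp t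
  bound := fun _ p => h.bound t p
  bound_wt := fun _ _ => by simpa using h.nonneg
  bound_wp := fun _ p => h.bound_wp t p
  bound_wpp := fun _ p => h.bound_wpp t p

theorem one_add_abs_sub_le (p c z : ℝ) : 1 + |p - c * z| ≤ (1 + |p| + |c|) * (1 + |z|) := by
  have := abs_sub p (c * z)
  rw [abs_mul] at this
  nlinarith [abs_nonneg p, abs_nonneg c, abs_nonneg z, mul_nonneg (abs_nonneg p) (abs_nonneg z)]

theorem integrable_w (h : HeatReg B w wt wp wpp) (t p c : ℝ) :
    Integrable (fun z => w t (p - c * z)) gauss := by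
  refine integrable_gauss (B := B * (1 + |p| + |c|)) ((h.continuous t).comp (by fun_prop))
    fun z => ?_
  have h1 : 1 + |z| ≤ (1 + |z|) ^ 4 := le_self_pow₀ (by linarith [abs_nonneg z]) (by norm_num)
  have hB := h.nonneg
  calc _ ≤ B * (1 + |p - c * z|) := h.bound _ _
    _ ≤ B * ((1 + |p| + |c|) * (1 + |z|)) := by gcongr; exact one_add_abs_sub_le p c z
    _ ≤ B * ((1 + |p| + |c|) * (1 + |z|) ^ 4) := by gcongr
    _ = _ := by ring

theorem integrable_bdd {g : ℝ → ℝ} (hg : Continuous g) (hb : ∀ p, |g p| ≤ B) (k : ℕ) (hk : k ≤ 4)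
    (p c : ℝ) : Integrable (fun z => z ^ k * g (p - c * z)) gauss := by
  refine integrable_gauss (B := B) (by fun_prop) fun z => ?_
  have h1 : |z| ^ k ≤ (1 + |z|) ^ 4 :=
    calc |z| ^ k ≤ (1 + |z|) ^ k := by gcongr; linarith
      _ ≤ _ := pow_le_pow_right₀ (by linarith [abs_nonneg z]) hk
  rw [abs_mul, abs_pow, mul_comm]
  exact mul_le_mul (hb _) h1 (by positivity) ((abs_nonneg _).trans (hb 0))

/-- The average of `w` with respect to the heat kernel, seen along the backward parabola. -/
theorem hasDerivAt_flow (h : HeatReg B w wt wp wpp) (b t p s : ℝ) :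
    HasDerivAt (fun s => ∫ z, w (t - s ^ 2) (p - b * s * z) ∂gauss)
      (-(2 * s) * ∫ z, (wt (t - s ^ 2) (p - b * s * z)
        - b ^ 2 / 2 * wpp (t - s ^ 2) (p - b * s * z)) ∂gauss) s := by
  have hB := h.nonneg
  -- Elapsed time is `s²`, so the space displacement `b s z` is linear in `s` and the path is
  -- differentiable also at `s = 0`.
  have main := hasDerivAt_integral_of_dominated_loc_of_deriv_le (μ := gauss) (x₀ := s)
    (F := fun s z => w (t - s ^ 2) (p - b * s * z))
    (F' := fun s z => wt (t - s ^ 2) (p - b * s * z) * (-(2 * s))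
      + wp (t - s ^ 2) (p - b * s * z) * (-(b * z)))
    (bound := fun z => (B * (2 * (|s| + 1)) + B * |b|) * (1 + |z|) ^ 4)
    (Metric.ball_mem_nhds s one_pos)
    (Eventually.of_forall fun s' => (h.integrable_w _ p (b * s')).aestronglyMeasurable)
    (h.integrable_w _ p (b * s)) ?_ ?_ (integrable_gauss_weight.const_mul _) ?_
  · refine main.2.congr_deriv ?_
    have i0 := integrable_bdd (h.continuous_wt (t - s ^ 2)) (h.bound_wt _) 0 (by norm_num) p (b * s)
    have i1 := integrable_bdd (h.continuous_wp (t - s ^ 2)) (h.bound_wp _) 1 (by norm_num) p (b * s)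
    have i1' := integrable_bdd (h.continuous_wp (t - s ^ 2)) (h.bound_wp _) 0 (by norm_num)
      p (b * s)
    have i2 := integrable_bdd (h.continuous_wpp (t - s ^ 2)) (h.bound_wpp _) 0 (by norm_num)
      p (b * s)
    simp only [pow_zero, one_mul, pow_one] at i0 i1 i1' i2
    -- Integration by parts turns the chain-rule term with `z wp` into `b s wpp`, which has the same
    -- factor `s` as the time derivative; together they form the heat operator with coefficient
    -- `b²/2`.
    have st := integral_gauss_mul_id (g := fun z => wp (t - s ^ 2) (p - b * s * z))
      (g' := fun z => wpp (t - s ^ 2) (p - b * s * z) * (-(b * s))) (fun z => by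
        have e : HasDerivAt (fun z => p - b * s * z) (-(b * s)) z := by
          simpa using ((hasDerivAt_id z).const_mul (b * s)).const_sub p
        exact (h.hasDerivAt (t - s ^ 2) (p - b * s * z)).comp z e) i1' (i2.mul_const _) i1
    rw [integral_mul_const] at st
    rw [integral_sub i0 (i2.const_mul _), integral_add (i0.mul_const _), integral_mul_const,
      integral_const_mul]
    · have e2 : ∫ z, wp (t - s ^ 2) (p - b * s * z) * (-(b * z)) ∂gauss
          = -b * ∫ z, z * wp (t - s ^ 2) (p - b * s * z) ∂gauss := by
        rw [← integral_const_mul]; congr 1; ext z; ring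
      rw [e2, st]; ring
    · refine (i1.const_mul (-b)).congr (ae_of_all _ fun z => by ring)
  · have c1 := h.continuous_wt (t - s ^ 2)
    have c2 := h.continuous_wp (t - s ^ 2)
    exact Continuous.aestronglyMeasurable (by fun_prop)
  · refine ae_of_all _ fun z s' hs' => ?_
    have hs : |s'| ≤ |s| + 1 := by
      have h1 : |s' - s| < 1 := hs'
      have := abs_sub_abs_le_abs_sub s' s
      linarith
    have h1 : 1 ≤ (1 + |z|) ^ 4 := one_le_pow₀ (by linarith [abs_nonneg z])
    have h2 : |z| ≤ (1 + |z|) ^ 4 := by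
      have : 1 + |z| ≤ (1 + |z|) ^ 4 := le_self_pow₀ (by linarith [abs_nonneg z]) (by norm_num)
      linarith
    rw [Real.norm_eq_abs]
    calc _ ≤ |wt (t - s' ^ 2) (p - b * s' * z) * (-(2 * s'))|
          + |wp (t - s' ^ 2) (p - b * s' * z) * (-(b * z))| := abs_add_le _ _
      _ ≤ B * (2 * (|s| + 1)) + B * (|b| * |z|) := by
          rw [abs_mul, abs_mul, abs_neg, abs_neg, abs_mul, abs_mul, abs_two]
          gcongr
          · exact h.bound_wt _ _
          · exact h.bound_wp _ _
      _ ≤ B * (2 * (|s| + 1)) * (1 + |z|) ^ 4 + B * (|b| * (1 + |z|) ^ 4) := by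
          have : 0 ≤ B * (2 * (|s| + 1)) := by positivity
          exact add_le_add (le_mul_of_one_le_right this h1) (by gcongr)
      _ = _ := by ring
  · refine ae_of_all _ fun z s' _ => ?_
    have e1 : HasDerivAt (fun s => t - s ^ 2) (-(2 * s')) s' := by
      simpa using ((hasDerivAt_id s').pow 2).const_sub t
    have e2 : HasDerivAt (fun s => p - b * s * z) (-(b * z)) s' := by
      simpa using (((hasDerivAt_id s').const_mul b).mul_const z).const_sub p
    have := (h.hasFDerivAt (t - s' ^ 2) (p - b * s' * z)).comp_hasDerivAt s' (e1.prodMk e2)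
    simpa [Function.comp_def] using this

end HeatReg

/-! ### Duhamel bound and smoothing estimates for the Gaussian flow. -/

namespace HeatReg

variable {B : ℝ} {w wt wp wpp : ℝ → ℝ → ℝ}

/-- Since `b s ≤ 4R`, quadratic growth in `p / R` along the flow becomes quadratic growth in the
Gaussian variable, with a constant independent of the scale. -/
theorem weight_le {R b s p : ℝ} (hR : 0 < R) (hb0 : 0 ≤ b) (hb : b ≤ 2) (hs0 : 0 ≤ s)
    (hs : s ≤ 2 * R) (hp : |p| ≤ R) (z : ℝ) :
    (1 + |p - b * s * z| / R) ^ 2 ≤ 25 * (1 + |z|) ^ 2 := by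
  have h1 : |p - b * s * z| ≤ R + 4 * R * |z| := by
    have h2 := abs_sub p (b * s * z)
    rw [abs_mul (b * s), abs_of_nonneg (mul_nonneg hb0 hs0)] at h2
    have h3 : b * s ≤ 4 * R := by nlinarith
    nlinarith [abs_nonneg z]
  have h2 : 1 + |p - b * s * z| / R ≤ 5 * (1 + |z|) := by
    have : |p - b * s * z| / R ≤ 1 + 4 * |z| := by
      rw [div_le_iff₀ hR]; linarith
    linarith [abs_nonneg z]
  calc _ ≤ (5 * (1 + |z|)) ^ 2 := by gcongr
    _ = _ := by ring

/-- Duhamel's principle as a mean value inequality in `s`: at `s = 0` the average is `w t p`, and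
the derivative only sees the heat operator applied to `w`. -/
theorem abs_flow_sub_le (h : HeatReg B w wt wp wpp) {R b H : ℝ} (hR : 0 < R) (hb0 : 0 ≤ b)
    (hb : b ≤ 2) (hH : 0 ≤ H)
    (hh : ∀ t p, |t| ≤ R ^ 2 → |wt t p - b ^ 2 / 2 * wpp t p| ≤ H * (1 + |p| / R) ^ 2)
    {t p S : ℝ} (hS0 : 0 ≤ S) (hS : S ≤ 2 * R) (hp : |p| ≤ R) (ht : t ≤ R ^ 2)
    (htS : -R ^ 2 ≤ t - S ^ 2) :
    |∫ z, w (t - S ^ 2) (p - b * S * z) ∂gauss - w t p| ≤ 200 * gaussConst * R ^ 2 * H := by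
  have hg := one_le_gaussConst
  have main := (convex_Icc 0 S).norm_image_sub_le_of_norm_hasDerivWithin_le
    (f := fun s => ∫ z, w (t - s ^ 2) (p - b * s * z) ∂gauss) (C := 2 * S * (25 * H * gaussConst))
    (fun s _ => (h.hasDerivAt_flow b t p s).hasDerivWithinAt) (fun s hs => ?_)
    (Set.left_mem_Icc.2 hS0) (Set.right_mem_Icc.2 hS0)
  · simp only [Real.norm_eq_abs, sub_zero, abs_of_nonneg hS0, mul_zero, zero_mul, ne_eq,
      OfNat.ofNat_ne_zero, not_false_eq_true, zero_pow, integral_const, probReal_univ,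
      one_smul] at main
    refine main.trans ?_
    have : S * S ≤ (2 * R) * (2 * R) := mul_self_le_mul_self hS0 hS
    have h2 : 0 ≤ H * gaussConst := by positivity
    nlinarith
  · rw [norm_mul, norm_neg, Real.norm_eq_abs, Real.norm_eq_abs, abs_of_nonneg (by linarith [hs.1])]
    refine mul_le_mul (by linarith [hs.2]) ?_ (abs_nonneg _) (by linarith)
    refine abs_integral_gauss_le fun z => ?_
    have hs2 : s ^ 2 ≤ S ^ 2 := by nlinarith [hs.1, hs.2]
    have h1 := hh (t - s ^ 2) (p - b * s * z) (abs_le.2 ⟨by linarith, by nlinarith⟩)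
    have h2 := weight_le hR hb0 hb hs.1 (hs.2.trans hS) hp z
    have h3 : (1 + |z|) ^ 2 ≤ (1 + |z|) ^ 4 :=
      pow_le_pow_right₀ (by linarith [abs_nonneg z]) (by norm_num)
    calc _ ≤ _ := h1
      _ ≤ H * (25 * (1 + |z|) ^ 4) := by
        gcongr
        linarith
      _ = _ := by ring

/-- The first space derivative of the heat flow in terms of the initial data. -/
theorem integral_wp_eq (h : HeatReg B w wt wp wpp) (t p c : ℝ) :
    ∫ z, z * w t (p - c * z) ∂gauss = -c * ∫ z, wp t (p - c * z) ∂gauss := by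
  have hB := h.nonneg
  have e : ∀ z, HasDerivAt (fun z => w t (p - c * z)) (wp t (p - c * z) * (-c)) z := fun z => by
    have e : HasDerivAt (fun z => p - c * z) (-c) z := by
      simpa using ((hasDerivAt_id z).const_mul c).const_sub p
    exact (h.hasDerivAt_space t (p - c * z)).comp z e
  have i0 := h.integrable_w t p c
  have i1 := integrable_bdd (h.continuous_wp t) (h.bound_wp _) 0 (by norm_num) p c
  simp only [pow_zero, one_mul] at i1
  have cw := h.continuous t
  rw [integral_gauss_mul_id e i0 (i1.mul_const _), integral_mul_const, mul_comm]
  refine integrable_gauss (B := B * (1 + |p| + |c|)) (by fun_prop) fun z => ?_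
  have h1 : |z| * (1 + |z|) ≤ (1 + |z|) ^ 4 := by
    have h2 : (1 + |z|) ^ 2 ≤ (1 + |z|) ^ 4 :=
      pow_le_pow_right₀ (by linarith [abs_nonneg z]) (by norm_num)
    nlinarith [abs_nonneg z]
  rw [abs_mul]
  calc |z| * |w t (p - c * z)| ≤ |z| * (B * ((1 + |p| + |c|) * (1 + |z|))) := by
        gcongr
        exact (h.bound _ _).trans (by gcongr; exact one_add_abs_sub_le p c z)
    _ = B * (1 + |p| + |c|) * (|z| * (1 + |z|)) := by ring
    _ ≤ _ := by gcongr

/-- The second space derivative of the heat flow in terms of the initial data. -/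
theorem integral_wpp_eq (h : HeatReg B w wt wp wpp) (t p c : ℝ) :
    ∫ z, (z ^ 2 - 1) * w t (p - c * z) ∂gauss = c ^ 2 * ∫ z, wpp t (p - c * z) ∂gauss := by
  have hB := h.nonneg
  have cw := h.continuous t
  have cwp := h.continuous_wp t
  have e1 : ∀ z, HasDerivAt (fun z => p - c * z) (-c) z := fun z => by
      simpa using ((hasDerivAt_id z).const_mul c).const_sub p
  have e : ∀ z, HasDerivAt (fun z => w t (p - c * z)) (wp t (p - c * z) * (-c)) z := fun z =>
    (h.hasDerivAt_space t (p - c * z)).comp z (e1 z)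
  have e' : ∀ z, HasDerivAt (fun z => wp t (p - c * z)) (wpp t (p - c * z) * (-c)) z := fun z =>
    (h.hasDerivAt t (p - c * z)).comp z (e1 z)
  have i0 := h.integrable_w t p c
  have j0 := integrable_bdd (h.continuous_wp t) (h.bound_wp _) 0 (by norm_num) p c
  have j1 := integrable_bdd (h.continuous_wp t) (h.bound_wp _) 1 (by norm_num) p c
  have k0 := integrable_bdd (h.continuous_wpp t) (h.bound_wpp _) 0 (by norm_num) p c
  simp only [pow_zero, one_mul, pow_one] at j0 j1 k0
  have hw : ∀ z, |w t (p - c * z)| ≤ B * ((1 + |p| + |c|) * (1 + |z|)) := fun z =>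
    (h.bound _ _).trans (by gcongr; exact one_add_abs_sub_le p c z)
  have i1 : Integrable (fun z => z * w t (p - c * z)) gauss := by
    refine integrable_gauss (B := B * (1 + |p| + |c|)) (by fun_prop) fun z => ?_
    have h1 : |z| * (1 + |z|) ≤ (1 + |z|) ^ 4 := by
      have h2 : (1 + |z|) ^ 2 ≤ (1 + |z|) ^ 4 :=
        pow_le_pow_right₀ (by linarith [abs_nonneg z]) (by norm_num)
      nlinarith [abs_nonneg z]
    rw [abs_mul]
    calc |z| * |w t (p - c * z)| ≤ |z| * (B * ((1 + |p| + |c|) * (1 + |z|))) := by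
          gcongr
          exact hw z
      _ = B * (1 + |p| + |c|) * (|z| * (1 + |z|)) := by ring
      _ ≤ _ := by gcongr
  have i2 : Integrable (fun z => z * (z * w t (p - c * z))) gauss := by
    refine integrable_gauss (B := B * (1 + |p| + |c|)) (by fun_prop) fun z => ?_
    have h1 : |z| * (|z| * (1 + |z|)) ≤ (1 + |z|) ^ 4 := by
      have h2 : (1 + |z|) ^ 3 ≤ (1 + |z|) ^ 4 :=
        pow_le_pow_right₀ (by linarith [abs_nonneg z]) (by norm_num)
      nlinarith [abs_nonneg z, mul_nonneg (abs_nonneg z) (abs_nonneg z)]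
    rw [abs_mul, abs_mul]
    calc |z| * (|z| * |w t (p - c * z)|)
        ≤ |z| * (|z| * (B * ((1 + |p| + |c|) * (1 + |z|)))) := by
          gcongr
          exact hw z
      _ = B * (1 + |p| + |c|) * (|z| * (|z| * (1 + |z|))) := by ring
      _ ≤ _ := by gcongr
  have s1 := integral_gauss_mul_id e' j0 (k0.mul_const _) j1
  have i3 : Integrable (fun z => w t (p - c * z) + z * (wp t (p - c * z) * (-c))) gauss :=
    i0.add ((j1.mul_const (-c)).congr (ae_of_all _ fun z => by ring))
  have s2 := integral_gauss_mul_id (g := fun z => z * w t (p - c * z))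
    (g' := fun z => w t (p - c * z) + z * (wp t (p - c * z) * (-c)))
    (fun z => ((hasDerivAt_id z).mul (e z)).congr_deriv (by simp)) i1 i3 i2
  have hz : ∫ z, z * (wp t (p - c * z) * (-c)) ∂gauss
      = -c * ∫ z, z * wp t (p - c * z) ∂gauss := by
    rw [← integral_const_mul]; congr 1; ext z; ring
  rw [integral_add i0 ((j1.mul_const (-c)).congr (ae_of_all _ fun z => by ring)), hz, s1,
    integral_mul_const] at s2
  have hl : ∫ z, (z ^ 2 - 1) * w t (p - c * z) ∂gauss
      = ∫ z, z * (z * w t (p - c * z)) ∂gauss - ∫ z, w t (p - c * z) ∂gauss := by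
    rw [← integral_sub i2 i0]; congr 1; ext z; ring
  rw [hl, s2]; ring

/-- Smoothing of the heat flow: both derivatives fall on the Gaussian, at the price of the factor
`(b s)²`, so only the size of the slice enters. -/
theorem abs_integral_wpp_le (h : HeatReg B w wt wp wpp) {R b s p t A : ℝ} (hR : 0 < R)
    (hb0 : 0 ≤ b) (hb : b ≤ 2) (hs0 : 0 ≤ s) (hs : s ≤ 2 * R) (hp : |p| ≤ R)
    (hA : 0 ≤ A) (hw : ∀ p, |w t p| ≤ A * (1 + |p| / R) ^ 2) :
    (b * s) ^ 2 * |∫ z, wpp t (p - b * s * z) ∂gauss| ≤ 25 * gaussConst * A := by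
  have h1 := h.integral_wpp_eq t p (b * s)
  have h2 : |∫ z, (z ^ 2 - 1) * w t (p - b * s * z) ∂gauss| ≤ 25 * A * gaussConst := by
    refine abs_integral_gauss_le fun z => ?_
    have h3 := weight_le hR hb0 hb hs0 hs hp z
    have h4 : |z ^ 2 - 1| ≤ (1 + |z|) ^ 2 :=
      abs_le.2 ⟨by nlinarith [sq_nonneg z, abs_nonneg z], by nlinarith [sq_abs z, abs_nonneg z]⟩
    rw [abs_mul]
    calc _ ≤ (1 + |z|) ^ 2 * (A * (25 * (1 + |z|) ^ 2)) := by
          gcongr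
          exact (hw _).trans (by gcongr)
      _ = _ := by ring
  rw [h1, abs_mul, abs_of_nonneg (sq_nonneg (b * s))] at h2
  linarith

theorem abs_integral_wp_le (h : HeatReg B w wt wp wpp) {R b s p t A : ℝ} (hR : 0 < R)
    (hb0 : 0 ≤ b) (hb : b ≤ 2) (hs0 : 0 ≤ s) (hs : s ≤ 2 * R) (hp : |p| ≤ R)
    (hA : 0 ≤ A) (hw : ∀ p, |w t p| ≤ A * (1 + |p| / R) ^ 2) :
    b * s * |∫ z, wp t (p - b * s * z) ∂gauss| ≤ 25 * gaussConst * A := by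
  have h1 := h.integral_wp_eq t p (b * s)
  have h2 : |∫ z, z * w t (p - b * s * z) ∂gauss| ≤ 25 * A * gaussConst := by
    refine abs_integral_gauss_le fun z => ?_
    have h3 := weight_le hR hb0 hb hs0 hs hp z
    have h4 : |z| ≤ (1 + |z|) ^ 2 := by nlinarith [abs_nonneg z]
    rw [abs_mul]
    calc _ ≤ (1 + |z|) ^ 2 * (A * (25 * (1 + |z|) ^ 2)) := by
          gcongr
          exact (hw _).trans (by gcongr)
      _ = _ := by ring
  rw [h1, abs_mul, abs_neg, abs_of_nonneg (mul_nonneg hb0 hs0)] at h2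
  linarith

theorem hasDerivAt_integral_space {g g' : ℝ → ℝ} (hg : ∀ p, HasDerivAt g (g' p) p)
    (hc' : Continuous g') (hb' : ∀ p, |g' p| ≤ B) (c p : ℝ)
    (hi : ∀ p, Integrable (fun z => g (p - c * z)) gauss) :
    HasDerivAt (fun p => ∫ z, g (p - c * z) ∂gauss) (∫ z, g' (p - c * z) ∂gauss) p := by
  refine (hasDerivAt_integral_of_dominated_loc_of_deriv_le (μ := gauss) (x₀ := p)
    (F := fun p z => g (p - c * z)) (F' := fun p z => g' (p - c * z)) (bound := fun _ => B)
    (Metric.ball_mem_nhds p one_pos)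
    (Eventually.of_forall fun p' => (hi p').aestronglyMeasurable) (hi p) ?_ ?_
    (integrable_const _) ?_).2
  · exact Continuous.aestronglyMeasurable (by fun_prop)
  · exact ae_of_all _ fun z p' _ => hb' _
  · exact ae_of_all _ fun z p' _ => by
      simpa [Function.comp_def] using
        (hg (p' - c * z)).comp p' ((hasDerivAt_id p').sub_const (c * z))

/-- For the steady extension the flow derivative is `b² s` times the average of `wpp`. Integrating
in `s` produces the difference of elapsed times `s² - R²`, which is of order `r²`. -/
theorem abs_flow_initial_sub_le (h : HeatReg B w wt wp wpp) {R a b p t₀ J s r : ℝ} (hR : 0 < R)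
    (hbsq : b ^ 2 = 2 * a) (ha0 : 0 ≤ a) (ha1 : a ≤ 1) (hJ0 : 0 ≤ J)
    (hJ : ∀ s, R / 2 ≤ s → s ≤ 2 * R → |∫ z, wpp t₀ (p - b * s * z) ∂gauss| ≤ J)
    (hsR' : R / 2 ≤ s) (hsR : s ≤ 2 * R) (hr : |s ^ 2 - R ^ 2| ≤ r ^ 2) :
    |∫ z, w t₀ (p - b * s * z) ∂gauss - ∫ z, w t₀ (p - b * R * z) ∂gauss| ≤ 4 * J * r ^ 2 := by
  have main := (convex_Icc (R / 2) (2 * R)).norm_image_sub_le_of_norm_hasDerivWithin_le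
    (f := fun s => ∫ z, w t₀ (p - b * s * z) ∂gauss) (C := 4 * R * J)
    (fun s _ => ((h.steady t₀).hasDerivAt_flow b 0 p s).hasDerivWithinAt)
    (fun s hs => ?_)
    (⟨by linarith, by linarith⟩ : R ∈ Set.Icc (R / 2) (2 * R))
    (⟨hsR', hsR⟩ : s ∈ Set.Icc (R / 2) (2 * R))
  · simp only [Real.norm_eq_abs] at main
    refine main.trans ?_
    have h1 : |s - R| * R ≤ r ^ 2 := by
      have : |s - R| * (s + R) = |s ^ 2 - R ^ 2| := by
        rw [show s ^ 2 - R ^ 2 = (s - R) * (s + R) by ring, abs_mul,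
          abs_of_nonneg (by linarith : 0 ≤ s + R)]
      nlinarith [abs_nonneg (s - R)]
    nlinarith
  · have h1 := hJ s hs.1 hs.2
    simp only [zero_sub]
    rw [integral_neg, integral_const_mul, norm_mul, norm_neg, norm_neg, Real.norm_eq_abs,
      Real.norm_eq_abs, abs_mul (b ^ 2 / 2),
      abs_of_nonneg (by linarith [hs.1] : 0 ≤ 2 * s), hbsq,
      abs_of_nonneg (by linarith : 0 ≤ 2 * a / 2)]
    have h2 : 2 * a / 2 * |∫ z, wpp t₀ (p - b * s * z) ∂gauss| ≤ 1 * J :=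
      mul_le_mul (by linarith) h1 (abs_nonneg _) zero_le_one
    rw [one_mul] at h2
    exact mul_le_mul (by linarith [hs.2]) h2 (by positivity) (by linarith)

end HeatReg

/-! ### Comparison with affine functions of the space variable. -/

theorem abs_taylor_le {G G' G'' : ℝ → ℝ} (h1 : ∀ q, HasDerivAt G (G' q) q)
    (h2 : ∀ q, HasDerivAt G' (G'' q) q) {J r : ℝ} (hr : 0 < r) (hJ : 0 ≤ J)
    (hb : ∀ q, |q| ≤ r → |G'' q| ≤ J) {p : ℝ} (hp : |p| ≤ r) :
    |G p - G 0 - G' 0 * p| ≤ J * r ^ 2 := by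
  have hball : ∀ q, |q| ≤ r → |G' q - G' 0| ≤ J * r := by
    intro q hq
    have main := (convex_Icc (-r) r).norm_image_sub_le_of_norm_hasDerivWithin_le
      (f := G') (C := J) (fun q _ => (h2 q).hasDerivWithinAt) (fun q hq => hb q (abs_le.2 hq))
      (⟨by linarith, hr.le⟩ : (0 : ℝ) ∈ Set.Icc (-r) r) (abs_le.1 hq : q ∈ Set.Icc (-r) r)
    simp only [Real.norm_eq_abs, sub_zero] at main
    exact main.trans (by gcongr)
  have main := (convex_Icc (-r) r).norm_image_sub_le_of_norm_hasDerivWithin_le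
    (f := fun q => G q - G' 0 * q) (f' := fun q => G' q - G' 0) (C := J * r)
    (fun q _ => ((h1 q).sub (by simpa using (hasDerivAt_id q).const_mul (G' 0))).hasDerivWithinAt)
    (fun q hq => hball q (abs_le.2 hq))
    (⟨by linarith, hr.le⟩ : (0 : ℝ) ∈ Set.Icc (-r) r) (abs_le.1 hp : p ∈ Set.Icc (-r) r)
  simp only [Real.norm_eq_abs, sub_zero, mul_zero] at main
  calc |G p - G 0 - G' 0 * p| = |G p - G' 0 * p - G 0| := by congr 1; ring
    _ ≤ _ := main
    _ ≤ J * r * r := by gcongr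
    _ = _ := by ring

open HeatReg in
/-- Approximation of a solution of the heat equation by affine functions. -/
theorem heat_taylor (lam : ℝ) (hlam : 0 < lam) : ∃ C : ℝ, 0 < C ∧
    ∀ (a B : ℝ) (w wt wp wpp : ℝ → ℝ → ℝ) (R A H : ℝ), lam ≤ a → a ≤ 1 →
      HeatReg B w wt wp wpp → 0 < R → 0 ≤ A → 0 ≤ H →
      (∀ p, |w (-R ^ 2) p| ≤ A * (1 + |p| / R) ^ 2) →
      (∀ t p, |t| ≤ R ^ 2 → |wt t p - a * wpp t p| ≤ H * (1 + |p| / R) ^ 2) →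
      ∃ c m : ℝ, |m| ≤ C * A / R ∧ ∀ r t p, 0 < r → r ≤ R / 2 → |t| ≤ r ^ 2 → |p| ≤ r →
        |w t p - c - m * p| ≤ C * (A * (r / R) ^ 2 + R ^ 2 * H) := by
  have hg := one_le_gaussConst
  set g := gaussConst
  refine ⟨200 * g + 25 * g / √lam + 300 * g / lam, by positivity, ?_⟩
  intro a B w wt wp wpp R A H hla ha1 h hR hA hH hw hh
  -- A Gaussian of standard deviation `b s` is the heat kernel of `∂₂ - a ∂₁²` after time `s²`
  -- exactly when `b²/2 = a`.
  set b : ℝ := √(2 * a) with hbdef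
  have ha0 : 0 < a := hlam.trans_le hla
  have hb0 : 0 ≤ b := Real.sqrt_nonneg _
  have hbsq : b ^ 2 = 2 * a := Real.sq_sqrt (by linarith)
  have hb2 : b ≤ 2 := by nlinarith
  have hblam : √lam ≤ b := Real.sqrt_le_sqrt (by linarith)
  have hsl : 0 < √lam := Real.sqrt_pos.2 hlam
  have hbpos : 0 < b := hsl.trans_le hblam
  have hh' : ∀ t p, |t| ≤ R ^ 2 → |wt t p - b ^ 2 / 2 * wpp t p| ≤ H * (1 + |p| / R) ^ 2 := by
    intro t p ht
    have e : b ^ 2 / 2 = a := by rw [hbsq]; ring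
    rw [e]; exact hh t p ht
  -- Value and slope at the origin of the heat evolution of the slice at time `-R²`.
  refine ⟨∫ z, w (-R ^ 2) (0 - b * R * z) ∂gauss, ∫ z, wp (-R ^ 2) (0 - b * R * z) ∂gauss, ?_, ?_⟩
  · have h1 := h.abs_integral_wp_le hR hb0 hb2 hR.le (by linarith) (by simpa using hR.le) hA hw
      (p := 0)
    have h2 : |∫ z, wp (-R ^ 2) (0 - b * R * z) ∂gauss| ≤ 25 * g * A / (√lam * R) := by
      rw [le_div_iff₀ (by positivity)]
      calc _ ≤ |∫ z, wp (-R ^ 2) (0 - b * R * z) ∂gauss| * (b * R) := by gcongr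
        _ ≤ _ := by linarith
    refine h2.trans ?_
    have e : 25 * g * A / (√lam * R) = 25 * g / √lam * A / R := by field_simp
    rw [e]
    gcongr
    have : 0 ≤ 300 * g / lam := by positivity
    linarith
  · intro r t p hr hrR ht hp
    have hr2 : r ^ 2 ≤ R ^ 2 / 4 := by nlinarith
    have ht' := abs_le.1 ht
    have hpR : |p| ≤ R := hp.trans (by linarith)
    -- The flow started at time `t` is run until it reaches the slice at time `-R²`.
    set s := √(t + R ^ 2) with hs
    have hs2 : s ^ 2 = t + R ^ 2 := Real.sq_sqrt (by nlinarith)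
    have hs0 : 0 ≤ s := Real.sqrt_nonneg _
    have hsR : s ≤ 2 * R := by nlinarith
    have hsR' : R / 2 ≤ s := by nlinarith
    have d1 := h.abs_flow_sub_le hR hb0 hb2 hH hh' hs0 hsR hpR (t := t) (by nlinarith)
      (by rw [hs2]; linarith)
    have e0 : t - s ^ 2 = -R ^ 2 := by rw [hs2]; ring
    rw [e0] at d1
    -- second derivative bound
    have hJ : ∀ s p, R / 2 ≤ s → s ≤ 2 * R → |p| ≤ R →
        |∫ z, wpp (-R ^ 2) (p - b * s * z) ∂gauss| ≤ 50 * g * A / (lam * R ^ 2) := by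
      intro s p h1 h2 h3
      have h4 := h.abs_integral_wpp_le hR hb0 hb2 (by linarith) h2 h3 hA hw
      rw [le_div_iff₀ (by positivity)]
      have h5 : lam * R ^ 2 ≤ 2 * (b * s) ^ 2 := by
        rw [mul_pow, hbsq]
        have : R ^ 2 ≤ 4 * s ^ 2 := by nlinarith
        nlinarith [sq_nonneg s, mul_le_mul hla this (by positivity) ha0.le]
      calc _ ≤ |∫ z, wpp (-R ^ 2) (p - b * s * z) ∂gauss| * (2 * (b * s) ^ 2) := by gcongr
        _ ≤ _ := by linarith
    have hr2' : |s ^ 2 - R ^ 2| ≤ r ^ 2 := by rw [hs2]; simpa using ht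
    set J := 50 * g * A / (lam * R ^ 2) with hJdef
    have hJ0 : 0 ≤ J := by positivity
    -- variation in the time-like parameter
    have d2 : |∫ z, w (-R ^ 2) (p - b * s * z) ∂gauss - ∫ z, w (-R ^ 2) (p - b * R * z) ∂gauss|
        ≤ 4 * J * r ^ 2 := by
      exact h.abs_flow_initial_sub_le hR hbsq ha0.le ha1 hJ0 (fun s h1 h2 => hJ s p h1 h2 hpR)
        hsR' hsR hr2'
    -- variation in space
    have hdp : ∀ q, HasDerivAt (fun q => ∫ z, w (-R ^ 2) (q - b * R * z) ∂gauss)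
        (∫ z, wp (-R ^ 2) (q - b * R * z) ∂gauss) q := fun q =>
      hasDerivAt_integral_space (h.hasDerivAt_space (-R ^ 2)) (h.continuous_wp _) (h.bound_wp _)
        (b * R) q fun p => h.integrable_w _ p _
    have hdpp : ∀ q, HasDerivAt (fun q => ∫ z, wp (-R ^ 2) (q - b * R * z) ∂gauss)
        (∫ z, wpp (-R ^ 2) (q - b * R * z) ∂gauss) q := fun q =>
      hasDerivAt_integral_space (h.hasDerivAt (-R ^ 2)) (h.continuous_wpp _) (h.bound_wpp _)
        (b * R) q fun p => by
          simpa using integrable_bdd (h.continuous_wp (-R ^ 2)) (h.bound_wp _) 0 (by norm_num)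
            p (b * R)
    set G := fun q => ∫ z, w (-R ^ 2) (q - b * R * z) ∂gauss
    set G' := fun q => ∫ z, wp (-R ^ 2) (q - b * R * z) ∂gauss
    have d3 : |G p - G 0 - G' 0 * p| ≤ J * r ^ 2 :=
      abs_taylor_le hdp hdpp hr hJ0
        (fun q hq => hJ R q (by linarith) (by linarith) (hq.trans (by linarith))) hp
    have tri : |w t p - G 0 - G' 0 * p| ≤ 200 * g * R ^ 2 * H + 4 * J * r ^ 2 + J * r ^ 2 := by
      have e : w t p - G 0 - G' 0 * p
          = -(∫ z, w (-R ^ 2) (p - b * s * z) ∂gauss - w t p)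
            + (∫ z, w (-R ^ 2) (p - b * s * z) ∂gauss - G p) + (G p - G 0 - G' 0 * p) := by ring
      rw [e]
      refine (abs_add_le _ _).trans (add_le_add ((abs_add_le _ _).trans (add_le_add ?_ d2)) d3)
      rw [abs_neg]; exact d1
    refine tri.trans ?_
    have e1 : 4 * J * r ^ 2 + J * r ^ 2 = 250 * g / lam * (A * (r / R) ^ 2) := by
      rw [hJdef]; field_simp; ring
    have p1 : 0 ≤ A * (r / R) ^ 2 := by positivity
    have p2 : 0 ≤ R ^ 2 * H := by positivity
    have p3 : 0 ≤ g / lam := by positivity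
    have p4 : 0 ≤ 25 * g / √lam := by positivity
    have e2 : 250 * g / lam = 250 * (g / lam) := by ring
    have e3 : 300 * g / lam = 300 * (g / lam) := by ring
    rw [e2] at e1
    rw [e3, add_assoc, e1]
    have e4 : 200 * g * R ^ 2 * H = 200 * g * (R ^ 2 * H) := by ring
    rw [e4]
    generalize A * (r / R) ^ 2 = P at *
    generalize R ^ 2 * H = Q at *
    generalize g / lam = k at *
    generalize 25 * g / √lam = D at *
    have : 0 ≤ 200 * g * P + D * (P + Q) + 50 * (k * P) + 300 * (k * Q) := by positivity
    linarith

/-! ### Coordinates around a point -/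

/-- The point with parabolic coordinates `(p, t)` relative to `x`. -/
def pointAt (x : Plane) (t p : ℝ) : Plane := x + (p • e₁ + t • e₂)

@[simp] theorem pointAt_zero (x : Plane) (t p : ℝ) : pointAt x t p 0 = x 0 + p := by
  simp [pointAt, e₁, e₂]

@[simp] theorem pointAt_one (x : Plane) (t p : ℝ) : pointAt x t p 1 = x 1 + t := by
  simp [pointAt, e₁, e₂]

theorem pointAt_sub (x y : Plane) : pointAt x ((y - x) 1) ((y - x) 0) = y := by
  ext i; fin_cases i <;> simp

theorem pointAt_zero_zero (x : Plane) : pointAt x 0 0 = x := by simp [pointAt]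

/-- The constant `B'` is purely qualitative: it justifies differentiation under integrals and never
enters an estimate. -/
theorem heatReg_conv {g : Plane → ℝ} (hg : Continuous g) {B : ℝ} (hB : ∀ x, |g x| ≤ B)
    (φ : 𝓢(Plane, ℝ)) (x : Plane) (c m : ℝ) : ∃ B', HeatReg B'
      (fun t p => conv g φ (pointAt x t p) - c - m * p)
      (fun t p => conv g (∂_{e₂} φ) (pointAt x t p))
      (fun t p => conv g (∂_{e₁} φ) (pointAt x t p) - m)
      (fun t p => conv g (∂_{e₁} (∂_{e₁} φ)) (pointAt x t p)) := by
  have hB0 : 0 ≤ B := (abs_nonneg _).trans (hB 0)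
  have hL : ∀ χ : 𝓢(Plane, ℝ), ∀ t p, HasFDerivAt (fun q : ℝ × ℝ => conv g χ (pointAt x q.1 q.2))
      (conv g (∂_{e₂} χ) (pointAt x t p) • ContinuousLinearMap.fst ℝ ℝ ℝ
        + conv g (∂_{e₁} χ) (pointAt x t p) • ContinuousLinearMap.snd ℝ ℝ ℝ) (t, p) := by
    intro χ t p
    obtain ⟨L, hL, hm⟩ := hasFDerivAt_conv hg hB χ (pointAt x t p)
    have h1 : HasFDerivAt (fun q : ℝ × ℝ => pointAt x q.1 q.2)
        ((ContinuousLinearMap.snd ℝ ℝ ℝ).smulRight e₁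
          + (ContinuousLinearMap.fst ℝ ℝ ℝ).smulRight e₂) (t, p) :=
      (((ContinuousLinearMap.snd ℝ ℝ ℝ).hasFDerivAt.smul_const e₁).add
        ((ContinuousLinearMap.fst ℝ ℝ ℝ).hasFDerivAt.smul_const e₂)).const_add x
    have hz : conv g 0 (pointAt x t p) = 0 := by simp [conv]
    refine (hL.comp (t, p) h1).congr_fderiv ?_
    ext <;> simp [hm, hz]
  have hP : ∀ χ : 𝓢(Plane, ℝ), ∀ t p, HasDerivAt (fun p => conv g χ (pointAt x t p))
      (conv g (∂_{e₁} χ) (pointAt x t p)) p := by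
    intro χ t p
    have := (hL χ t p).comp_hasDerivAt p ((hasDerivAt_const p t).prodMk (hasDerivAt_id p))
    simpa [Function.comp_def] using this
  have hC : ∀ χ : 𝓢(Plane, ℝ), ∀ t, Continuous (fun p => conv g χ (pointAt x t p)) := fun χ t =>
    continuous_iff_continuousAt.2 fun p => (hP χ t p).continuousAt
  set b : 𝓢(Plane, ℝ) → ℝ := fun χ => B * ∫ z, |χ z|
  have hb : ∀ χ y, |conv g χ y| ≤ b χ := fun χ y => abs_conv_le hB χ y
  have hb0 : ∀ χ, 0 ≤ b χ := fun χ => (abs_nonneg _).trans (hb χ 0)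
  refine ⟨b φ + b (∂_{e₂} φ) + b (∂_{e₁} φ) + b (∂_{e₁} (∂_{e₁} φ)) + |c| + |m|, ?_⟩
  have n1 := hb0 φ
  have n2 := hb0 (∂_{e₂} φ)
  have n3 := hb0 (∂_{e₁} φ)
  have n4 := hb0 (∂_{e₁} (∂_{e₁} φ))
  have nc := abs_nonneg c
  have nm := abs_nonneg m
  refine ⟨fun t p => ?_, fun t p => (hP _ t p).sub_const m, fun t => hC _ t, fun t => hC _ t,
    fun t p => ?_, fun t p => ?_, fun t p => ?_, fun t p => ?_⟩
  · have h2 : HasFDerivAt (fun q : ℝ × ℝ => m * q.2) (m • ContinuousLinearMap.snd ℝ ℝ ℝ) (t, p) :=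
      (ContinuousLinearMap.snd ℝ ℝ ℝ).hasFDerivAt.const_mul m
    refine (((hL φ t p).sub_const c).sub h2).congr_fderiv ?_
    ext <;> simp
  · have h1 := hb φ (pointAt x t p)
    have h2 := abs_sub (conv g φ (pointAt x t p) - c) (m * p)
    have h3 := abs_sub (conv g φ (pointAt x t p)) c
    rw [abs_mul] at h2
    have := abs_nonneg p
    have : 0 ≤ (b φ + b (∂_{e₂} φ) + b (∂_{e₁} φ) + b (∂_{e₁} (∂_{e₁} φ)) + |c|) * |p| := by
      positivity
    nlinarith
  · have := hb (∂_{e₂} φ) (pointAt x t p)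
    linarith
  · have := hb (∂_{e₁} φ) (pointAt x t p)
    have := abs_sub (conv g (∂_{e₁} φ) (pointAt x t p)) m
    linarith
  · have := hb (∂_{e₁} (∂_{e₁} φ)) (pointAt x t p)
    linarith

/-- Affine approximation of smooth functions in terms of the size of `(∂₂ - a ∂₁²) w`. -/
theorem conv_taylor (lam : ℝ) (hlam : 0 < lam) : ∃ C : ℝ, 0 < C ∧
    ∀ (a B : ℝ) (g : Plane → ℝ) (φ : 𝓢(Plane, ℝ)) (x : Plane) (c m R A H : ℝ), lam ≤ a → a ≤ 1 →
      Continuous g → (∀ x, |g x| ≤ B) → 0 < R → 0 ≤ A → 0 ≤ H →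
      (∀ y : Plane, (y - x) 1 = -R ^ 2 →
        |conv g φ y - c - m * (y - x) 0| ≤ A * (1 + |(y - x) 0| / R) ^ 2) →
      (∀ y : Plane, |(y - x) 1| ≤ R ^ 2 →
        |conv g (∂_{e₂} φ) y - a * conv g (∂_{e₁} (∂_{e₁} φ)) y|
          ≤ H * (1 + |(y - x) 0| / R) ^ 2) →
      ∃ c' m' : ℝ, |m' - m| ≤ C * A / R ∧ ∀ r y, 0 < r → r ≤ R / 2 → pdist y x ≤ r →
        |conv g φ y - c' - m' * (y - x) 0| ≤ C * (A * (r / R) ^ 2 + R ^ 2 * H) := by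
  obtain ⟨C, hC, h⟩ := heat_taylor lam hlam
  refine ⟨C, hC, ?_⟩
  intro a B g φ x c m R A H hla ha1 hg hB hR hA hH hw hh
  obtain ⟨B', hreg⟩ := heatReg_conv hg hB φ x c m
  obtain ⟨c', m', hm', hcm⟩ := h a B' _ _ _ _ R A H hla ha1 hreg hR hA hH
    (fun p => by simpa using hw (pointAt x (-R ^ 2) p) (by simp))
    (fun t p ht => by simpa using hh (pointAt x t p) (by simpa using ht))
  refine ⟨c + c', m + m', by simpa using hm', fun r y hr hrR hy => ?_⟩
  have hp : |(y - x) 0| ≤ r := (abs_apply_zero_le_pnorm _).trans hy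
  have ht : |(y - x) 1| ≤ r ^ 2 := by
    have h1 : √|(y - x) 1| ≤ r := by
      have : pnorm (y - x) ≤ r := hy
      unfold pnorm at this
      linarith [abs_nonneg ((y - x) 0)]
    exact (Real.sqrt_le_left hr.le).1 h1
  have := hcm r ((y - x) 1) ((y - x) 0) hr hrR ht hp
  rw [pointAt_sub] at this
  convert this using 2
  ring

/-! ### The maximum principle -/

/-- A positive second derivative would make the point a local minimum as well, so `f` would be
locally constant, contradicting positivity. -/
theorem second_deriv_nonpos_of_isLocalMax {f f' : ℝ → ℝ} {f'' p : ℝ}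
    (h1 : ∀ q, HasDerivAt f (f' q) q) (h2 : HasDerivAt f' f'' p) (hm : IsLocalMax f p) :
    f'' ≤ 0 := by
  by_contra! hpos
  have e1 : deriv f = f' := funext fun q => (h1 q).deriv
  have hmin : IsLocalMin f p := isLocalMin_of_deriv_deriv_pos (by rw [e1, h2.deriv]; exact hpos)
    hm.deriv_eq_zero (h1 p).continuousAt
  have hc : f =ᶠ[𝓝 p] fun _ => f p := by
    filter_upwards [hm, hmin] with q ha hb using le_antisymm ha hb
  have h3 : deriv (deriv f) p = 0 := by
    rw [hc.deriv.deriv_eq]; simp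
  rw [e1, h2.deriv] at h3
  linarith

/-- Subtracting `ε² (t² + p²)` forces a maximum to be attained. There `wt` is of order `ε` and `wpp
≤ 2ε²`, so the inequality for the operator bounds `w`; then `ε → 0`. No regularity of the
coefficient is needed. -/
theorem le_of_heatReg {B M G a' : ℝ} {w wt wp wpp : ℝ → ℝ → ℝ} (h : HeatReg B w wt wp wpp)
    (hM : ∀ t p, |w t p| ≤ M) (a : ℝ → ℝ → ℝ) (ha0 : ∀ t p, 0 ≤ a t p) (ha1 : ∀ t p, a t p ≤ a')
    (hG : ∀ t p, wt t p - a t p * wpp t p + w t p ≤ G) : w 0 0 ≤ G := by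
  have hM0 : 0 ≤ M := (abs_nonneg _).trans (hM 0 0)
  have key : ∀ ε : ℝ, 0 < ε → w 0 0 ≤ G + 2 * a' * ε ^ 2 + 2 * √(2 * M) * ε := by
    intro ε hε
    set F : ℝ × ℝ → ℝ := fun q => w q.1 q.2 - ε ^ 2 * (q.1 ^ 2 + q.2 ^ 2) with hF
    have hFc : Continuous F := by
      have : Continuous (fun q : ℝ × ℝ => w q.1 q.2) :=
        continuous_iff_continuousAt.2 fun q => (h.hasFDerivAt q.1 q.2).continuousAt
      fun_prop
    -- Beyond radius `ρ` the penalty exceeds the oscillation `2M`, so such points cannot beat the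
    -- origin.
    obtain ⟨ρ, hρ0, hρ⟩ : ∃ ρ : ℝ, 0 ≤ ρ ∧ 2 * M ≤ ε ^ 2 * ρ ^ 2 := by
      refine ⟨√(2 * M) / ε, by positivity, ?_⟩
      rw [div_pow, Real.sq_sqrt (by positivity)]
      field_simp; rfl
    obtain ⟨q, -, hq⟩ := (isCompact_closedBall (0 : ℝ × ℝ) ρ).exists_isMaxOn
      ⟨0, by simpa using hρ0⟩ hFc.continuousOn
    have hmax : ∀ q', F q' ≤ F q := by
      intro q'
      by_cases hq' : q' ∈ Metric.closedBall (0 : ℝ × ℝ) ρ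
      · exact hq hq'
      · have h0 : F 0 ≤ F q := hq (by simpa using hρ0)
        refine le_trans ?_ h0
        rw [mem_closedBall_zero_iff, not_le, Prod.norm_def, lt_max_iff] at hq'
        have h1 : ρ ^ 2 ≤ q'.1 ^ 2 + q'.2 ^ 2 := by
          rcases hq' with h1 | h1
          · have : ρ ^ 2 ≤ q'.1 ^ 2 := by
              rw [← sq_abs q'.1]; exact pow_le_pow_left₀ hρ0 (le_of_lt h1) 2
            nlinarith [sq_nonneg q'.2]
          · have : ρ ^ 2 ≤ q'.2 ^ 2 := by
              rw [← sq_abs q'.2]; exact pow_le_pow_left₀ hρ0 (le_of_lt h1) 2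
            nlinarith [sq_nonneg q'.1]
        have h2 := (abs_le.1 (hM q'.1 q'.2)).2
        have h3 := (abs_le.1 (hM 0 0)).1
        have h4 : ε ^ 2 * ρ ^ 2 ≤ ε ^ 2 * (q'.1 ^ 2 + q'.2 ^ 2) := by gcongr
        simp only [hF, Prod.fst_zero, Prod.snd_zero]
        nlinarith
    obtain ⟨t, p⟩ := q
    have h00 := hmax (0, 0)
    simp only [hF] at h00
    have hb1 := (abs_le.1 (hM t p)).2
    have hb2 := (abs_le.1 (hM 0 0)).1
    -- Comparison with the value at the origin bounds the penalty at the maximum point by `2M`;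
    -- hence the time derivative `2ε² t` of the penalty is of order `ε`.
    have hsz : (ε * t) ^ 2 ≤ 2 * M := by nlinarith [sq_nonneg (ε * p)]
    have ht : |ε * t| ≤ √(2 * M) := Real.abs_le_sqrt hsz
    -- time derivative
    have hdt : HasDerivAt (fun s => w s p - ε ^ 2 * (s ^ 2 + p ^ 2))
        (wt t p - ε ^ 2 * (2 * t)) t := by
      have h1 := (h.hasFDerivAt t p).comp_hasDerivAt t
        ((hasDerivAt_id t).prodMk (hasDerivAt_const t p))
      have h2 : HasDerivAt (fun s => ε ^ 2 * (s ^ 2 + p ^ 2)) (ε ^ 2 * (2 * t)) t := by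
        simpa using (((hasDerivAt_id t).pow 2).add_const (p ^ 2)).const_mul (ε ^ 2)
      have h3 : HasDerivAt (fun s => w s p) (wt t p) t := by simpa [Function.comp_def] using h1
      exact h3.sub h2
    have h1 : wt t p - ε ^ 2 * (2 * t) = 0 :=
      IsLocalMax.hasDerivAt_eq_zero (Eventually.of_forall fun s => hmax (s, p)) hdt
    have hdp : ∀ q, HasDerivAt (fun q => w t q - ε ^ 2 * (t ^ 2 + q ^ 2))
        (wp t q - ε ^ 2 * (2 * q)) q := by
      intro q
      have h2 : HasDerivAt (fun q => ε ^ 2 * (t ^ 2 + q ^ 2)) (ε ^ 2 * (2 * q)) q := by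
        simpa using (((hasDerivAt_id q).pow 2).const_add (t ^ 2)).const_mul (ε ^ 2)
      exact (h.hasDerivAt_space t q).sub h2
    have hdpp : HasDerivAt (fun q => wp t q - ε ^ 2 * (2 * q)) (wpp t p - ε ^ 2 * 2) p := by
      have h2 : HasDerivAt (fun q => ε ^ 2 * (2 * q)) (ε ^ 2 * 2) p := by
        simpa using ((hasDerivAt_id p).const_mul 2).const_mul (ε ^ 2)
      exact (h.hasDerivAt t p).sub h2
    have h2 : wpp t p - ε ^ 2 * 2 ≤ 0 :=
      second_deriv_nonpos_of_isLocalMax hdp hdpp (Eventually.of_forall fun q => hmax (t, q))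
    have h3 := hG t p
    have h4 : a t p * wpp t p ≤ a' * (ε ^ 2 * 2) := by
      calc a t p * wpp t p ≤ a t p * (ε ^ 2 * 2) :=
            mul_le_mul_of_nonneg_left (by linarith) (ha0 t p)
        _ ≤ _ := mul_le_mul_of_nonneg_right (ha1 t p) (by positivity)
    have h5 : -(√(2 * M) * ε) ≤ ε ^ 2 * t := by
      have := (abs_le.1 ht).1
      nlinarith
    nlinarith [sq_nonneg (ε * t), sq_nonneg (ε * p)]
  have hlim : Tendsto (fun ε : ℝ => G + 2 * a' * ε ^ 2 + 2 * √(2 * M) * ε) (𝓝[>] 0) (𝓝 G) := by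
    have : Continuous (fun ε : ℝ => G + 2 * a' * ε ^ 2 + 2 * √(2 * M) * ε) := by fun_prop
    have h := (this.tendsto 0).mono_left (nhdsWithin_le_nhds (s := Set.Ioi 0))
    simpa using h
  exact ge_of_tendsto hlim (eventually_nhdsWithin_of_forall fun ε hε => key ε hε)

theorem conv_neg_left (g : Plane → ℝ) (φ : 𝓢(Plane, ℝ)) (x : Plane) :
    conv (fun y => -g y) φ x = -conv g φ x := by
  simp [conv, integral_neg]

/-- The maximum principle for `∂₂ - a ∂₁² + 1` on the whole plane. -/
theorem abs_conv_le_of_parabolicOp {g : Plane → ℝ} (hg : Continuous g) {B : ℝ}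
    (hB : ∀ x, |g x| ≤ B) (φ : 𝓢(Plane, ℝ)) (a : Plane → ℝ) (ha0 : ∀ x, 0 ≤ a x)
    (ha1 : ∀ x, a x ≤ 1) {G : ℝ}
    (hG : ∀ x, |conv g (∂_{e₂} φ) x - a x * conv g (∂_{e₁} (∂_{e₁} φ)) x + conv g φ x| ≤ G)
    (x : Plane) : |conv g φ x| ≤ G := by
  have upper : ∀ g : Plane → ℝ, Continuous g → (∀ x, |g x| ≤ B) →
      (∀ x, |conv g (∂_{e₂} φ) x - a x * conv g (∂_{e₁} (∂_{e₁} φ)) x + conv g φ x| ≤ G) →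
      conv g φ x ≤ G := by
    intro g hg hB hG
    obtain ⟨B', h⟩ := heatReg_conv hg hB φ x 0 0
    have := le_of_heatReg (M := B * ∫ z, |φ z|) (a' := 1) (G := G) h
      (fun t p => by simpa using abs_conv_le hB φ (pointAt x t p))
      (fun t p => a (pointAt x t p)) (fun t p => ha0 _) (fun t p => ha1 _)
      (fun t p => by simpa using (abs_le.1 (hG (pointAt x t p))).2)
    simpa [pointAt_zero_zero] using this
  refine abs_le.2 ⟨?_, upper g hg hB hG⟩
  have h := upper (fun y => -g y) hg.neg (fun y => by simpa using hB y) fun y => by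
    simp only [conv_neg_left]
    rw [← abs_neg]
    convert hG y using 2
    ring
  rw [conv_neg_left] at h
  linarith

/-! ### The kernel at scale `ρ = T^{1/4}` -/

/-- The kernel `ψ_T` with `T = ρ⁴`. -/
def ker (ρ : ℝ) (hρ : 0 < ρ) : 𝓢(Plane, ℝ) := psi (ρ ^ 4) (pow_pos hρ 4)

/-- A constant controlling the moments of the kernel and of its second space derivative. -/
def kerConst : ℝ := momConst (psi 1 one_pos) + momConst (∂_{e₁} (∂_{e₁} (psi 1 one_pos)))

theorem kerConst_nonneg : 0 ≤ kerConst := add_nonneg (momConst_nonneg _) (momConst_nonneg _)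

theorem ker_apply (ρ : ℝ) (hρ : 0 < ρ) (z : Plane) :
    ker ρ hρ z = (ρ⁻¹) ^ (3 + 0) * psi 1 one_pos (parDil ρ⁻¹ (inv_ne_zero hρ.ne') z) :=
  psi_pow_four_apply ρ hρ _ z

theorem integral_abs_ker_le (ρ : ℝ) (hρ : 0 < ρ) : ∫ z, |ker ρ hρ z| ≤ kerConst := by
  have h := integral_moment_scaled_le hρ 0 (ker_apply ρ hρ) le_rfl (by norm_num : (0 : ℝ) ≤ 2)
  simp only [Real.rpow_zero, mul_one, pow_zero] at h
  exact h.trans (le_add_of_nonneg_right (momConst_nonneg _))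

theorem abs_conv_ker_le {g : Plane → ℝ} {B : ℝ} (hB : ∀ x, |g x| ≤ B) (ρ : ℝ) (hρ : 0 < ρ)
    (x : Plane) : |conv g (ker ρ hρ) x| ≤ kerConst * B := by
  refine (abs_conv_le hB _ x).trans ?_
  rw [mul_comm]
  exact mul_le_mul_of_nonneg_right (integral_abs_ker_le ρ hρ) ((abs_nonneg _).trans (hB 0))

theorem integral_apply_zero_mul_ker (ρ : ℝ) (hρ : 0 < ρ) : ∫ z : Plane, z 0 * ker ρ hρ z = 0 := by
  have h := integral_neg_eq_self (fun z : Plane => z 0 * ker ρ hρ z) volume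
  have e : ∀ z : Plane, (-z) 0 * ker ρ hρ (-z) = -(z 0 * ker ρ hρ z) := fun z => by
    simp [ker, psi_neg]
  simp only [e, integral_neg] at h
  linarith

theorem integrable_apply_zero_mul (φ : 𝓢(Plane, ℝ)) : Integrable (fun z : Plane => z 0 * φ z) := by
  refine (integrable_moment φ zero_le_one (by norm_num)).mono'
    (Continuous.aestronglyMeasurable (by fun_prop)) (ae_of_all _ fun z => ?_)
  rw [norm_mul, Real.norm_eq_abs, Real.norm_eq_abs, Real.rpow_one, mul_comm]
  exact mul_le_mul_of_nonneg_left (abs_apply_zero_le_pnorm z) (abs_nonneg _)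

/-- The kernel reproduces affine functions of the space variable. -/
theorem abs_conv_ker_sub_le {g : Plane → ℝ} (hg : Continuous g) {B : ℝ} (hB : ∀ x, |g x| ≤ B)
    {ρ : ℝ} (hρ : 0 < ρ) {x : Plane} {c m A D β γ : ℝ} (h0 : 0 ≤ β) (h2 : β ≤ 2) (h0' : 0 ≤ γ)
    (h2' : γ ≤ 2) (hA : 0 ≤ A) (hD : 0 ≤ D)
    (h : ∀ y, |g y - c - m * (y - x) 0| ≤ A * pdist y x ^ β + D * pdist y x ^ γ) :
    |conv g (ker ρ hρ) x - c| ≤ kerConst * (A * ρ ^ β + D * ρ ^ γ) := by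
  -- Unit mass and vanishing first moment allow the affine function to be subtracted under the
  -- integral.
  have e : conv g (ker ρ hρ) x - c
      = ∫ z, (g (x - z) - c - m * ((x - z) - x) 0) * ker ρ hρ z := by
    have h1 : ∫ z, ker ρ hρ z = 1 := integral_psi _ _
    have h3 := integral_apply_zero_mul_ker ρ hρ
    have i1 := integrable_conv' hg hB (ker ρ hρ) x
    have i2 := (ker ρ hρ).integrable (μ := volume)
    have i3 := integrable_apply_zero_mul (ker ρ hρ)
    have e2 : ∀ z, (g (x - z) - c - m * ((x - z) - x) 0) * ker ρ hρ z
        = g (x - z) * ker ρ hρ z - c * ker ρ hρ z + m * (z 0 * ker ρ hρ z) := fun z => by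
      have : ((x - z) - x) 0 = -z 0 := by simp
      rw [this]; ring
    simp only [e2]
    have i12 : Integrable (fun z => g (x - z) * ker ρ hρ z - c * ker ρ hρ z) :=
      i1.sub (i2.const_mul c)
    rw [integral_add i12 (i3.const_mul m), integral_sub i1 (i2.const_mul c),
      integral_const_mul, integral_const_mul, h1, h3, conv_eq]
    ring
  rw [e]
  have := abs_integral_mul_scaled_le hρ 0 (ker_apply ρ hρ) h0 h2 h0' h2' hA hD
    (fun z => g (x - z) - c - m * ((x - z) - x) 0) (fun z => by
      have := h (x - z)
      rwa [pdist_comm, pdist_eq_pnorm, sub_sub_cancel] at this)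
  refine this.trans ?_
  rw [pow_zero, mul_one]
  have h3 : 0 ≤ A * ρ ^ β + D * ρ ^ γ := by positivity
  exact mul_le_mul_of_nonneg_right (le_add_of_nonneg_right (momConst_nonneg _)) h3

/-- Convolution with the constant function one is constant, so its derivative vanishes. -/
theorem integral_lineDerivOp_eq_zero (φ : 𝓢(Plane, ℝ)) (m : Plane) : ∫ z, (∂_{m} φ) z = 0 := by
  have h := lineDeriv_conv (g := fun _ => 1) continuous_const (B := 1) (by simp) φ 0 m
  have e : ∀ χ : 𝓢(Plane, ℝ), ∀ x, conv (fun _ => 1) χ x = ∫ z, χ z := fun χ x => by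
    simp [conv_eq]
  rw [e, show conv (fun _ => 1) φ = fun _ => ∫ z, φ z from funext (e φ)] at h
  simpa [lineDeriv] using h.symm

/-- The differentiated kernel has mean zero, so `g x` may be subtracted; the two derivatives cost
`ρ^{-2}`. -/
theorem abs_conv_deriv_deriv_ker_le {g : Plane → ℝ} (hg : Continuous g) {B : ℝ}
    (hB : ∀ x, |g x| ≤ B) {ρ : ℝ} (hρ : 0 < ρ) {x : Plane} {A β : ℝ} (h0 : 0 ≤ β) (h2 : β ≤ 2)
    (hA : 0 ≤ A) (h : ∀ y, |g y - g x| ≤ A * pdist y x ^ β) :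
    |conv g (∂_{e₁} (∂_{e₁} (ker ρ hρ))) x| ≤ kerConst * A * ρ ^ (β - 2) := by
  set χ := ∂_{e₁} (∂_{e₁} (ker ρ hρ)) with hχ
  have e : conv g χ x = ∫ z, (g (x - z) - g x) * χ z := by
    have i1 := integrable_conv' hg hB χ x
    have i2 := χ.integrable (μ := volume)
    simp only [sub_mul]
    rw [integral_sub i1 (i2.const_mul _), integral_const_mul, hχ, integral_lineDerivOp_eq_zero,
      conv_eq]
    ring
  rw [e]
  have := abs_integral_mul_scaled_le (k := 2) hρ
    (deriv_deriv_psi_pow_four_apply ρ hρ (pow_pos hρ 4)) h0 h2 h0 h2 hA le_rfl (B := 0)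
    (fun z => g (x - z) - g x) (fun z => by
      have := h (x - z)
      rw [pdist_comm, pdist_eq_pnorm, sub_sub_cancel] at this
      linarith)
  refine this.trans ?_
  have e2 : ρ ^ (β - 2) = ρ ^ β * (ρ⁻¹) ^ 2 := by
    rw [Real.rpow_sub hρ, inv_pow]
    norm_cast
  rw [zero_mul, add_zero, e2, mul_assoc, mul_assoc, mul_assoc]
  exact mul_le_mul_of_nonneg_right (le_add_of_nonneg_left (momConst_nonneg _)) (by positivity)

/-! ### Absorption -/

/-- Iterating from a finite bound `U₀` gives the bounds `qⁿ U₀ + K/(1-q)`, and closedness lets `n →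
∞`. Only the finiteness of `U₀` matters, and no optimal constant has to be introduced. -/
theorem absorb {P : ℝ → Prop} (hcl : ∀ K, (∀ ε, 0 < ε → P (K + ε)) → P K)
    (hmono : ∀ U V, U ≤ V → P U → P V) {q K : ℝ} (hq0 : 0 ≤ q) (hq : q < 1) (hK : 0 ≤ K)
    {U₀ : ℝ} (hU₀ : 0 ≤ U₀) (h₀ : P U₀) (h : ∀ U, 0 ≤ U → P U → P (q * U + K)) :
    P (K / (1 - q)) := by
  have h1q : 0 < 1 - q := by linarith
  have key : ∀ n : ℕ, P (q ^ n * U₀ + K / (1 - q)) := by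
    intro n
    induction n with
    | zero => exact hmono _ _ (by have : 0 ≤ K / (1 - q) := by positivity
                                  simpa using this) h₀
    | succ n ih =>
      have := h _ (by positivity) ih
      convert this using 1
      field_simp
      ring
  refine hcl _ fun ε hε => ?_
  have ht : Tendsto (fun n : ℕ => q ^ n * U₀) atTop (𝓝 0) := by
    simpa using (tendsto_pow_atTop_nhds_zero_of_lt_one hq0 hq).mul_const U₀
  obtain ⟨n, hn⟩ := (ht.eventually (gt_mem_nhds hε)).exists
  exact hmono _ _ (by linarith) (key n)

theorem le_of_forall_pos_le_add_mul {a K b : ℝ} (hb : 0 ≤ b)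
    (h : ∀ ε, 0 < ε → a ≤ (K + ε) * b) : a ≤ K * b := by
  refine le_of_forall_pos_le_add fun ε hε => ?_
  have h1 := h (ε / (b + 1)) (by positivity)
  have h2 : ε / (b + 1) * b ≤ ε := by
    rw [div_mul_eq_mul_div, div_le_iff₀ (by positivity)]
    nlinarith
  linarith

/-! ### Hölder functions -/

theorem continuous_of_holder {g : Plane → ℝ} {α U : ℝ} (hα : 0 < α)
    (h : ∀ x y, |g x - g y| ≤ U * pdist x y ^ α) : Continuous g := by
  refine continuous_iff_continuousAt.2 fun x => ?_
  rw [ContinuousAt, tendsto_iff_dist_tendsto_zero]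
  have hc : Continuous (fun y => U * pdist y x ^ α) := by
    have : Continuous (fun y => pdist y x) :=
      continuous_pnorm.comp (continuous_id.sub continuous_const)
    exact continuous_const.mul (this.rpow_const fun _ => Or.inr hα.le)
  have h0 : Tendsto (fun y => U * pdist y x ^ α) (𝓝 x) (𝓝 0) := by
    have := hc.tendsto x
    rwa [pdist_self, Real.zero_rpow hα.ne', mul_zero] at this
  exact squeeze_zero (fun _ => dist_nonneg) (fun y => h y x) h0

theorem abs_conv_ker_sub_self_le {g : Plane → ℝ} {α U B : ℝ} (hα : 0 < α) (hα' : α ≤ 2)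
    (hB : ∀ x, |g x| ≤ B) (hU : 0 ≤ U) (h : ∀ x y, |g x - g y| ≤ U * pdist x y ^ α)
    {ρ : ℝ} (hρ : 0 < ρ) (x : Plane) : |conv g (ker ρ hρ) x - g x| ≤ kerConst * (U * ρ ^ α) := by
  have := abs_conv_ker_sub_le (continuous_of_holder hα h) hB hρ (x := x) (c := g x) (m := 0)
    (D := 0) hα.le hα' hα.le hα' hU le_rfl (fun y => by simpa using h y x)
  simpa using this

theorem exists_large_scale {a b p q : ℝ} (hp : 0 < p) (hq : 0 < q) {ε : ℝ}
    (hε : 0 < ε) : ∃ L : ℝ, 2 ≤ L ∧ a * L ^ (-p) + b * L ^ (-q) ≤ ε := by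
  have h1 : Tendsto (fun L : ℝ => a * L ^ (-p) + b * L ^ (-q)) atTop (𝓝 0) := by
    simpa using ((tendsto_rpow_neg_atTop hp).const_mul a).add
      ((tendsto_rpow_neg_atTop hq).const_mul b)
  obtain ⟨L, h2, h3⟩ := ((h1.eventually (ge_mem_nhds hε)).and (eventually_ge_atTop 2)).exists
  exact ⟨L, h3, h2⟩

theorem pdist_eq_of_time {R : ℝ} (hR : 0 < R) {x y : Plane} (h : (y - x) 1 = -R ^ 2) :
    pdist y x = R * (1 + |(y - x) 0| / R) := by
  rw [pdist_eq_pnorm, pnorm, h, abs_neg, abs_of_nonneg (sq_nonneg R), Real.sqrt_sq hR.le]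
  field_simp; ring

theorem pdist_le_of_time {R : ℝ} (hR : 0 < R) {x y : Plane} (h : |(y - x) 1| ≤ R ^ 2) :
    pdist y x ≤ R * (1 + |(y - x) 0| / R) := by
  have h1 : √|(y - x) 1| ≤ R := Real.sqrt_le_iff.2 ⟨hR.le, h⟩
  have e : R * (1 + |(y - x) 0| / R) = |(y - x) 0| + R := by field_simp; ring
  rw [e, pdist_eq_pnorm, pnorm]
  linarith

/-- Converts parabolic power growth into the quadratic weight demanded by `conv_taylor`. -/
theorem mul_rpow_le_mul_sq {R s d β : ℝ} (hR : 0 < R) (hs : 0 ≤ s) (hd0 : 0 ≤ d)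
    (hd : d ≤ R * (1 + s)) (h0 : 0 ≤ β) (h2 : β ≤ 2) : d ^ β ≤ R ^ β * (1 + s) ^ 2 := by
  calc d ^ β ≤ (R * (1 + s)) ^ β := Real.rpow_le_rpow hd0 hd h0
    _ = R ^ β * (1 + s) ^ β := Real.mul_rpow hR.le (by linarith)
    _ ≤ R ^ β * (1 + s) ^ (2 : ℝ) := by
        gcongr
        linarith
    _ = _ := by norm_cast

/-! ### Schauder estimate for constant coefficients -/

/-- The mollification at scale `ρ` of `(∂₂ - a₀ ∂₁² + 1) g` at the point `x`. -/
def mollOp (a₀ : ℝ) (g : Plane → ℝ) (ρ : ℝ) (hρ : 0 < ρ) (x : Plane) : ℝ :=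
  conv g (∂_{e₂} (ker ρ hρ)) x - a₀ * conv g (∂_{e₁} (∂_{e₁} (ker ρ hρ))) x + conv g (ker ρ hρ) x

/-- An increment at distance `r` is compared through a finer mollification scale `r/L` and a coarser
cylinder `L r`. The terms returning the Hölder constant gain negative powers of `L`; the data only
pay `L⁴`. -/
theorem schauder_local (α lam : ℝ) (hα : 0 < α) (hα' : α < 1) (hlam : 0 < lam) :
    ∃ C : ℝ, 0 < C ∧ ∀ (a₀ : ℝ) (v : Plane → ℝ) (B U N L r : ℝ) (x y : Plane),
      lam ≤ a₀ → a₀ ≤ 1 → 0 ≤ U → 0 ≤ N → (∀ x, |v x| ≤ B) →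
      (∀ x y, |v x - v y| ≤ U * pdist x y ^ α) →
      (∀ ρ (hρ : 0 < ρ), ρ ≤ 1 → ∀ x, |mollOp a₀ v ρ hρ x| ≤ N * ρ ^ (α - 2)) →
      2 ≤ L → 0 < r → r ≤ 1 → pdist y x ≤ r →
      |v y - v x| ≤ (C * (L ^ (-α) + L ^ (-(1 - α))) * U + C * L ^ 4 * N) * r ^ α := by
  obtain ⟨C, hC, hT⟩ := conv_taylor lam hlam
  have hk := kerConst_nonneg
  set k := kerConst
  refine ⟨2 * k + 3 * C * (k + 1) + 4 * C, by positivity, ?_⟩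
  intro a₀ v B U N L r x y hla ha1 hU hN hB hv hN' hL hr hr1 hyx
  have hvc := continuous_of_holder hα hv
  have hL0 : 0 < L := by linarith
  set ρ := r / L with hρdef
  have hρ : 0 < ρ := by positivity
  have hρ1 : ρ ≤ 1 := (div_le_one hL0).2 (by linarith)
  set R := L * r with hRdef
  have hR : 0 < R := by positivity
  have hρR : ρ ≤ R := by
    rw [hρdef, hRdef, div_le_iff₀ hL0]
    nlinarith [mul_pos hr hL0]
  have hm : ∀ z, |conv v (ker ρ hρ) z - v z| ≤ k * (U * ρ ^ α) :=
    fun z => abs_conv_ker_sub_self_le hα (by linarith) hB hU hv hρ z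
  -- The maximum principle bounds the zero-order term, so that it can be moved to the right-hand
  -- side of the heat equation.
  have hsup : ∀ z, |conv v (ker ρ hρ) z| ≤ N * ρ ^ (α - 2) := fun z =>
    abs_conv_le_of_parabolicOp hvc hB (ker ρ hρ) (fun _ => a₀) (fun _ => by linarith)
      (fun _ => ha1) (hN' ρ hρ hρ1) z
  obtain ⟨c', m', hm', hcm⟩ := hT a₀ B v (ker ρ hρ) x (v x) 0 R ((k + 1) * U * R ^ α)
    (2 * (N * ρ ^ (α - 2))) hla ha1 hvc hB hR (by positivity) (by positivity)
    (fun z hz => by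
      have h1 := hm z
      have h2 := hv z x
      have hd := pdist_eq_of_time hR hz
      have h3 := mul_rpow_le_mul_sq hR (by positivity : 0 ≤ |(z - x) 0| / R) (pdist_nonneg z x)
        hd.le hα.le (by linarith)
      have h4 : ρ ^ α ≤ R ^ α * (1 + |(z - x) 0| / R) ^ 2 := by
        refine mul_rpow_le_mul_sq hR (by positivity) hρ.le ?_ hα.le (by linarith)
        have : 0 ≤ R * (|(z - x) 0| / R) := by positivity
        linarith
      have h5 := mul_le_mul_of_nonneg_left h3 hU
      have h6 := mul_le_mul_of_nonneg_left h4 (mul_nonneg hk hU)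
      have e : conv v (ker ρ hρ) z - v x - 0 * (z - x) 0
          = (conv v (ker ρ hρ) z - v z) + (v z - v x) := by ring
      rw [e]
      refine (abs_add_le _ _).trans ?_
      linarith)
    (fun z hz => by
      have h1 := hN' ρ hρ hρ1 z
      have h2 := hsup z
      have h3 : 1 ≤ (1 + |(z - x) 0| / R) ^ 2 :=
        one_le_pow₀ (by have : 0 ≤ |(z - x) 0| / R := by positivity
                        linarith)
      have e : conv v (∂_{e₂} (ker ρ hρ)) z - a₀ * conv v (∂_{e₁} (∂_{e₁} (ker ρ hρ))) z
          = mollOp a₀ v ρ hρ z - conv v (ker ρ hρ) z := by rw [mollOp]; ring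
      rw [e]
      have h4 : |mollOp a₀ v ρ hρ z - conv v (ker ρ hρ) z| ≤ 2 * (N * ρ ^ (α - 2)) :=
        (abs_sub _ _).trans (by linarith)
      exact h4.trans (le_mul_of_one_le_right (by positivity) h3))
  have hrR : r ≤ R / 2 := by rw [hRdef]; nlinarith
  have e1 := hcm r y hr hrR hyx
  have e2 := hcm r x hr hrR (by rw [pdist_self]; exact hr.le)
  simp only [sub_self, PiLp.zero_apply, mul_zero, sub_zero] at e2
  have hy0 : |(y - x) 0| ≤ r := (abs_apply_zero_le_pnorm _).trans hyx
  rw [sub_zero] at hm'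
  -- powers
  have hra : 0 < r ^ α := by positivity
  have p1 : ρ ^ α = L ^ (-α) * r ^ α := by
    rw [hρdef, Real.div_rpow hr.le hL0.le, Real.rpow_neg hL0.le]; field_simp
  have p2 : R ^ α = L ^ α * r ^ α := Real.mul_rpow hL0.le hr.le
  have p3 : R ^ α * (r / R) = L ^ (-(1 - α)) * r ^ α := by
    rw [p2, hRdef, neg_sub, Real.rpow_sub hL0, Real.rpow_one]
    field_simp
  have p4 : R ^ 2 * ρ ^ (α - 2) ≤ L ^ 4 * r ^ α := by
    have : R ^ 2 * ρ ^ (α - 2) = L ^ (4 - α) * r ^ α := by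
      rw [hρdef, hRdef, Real.div_rpow hr.le hL0.le, Real.rpow_sub hr, Real.rpow_sub hL0,
        Real.rpow_sub hL0, show (4 : ℝ) = ((4 : ℕ) : ℝ) by norm_num,
        show (2 : ℝ) = ((2 : ℕ) : ℝ) by norm_num]
      simp only [Real.rpow_natCast]
      field_simp
    rw [this]
    gcongr
    calc L ^ (4 - α) ≤ L ^ (4 : ℝ) := Real.rpow_le_rpow_of_exponent_le (by linarith) (by linarith)
      _ = L ^ 4 := by norm_cast
  have hr2 : r / R ≤ 1 := by rw [div_le_one hR]; linarith
  have hr20 : 0 ≤ r / R := by positivity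
  have q1 : (k + 1) * U * R ^ α * (r / R) ^ 2 ≤ (k + 1) * U * (L ^ (-(1 - α)) * r ^ α) := by
    rw [← p3, sq]
    have : R ^ α * (r / R * (r / R)) ≤ R ^ α * (r / R) := by
      gcongr
      nlinarith
    calc _ = (k + 1) * U * (R ^ α * (r / R * (r / R))) := by ring
      _ ≤ _ := by gcongr
  -- The comparison slope was zero, so `m'` is at most of order `U R^{α-1}`; this is the source of
  -- the factor `L^{-(1-α)}`, small because `α < 1`.
  have q2 : |m' * (y - x) 0| ≤ C * ((k + 1) * U * (L ^ (-(1 - α)) * r ^ α)) := by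
    rw [abs_mul, ← p3]
    calc _ ≤ C * ((k + 1) * U * R ^ α) / R * r := by gcongr
      _ = _ := by ring
  have e3 : R ^ 2 * (2 * (N * ρ ^ (α - 2))) ≤ 2 * N * (L ^ 4 * r ^ α) := by
    calc _ = 2 * N * (R ^ 2 * ρ ^ (α - 2)) := by ring
      _ ≤ _ := by gcongr
  set Q := L ^ (-(1 - α)) * r ^ α with hQ
  set S := L ^ 4 * r ^ α with hS
  have e4 : C * ((k + 1) * U * R ^ α * (r / R) ^ 2 + R ^ 2 * (2 * (N * ρ ^ (α - 2))))
      ≤ C * ((k + 1) * U * Q + 2 * N * S) := by gcongr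
  have hQ0 : 0 ≤ Q := by positivity
  have hS0 : 0 ≤ S := by positivity
  have d : v y - v x = -(conv v (ker ρ hρ) y - v y) + (conv v (ker ρ hρ) x - v x)
      + (conv v (ker ρ hρ) y - c' - m' * (y - x) 0) - (conv v (ker ρ hρ) x - c')
      + m' * (y - x) 0 := by ring
  have tri : |v y - v x| ≤ 2 * (k * (U * ρ ^ α)) + 2 * (C * ((k + 1) * U * Q + 2 * N * S))
      + C * ((k + 1) * U * Q) := by
    have a1 := abs_le.1 (hm y)
    have a2 := abs_le.1 (hm x)
    have a3 := abs_le.1 (e1.trans e4)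
    have a4 := abs_le.1 (e2.trans e4)
    have a5 := abs_le.1 q2
    rw [d, abs_le]
    constructor <;> linarith [a1.1, a1.2, a2.1, a2.2, a3.1, a3.2, a4.1, a4.2, a5.1, a5.2]
  refine tri.trans ?_
  rw [p1]
  set P := L ^ (-α) * r ^ α with hP
  have hP0 : 0 ≤ P := by positivity
  have fin : ((2 * k + 3 * C * (k + 1) + 4 * C) * (L ^ (-α) + L ^ (-(1 - α))) * U
      + (2 * k + 3 * C * (k + 1) + 4 * C) * L ^ 4 * N) * r ^ α
      = (2 * k + 3 * C * (k + 1) + 4 * C) * (P * U + Q * U + S * N) := by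
    rw [hP, hQ, hS]; ring
  rw [fin]
  have : 0 ≤ 2 * k * (Q * U + S * N) + 3 * C * (k + 1) * (P * U + S * N)
      + 4 * C * (P * U + Q * U) := by positivity
  linarith

/-- The Hölder constant is absorbed: increments below distance one by `schauder_local` with large
`L`, larger ones by the supremum bound at the fixed scale `1/L'`. -/
theorem schauder_const (α lam : ℝ) (hα : 0 < α) (hα' : α < 1) (hlam : 0 < lam) :
    ∃ C : ℝ, 0 < C ∧ ∀ (a₀ : ℝ) (v : Plane → ℝ) (B U N : ℝ),
      lam ≤ a₀ → a₀ ≤ 1 → 0 ≤ U → 0 ≤ N → (∀ x, |v x| ≤ B) →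
      (∀ x y, |v x - v y| ≤ U * pdist x y ^ α) →
      (∀ ρ (hρ : 0 < ρ), ρ ≤ 1 → ∀ x, |mollOp a₀ v ρ hρ x| ≤ N * ρ ^ (α - 2)) →
      (∀ x, |v x| ≤ C * N) ∧ ∀ x y, |v x - v y| ≤ C * N * pdist x y ^ α := by
  obtain ⟨C, hC, hloc⟩ := schauder_local α lam hα hα' hlam
  have hk := kerConst_nonneg
  set k := kerConst
  obtain ⟨L, hL, hLs⟩ := exists_large_scale (a := C) (b := C) hα (by linarith : 0 < 1 - α)
    (by norm_num : (0 : ℝ) < 1 / 2)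
  obtain ⟨L', hL', hLs'⟩ := exists_large_scale (a := 2 * k) (b := 0) hα hα
    (by norm_num : (0 : ℝ) < 1 / 2)
  have hL0 : 0 < L := by linarith
  have hL0' : 0 < L' := by linarith
  set K := C * L ^ 4 + 2 * L' ^ (-(α - 2)) with hK
  have hK0 : 0 < K := by positivity
  refine ⟨1 + (k + 1) * (2 * K), by positivity, ?_⟩
  intro a₀ v B U N hla ha1 hU hN hB hv hN'
  have hvc := continuous_of_holder hα hv
  have sup : ∀ V, 0 ≤ V → (∀ x y, |v x - v y| ≤ V * pdist x y ^ α) → ∀ ρ, 0 < ρ → ρ ≤ 1 →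
      ∀ z, |v z| ≤ N * ρ ^ (α - 2) + k * (V * ρ ^ α) := by
    intro V hV hv ρ hρ hρ1 z
    have h1 := abs_le.1 (abs_conv_ker_sub_self_le hα (by linarith) hB hV hv hρ z)
    have h2 := abs_le.1 (abs_conv_le_of_parabolicOp hvc hB (ker ρ hρ) (fun _ => a₀)
      (fun _ => by linarith) (fun _ => ha1) (hN' ρ hρ hρ1) z)
    exact abs_le.2 ⟨by linarith [h1.2, h2.1], by linarith [h1.1, h2.2]⟩
  have hold : ∀ x y, |v x - v y| ≤ K * N / (1 - 1 / 2) * pdist x y ^ α := by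
    refine absorb (P := fun V => ∀ x y, |v x - v y| ≤ V * pdist x y ^ α) ?_ ?_
      (by norm_num : (0 : ℝ) ≤ 1 / 2) (by norm_num) (by positivity) hU hv ?_
    · intro V h x y
      exact le_of_forall_pos_le_add_mul (Real.rpow_nonneg (pdist_nonneg x y) α)
        fun ε hε => h ε hε x y
    · intro V W hVW h x y
      exact (h x y).trans (mul_le_mul_of_nonneg_right hVW (Real.rpow_nonneg (pdist_nonneg x y) α))
    · intro V hV h y x
      rcases eq_or_ne y x with rfl | hne
      · simp [pdist_self, Real.zero_rpow hα.ne']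
      have hd := pdist_pos hne
      have hda : 0 < pdist y x ^ α := by positivity
      rcases le_or_gt (pdist y x) 1 with h1 | h1
      · have h2 := hloc a₀ v B V N L (pdist y x) x y hla ha1 hV hN hB h hN' hL hd h1 le_rfl
        refine h2.trans ?_
        gcongr
        · rw [mul_add]
          exact hLs
        · rw [hK]
          have : 0 ≤ 2 * L' ^ (-(α - 2)) := by positivity
          linarith
      · have hρ : 0 < L'⁻¹ := by positivity
        have hρ1 : L'⁻¹ ≤ 1 := inv_le_one_of_one_le₀ (by linarith)
        have s1 := abs_le.1 (sup V hV h L'⁻¹ hρ hρ1 x)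
        have s2 := abs_le.1 (sup V hV h L'⁻¹ hρ hρ1 y)
        rw [Real.inv_rpow hL0'.le, ← Real.rpow_neg hL0'.le, Real.inv_rpow hL0'.le,
          ← Real.rpow_neg hL0'.le] at s1 s2
        have h3 : |v y - v x| ≤ 1 / 2 * V + K * N := by
          have h4 : 2 * (k * (V * L' ^ (-α))) ≤ 1 / 2 * V := by
            have := mul_le_mul_of_nonneg_right hLs' hV
            linarith
          have h5 : 2 * (N * L' ^ (-(α - 2))) ≤ K * N := by
            have : 0 ≤ C * L ^ 4 * N := by positivity
            rw [hK]; linarith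
          exact abs_le.2 ⟨by linarith [s1.2, s2.1], by linarith [s1.1, s2.2]⟩
        exact h3.trans (le_mul_of_one_le_right (by positivity) (Real.one_le_rpow h1.le hα.le))
  have e : K * N / (1 - 1 / 2) = 2 * K * N := by ring
  rw [e] at hold
  refine ⟨fun x => ?_, fun x y => (hold x y).trans ?_⟩
  · have h1 := sup (2 * K * N) (by positivity) hold 1 one_pos le_rfl x
    rw [Real.one_rpow, Real.one_rpow] at h1
    refine h1.trans ?_
    have : 0 ≤ 2 * K * N := by positivity
    linarith
  · have : 0 ≤ pdist x y ^ α := Real.rpow_nonneg (pdist_nonneg x y) α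
    refine mul_le_mul_of_nonneg_right (mul_le_mul_of_nonneg_right ?_ hN) this
    nlinarith

/-! ### Quantitative form of the hypotheses -/

/-- `u` is modelled after `v` according to `a`, `σ` with derivative `ν` and constant `M`. -/
def Modelled {I : ℕ} (α : ℝ) (u : Plane → ℝ) (v : Fin I → ℝ → Plane → ℝ) (a : Plane → ℝ)
    (σ : Fin I → Plane → ℝ) (ν : Plane → ℝ) (M : ℝ) : Prop :=
  ∀ x y, |u y - u x - ∑ i, σ i x * (v i (a x) y - v i (a x) x) - ν x * (y - x) 0|
    ≤ M * pdist y x ^ (2 * α)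

/-- The hypotheses of the main estimate with real constants; `F i a₀ ρ` stands for the mollification
of `f i a₀` at scale `ρ`. -/
structure ModelData {I : ℕ} (α lam C₀ δ K : ℝ) (N s : Fin I → ℝ)
    (F : Fin I → ℝ → ℝ → Plane → ℝ) (v : Fin I → ℝ → Plane → ℝ) (a : Plane → ℝ)
    (σ : Fin I → Plane → ℝ) (u : Plane → ℝ) : Prop where
  N_nonneg : ∀ i, 0 ≤ N i
  s_nonneg : ∀ i, 0 ≤ s i
  K_nonneg : 0 ≤ K
  C₀_nonneg : 0 ≤ C₀
  δ_nonneg : 0 ≤ δ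
  δ_le_one : δ ≤ 1
  a_mem : ∀ x, a x ∈ Set.Icc lam 1
  a_holder : ∀ x y, |a x - a y| ≤ δ * pdist x y ^ α
  σ_bound : ∀ i x, |σ i x| ≤ s i
  σ_holder : ∀ i x y, |σ i x - σ i y| ≤ s i * pdist x y ^ α
  F_bound : ∀ i, ∀ a₀ ∈ Set.Icc lam 1, ∀ ρ, 0 < ρ → ρ ≤ 1 → ∀ x,
    |F i a₀ ρ x| ≤ N i * ρ ^ (α - 2)
  F_lip : ∀ i, ∀ a₀ ∈ Set.Icc lam 1, ∀ a₁ ∈ Set.Icc lam 1, ∀ ρ, 0 < ρ → ρ ≤ 1 → ∀ x,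
    |F i a₀ ρ x - F i a₁ ρ x| ≤ N i * |a₀ - a₁| * ρ ^ (α - 2)
  v_eq : ∀ i, ∀ a₀ ∈ Set.Icc lam 1, ∀ ρ (hρ : 0 < ρ) x, mollOp a₀ (v i a₀) ρ hρ x = F i a₀ ρ x
  v_bound : ∀ i, ∀ a₀ ∈ Set.Icc lam 1, ∀ x, |v i a₀ x| ≤ C₀ * N i
  v_holder : ∀ i, ∀ a₀ ∈ Set.Icc lam 1, ∀ x y,
    |v i a₀ x - v i a₀ y| ≤ C₀ * N i * pdist x y ^ α
  v_lip : ∀ i, ∀ a₀ ∈ Set.Icc lam 1, ∀ a₁ ∈ Set.Icc lam 1, ∀ x y,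
    |(v i a₀ x - v i a₀ y) - (v i a₁ x - v i a₁ y)| ≤ C₀ * N i * |a₀ - a₁| * pdist x y ^ α
  v_periodic : ∀ i, ∀ a₀ ∈ Set.Icc lam 1, ∀ x, v i a₀ (x + e₁) = v i a₀ x
  u_continuous : Continuous u
  u_bounded : ∃ B, ∀ x, |u x| ≤ B
  u_periodic : ∀ x, u (x + e₁) = u x
  approx : ∀ ρ (hρ : 0 < ρ), ρ ≤ 1 → ∀ x,
    |mollOp (a x) u ρ hρ x - ∑ i, σ i x * F i (a x) ρ x| ≤ K * ρ ^ (2 * α - 2)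

theorem abs_sum_le_mul {I : ℕ} {t s N : Fin I → ℝ} {c : ℝ} (h : ∀ i, |t i| ≤ c * (s i * N i)) :
    |∑ i, t i| ≤ c * ∑ i, s i * N i := by
  rw [Finset.mul_sum]
  exact (Finset.abs_sum_le_sum_abs _ _).trans (Finset.sum_le_sum fun i _ => h i)

/-! ### The frozen part and the equation it satisfies. -/

namespace ModelData

variable {I : ℕ} {α lam C₀ δ K : ℝ} {N s : Fin I → ℝ} {F : Fin I → ℝ → ℝ → Plane → ℝ}
  {v : Fin I → ℝ → Plane → ℝ} {a : Plane → ℝ} {σ : Fin I → Plane → ℝ} {u ν : Plane → ℝ}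

/-- The function `u - ∑ i, σ_i(x) v_i(·, a(x))`. -/
def frozenPart (v : Fin I → ℝ → Plane → ℝ) (a : Plane → ℝ) (σ : Fin I → Plane → ℝ)
    (u : Plane → ℝ) (x y : Plane) : ℝ := u y - ∑ i, σ i x * v i (a x) y

theorem X_nonneg (h : ModelData α lam C₀ δ K N s F v a σ u) : 0 ≤ ∑ i, s i * N i :=
  Finset.sum_nonneg fun i _ => mul_nonneg (h.s_nonneg i) (h.N_nonneg i)

theorem v_continuous (h : ModelData α lam C₀ δ K N s F v a σ u) (hα : 0 < α) (i : Fin I) {a₀ : ℝ}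
    (ha : a₀ ∈ Set.Icc lam 1) : Continuous (v i a₀) :=
  continuous_of_holder hα (h.v_holder i a₀ ha)

theorem continuous_frozenPart (h : ModelData α lam C₀ δ K N s F v a σ u) (hα : 0 < α) (x : Plane) :
    Continuous (frozenPart v a σ u x) := by
  have := fun i => h.v_continuous hα i (h.a_mem x)
  have := h.u_continuous
  unfold frozenPart
  fun_prop

theorem abs_sum_σ_v_le (h : ModelData α lam C₀ δ K N s F v a σ u) (x y : Plane) :
    |∑ i, σ i x * v i (a x) y| ≤ C₀ * ∑ i, s i * N i := by
  refine abs_sum_le_mul fun i => ?_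
  rw [abs_mul]
  calc _ ≤ s i * (C₀ * N i) :=
        mul_le_mul (h.σ_bound i x) (h.v_bound i _ (h.a_mem x) y) (abs_nonneg _) (h.s_nonneg i)
    _ = _ := by ring

theorem abs_frozenPart_le (h : ModelData α lam C₀ δ K N s F v a σ u) {U₀ : ℝ}
    (hU : ∀ x, |u x| ≤ U₀) (x y : Plane) :
    |frozenPart v a σ u x y| ≤ U₀ + C₀ * ∑ i, s i * N i :=
  (abs_sub _ _).trans (add_le_add (hU y) (h.abs_sum_σ_v_le x y))

theorem conv_frozenPart (h : ModelData α lam C₀ δ K N s F v a σ u) (hα : 0 < α)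
    (φ : 𝓢(Plane, ℝ)) (x y : Plane) :
    conv (frozenPart v a σ u x) φ y = conv u φ y - ∑ i, σ i x * conv (v i (a x)) φ y := by
  obtain ⟨B, hB⟩ := h.u_bounded
  have iv := fun i => integrable_conv (h.v_continuous hα i (h.a_mem x))
    (h.v_bound i _ (h.a_mem x)) φ y
  have iu := integrable_conv h.u_continuous hB φ y
  rw [← conv_sum_mul_left (fun i => σ i x) φ y iv]
  refine conv_sub_left φ y iu ?_
  simp only [Finset.sum_mul, mul_assoc]
  exact integrable_finsetSum _ fun i _ => (iv i).const_mul (σ i x)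

/-- The coefficient is frozen at the same value `a x` in the operator and in every `v i`, so each `v
i` contributes exactly its right-hand side. -/
theorem mollOp_frozenPart (h : ModelData α lam C₀ δ K N s F v a σ u) (hα : 0 < α) {ρ : ℝ}
    (hρ : 0 < ρ) (x y : Plane) :
    mollOp (a x) (frozenPart v a σ u x) ρ hρ y
      = mollOp (a x) u ρ hρ y - ∑ i, σ i x * F i (a x) ρ y := by
  have e : ∑ i, σ i x * F i (a x) ρ y = ∑ i, σ i x * mollOp (a x) (v i (a x)) ρ hρ y :=
    Finset.sum_congr rfl fun i _ => by rw [h.v_eq i _ (h.a_mem x)]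
  rw [e]
  simp only [mollOp, h.conv_frozenPart hα, mul_add, mul_sub, Finset.sum_add_distrib,
    Finset.sum_sub_distrib]
  have e2 : ∑ i, σ i x * (a x * conv (v i (a x)) (∂_{e₁} (∂_{e₁} (ker ρ hρ))) y)
      = a x * ∑ i, σ i x * conv (v i (a x)) (∂_{e₁} (∂_{e₁} (ker ρ hρ))) y := by
    rw [Finset.mul_sum]; exact Finset.sum_congr rfl fun i _ => by ring
  rw [e2]; ring

/-- Expanding around `y` while freezing at `x` costs the increments of `σ` and `a` between `x` and
`y`, of order `d(y,x)^α`, each times an increment of some `v i` or of its parameter dependence, of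
order `d(z,y)^α`. -/
theorem abs_frozenPart_sub_le (h : ModelData α lam C₀ δ K N s F v a σ u) {M : ℝ}
    (hM : Modelled α u v a σ ν M) (x y z : Plane) :
    |frozenPart v a σ u x z - frozenPart v a σ u x y - ν y * (z - y) 0|
      ≤ M * pdist z y ^ (2 * α)
        + 2 * C₀ * (∑ i, s i * N i) * pdist y x ^ α * pdist z y ^ α := by
  have hd : 0 ≤ pdist y x ^ α := Real.rpow_nonneg (pdist_nonneg y x) α
  have hd' : 0 ≤ pdist z y ^ α := Real.rpow_nonneg (pdist_nonneg z y) α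
  have hC := h.C₀_nonneg
  have e : frozenPart v a σ u x z - frozenPart v a σ u x y - ν y * (z - y) 0
      = (u z - u y - ∑ i, σ i y * (v i (a y) z - v i (a y) y) - ν y * (z - y) 0)
        + ∑ i, (σ i y * ((v i (a y) z - v i (a y) y) - (v i (a x) z - v i (a x) y))
          + (σ i y - σ i x) * (v i (a x) z - v i (a x) y)) := by
    have : ∑ i, (σ i y * ((v i (a y) z - v i (a y) y) - (v i (a x) z - v i (a x) y))
          + (σ i y - σ i x) * (v i (a x) z - v i (a x) y))
        = ∑ i, σ i y * (v i (a y) z - v i (a y) y) - (∑ i, σ i x * v i (a x) z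
          - ∑ i, σ i x * v i (a x) y) := by
      rw [← Finset.sum_sub_distrib, ← Finset.sum_sub_distrib]
      exact Finset.sum_congr rfl fun i _ => by ring
    rw [this]; unfold frozenPart; ring
  rw [e]
  refine (abs_add_le _ _).trans (add_le_add (hM y z) ?_)
  have : ∀ i, |σ i y * ((v i (a y) z - v i (a y) y) - (v i (a x) z - v i (a x) y))
      + (σ i y - σ i x) * (v i (a x) z - v i (a x) y)|
      ≤ (2 * C₀ * pdist y x ^ α * pdist z y ^ α) * (s i * N i) := by
    intro i
    have hN := h.N_nonneg i
    have hs := h.s_nonneg i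
    have h1 : |a y - a x| ≤ pdist y x ^ α :=
      (h.a_holder y x).trans (mul_le_of_le_one_left hd h.δ_le_one)
    have h2 := h.v_lip i _ (h.a_mem y) _ (h.a_mem x) z y
    have h3 := h.v_holder i _ (h.a_mem x) z y
    have h4 : C₀ * N i * |a y - a x| * pdist z y ^ α
        ≤ C₀ * N i * pdist y x ^ α * pdist z y ^ α := by
      gcongr
    refine (abs_add_le _ _).trans ?_
    rw [abs_mul, abs_mul]
    calc _ ≤ s i * (C₀ * N i * pdist y x ^ α * pdist z y ^ α)
          + (s i * pdist y x ^ α) * (C₀ * N i * pdist z y ^ α) := by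
          refine add_le_add (mul_le_mul (h.σ_bound i y) (h2.trans h4) (abs_nonneg _) hs)
            (mul_le_mul (h.σ_holder i y x) h3 (abs_nonneg _) (by positivity))
      _ = _ := by ring
  refine (abs_sum_le_mul this).trans (le_of_eq (by ring))

theorem abs_conv_frozenPart_sub_le (h : ModelData α lam C₀ δ K N s F v a σ u) (hα : 0 < α)
    (hα' : α < 1) {M : ℝ} (hM0 : 0 ≤ M) (hM : Modelled α u v a σ ν M) {ρ : ℝ} (hρ : 0 < ρ)
    (x y : Plane) :
    |conv (frozenPart v a σ u x) (ker ρ hρ) y - frozenPart v a σ u x y|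
      ≤ kerConst * (M * ρ ^ (2 * α)
        + 2 * C₀ * (∑ i, s i * N i) * pdist y x ^ α * ρ ^ α) := by
  obtain ⟨B, hB⟩ := h.u_bounded
  have hd : 0 ≤ pdist y x ^ α := Real.rpow_nonneg (pdist_nonneg y x) α
  have hC := h.C₀_nonneg
  have hX := h.X_nonneg
  exact abs_conv_ker_sub_le (h.continuous_frozenPart hα x) (h.abs_frozenPart_le hB x) hρ
    (by linarith) (by linarith) hα.le (by linarith) hM0 (by positivity)
    (fun z => h.abs_frozenPart_sub_le hM x y z)

/-- The size of `(∂₂ - a(x) ∂₁²)` applied to the mollified frozen part. -/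
theorem abs_heat_frozenPart_le (h : ModelData α lam C₀ δ K N s F v a σ u) (hα : 0 < α)
    (hα' : α < 1) {U₀ U₁ : ℝ} (hU₀ : ∀ x, |u x| ≤ U₀) (hU₁0 : 0 ≤ U₁)
    (hU₁ : ∀ x y, |u x - u y| ≤ U₁ * pdist x y ^ α) {ρ : ℝ} (hρ : 0 < ρ) (hρ1 : ρ ≤ 1)
    (x y : Plane) :
    |conv (frozenPart v a σ u x) (∂_{e₂} (ker ρ hρ)) y
        - a x * conv (frozenPart v a σ u x) (∂_{e₁} (∂_{e₁} (ker ρ hρ))) y|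
      ≤ K * ρ ^ (2 * α - 2)
        + (2 * (∑ i, s i * N i) + kerConst * δ * U₁) * pdist y x ^ α * ρ ^ (α - 2)
        + kerConst * (U₀ + C₀ * ∑ i, s i * N i) := by
  have hd : 0 ≤ pdist y x ^ α := Real.rpow_nonneg (pdist_nonneg y x) α
  have hk := kerConst_nonneg
  -- The hypothesis on `u` holds with coefficients taken at `y`; the other terms account for moving
  -- `a`, then `σ` and `F`, to `x`, and for the zero-order term.
  have e : conv (frozenPart v a σ u x) (∂_{e₂} (ker ρ hρ)) y
        - a x * conv (frozenPart v a σ u x) (∂_{e₁} (∂_{e₁} (ker ρ hρ))) y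
      = (mollOp (a y) u ρ hρ y - ∑ i, σ i y * F i (a y) ρ y)
        + (a y - a x) * conv u (∂_{e₁} (∂_{e₁} (ker ρ hρ))) y
        + ∑ i, (σ i y * (F i (a y) ρ y - F i (a x) ρ y) + (σ i y - σ i x) * F i (a x) ρ y)
        - conv (frozenPart v a σ u x) (ker ρ hρ) y := by
    have e1 := h.mollOp_frozenPart hα hρ x y
    have e2 : ∑ i, (σ i y * (F i (a y) ρ y - F i (a x) ρ y) + (σ i y - σ i x) * F i (a x) ρ y)
        = ∑ i, σ i y * F i (a y) ρ y - ∑ i, σ i x * F i (a x) ρ y := by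
      rw [← Finset.sum_sub_distrib]
      exact Finset.sum_congr rfl fun i _ => by ring
    rw [e2]
    have e3 : mollOp (a y) u ρ hρ y + (a y - a x) * conv u (∂_{e₁} (∂_{e₁} (ker ρ hρ))) y
        = mollOp (a x) u ρ hρ y := by unfold mollOp; ring
    have e4 : conv (frozenPart v a σ u x) (∂_{e₂} (ker ρ hρ)) y
        - a x * conv (frozenPart v a σ u x) (∂_{e₁} (∂_{e₁} (ker ρ hρ))) y
        = mollOp (a x) (frozenPart v a σ u x) ρ hρ y
          - conv (frozenPart v a σ u x) (ker ρ hρ) y := by unfold mollOp; ring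
    rw [e4, e1, ← e3]; ring
  have b1 := h.approx ρ hρ hρ1 y
  -- The oscillation of `a` multiplies two derivatives of `u_ρ`; this is the origin of `δ U₁`, which
  -- is absorbed at the end by smallness of `δ`.
  have b2 : |(a y - a x) * conv u (∂_{e₁} (∂_{e₁} (ker ρ hρ))) y|
      ≤ kerConst * δ * U₁ * pdist y x ^ α * ρ ^ (α - 2) := by
    have h1 := abs_conv_deriv_deriv_ker_le h.u_continuous hU₀ hρ (x := y) hα.le (by linarith) hU₁0
      (fun z => hU₁ z y)
    rw [abs_mul]
    calc _ ≤ (δ * pdist y x ^ α) * (kerConst * U₁ * ρ ^ (α - 2)) :=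
          mul_le_mul (h.a_holder y x) h1 (abs_nonneg _) (mul_nonneg h.δ_nonneg hd)
      _ = _ := by ring
  have b3 : |∑ i, (σ i y * (F i (a y) ρ y - F i (a x) ρ y) + (σ i y - σ i x) * F i (a x) ρ y)|
      ≤ (2 * pdist y x ^ α * ρ ^ (α - 2)) * ∑ i, s i * N i := by
    refine abs_sum_le_mul fun i => ?_
    have hN := h.N_nonneg i
    have hs := h.s_nonneg i
    have h1 : |a y - a x| ≤ pdist y x ^ α :=
      (h.a_holder y x).trans (mul_le_of_le_one_left hd h.δ_le_one)
    have h2 := h.F_lip i _ (h.a_mem y) _ (h.a_mem x) ρ hρ hρ1 y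
    have h4 : N i * |a y - a x| * ρ ^ (α - 2) ≤ N i * pdist y x ^ α * ρ ^ (α - 2) := by gcongr
    refine (abs_add_le _ _).trans ?_
    rw [abs_mul, abs_mul]
    calc _ ≤ s i * (N i * pdist y x ^ α * ρ ^ (α - 2))
          + (s i * pdist y x ^ α) * (N i * ρ ^ (α - 2)) :=
          add_le_add (mul_le_mul (h.σ_bound i y) (h2.trans h4) (abs_nonneg _) hs)
            (mul_le_mul (h.σ_holder i y x) (h.F_bound i _ (h.a_mem x) ρ hρ hρ1 y) (abs_nonneg _)
              (by positivity))
      _ = _ := by ring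
  have b4 := abs_conv_ker_le (h.abs_frozenPart_le hU₀ x) ρ hρ y
  rw [e]
  have t1 := abs_sub ((mollOp (a y) u ρ hρ y - ∑ i, σ i y * F i (a y) ρ y)
        + (a y - a x) * conv u (∂_{e₁} (∂_{e₁} (ker ρ hρ))) y
        + ∑ i, (σ i y * (F i (a y) ρ y - F i (a x) ρ y) + (σ i y - σ i x) * F i (a x) ρ y))
    (conv (frozenPart v a σ u x) (ker ρ hρ) y)
  have t2 := abs_add_three (mollOp (a y) u ρ hρ y - ∑ i, σ i y * F i (a y) ρ y)
    ((a y - a x) * conv u (∂_{e₁} (∂_{e₁} (ker ρ hρ))) y)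
    (∑ i, (σ i y * (F i (a y) ρ y - F i (a x) ρ y) + (σ i y - σ i x) * F i (a x) ρ y))
  linarith

end ModelData

/-! ### Affine approximation of the frozen part at a single scale. -/

namespace ModelData

/-- Applies `conv_taylor` with mollification scale `r/L` and cylinder `L r`. Mollification returns
`M L^{-2α}`, and the Taylor remainder returns `M (L r)^{2α} L^{-2} = M L^{-(2-2α)} r^{2α}`. -/
theorem exists_affine_approx (α lam C₀ : ℝ) (hα : 1 / 2 < α) (hα' : α < 1) (hlam : 0 < lam)
    (hC₀ : 0 ≤ C₀) : ∃ C : ℝ, 0 < C ∧ ∀ (I : ℕ) (δ K : ℝ) (N s : Fin I → ℝ)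
      (F : Fin I → ℝ → ℝ → Plane → ℝ) (v : Fin I → ℝ → Plane → ℝ) (a : Plane → ℝ)
      (σ : Fin I → Plane → ℝ) (u ν : Plane → ℝ) (M U₀ U₁ L r : ℝ) (x : Plane),
      ModelData α lam C₀ δ K N s F v a σ u → 0 ≤ M → Modelled α u v a σ ν M →
      (∀ x, |u x| ≤ U₀) → 0 ≤ U₁ → (∀ x y, |u x - u y| ≤ U₁ * pdist x y ^ α) →
      2 ≤ L → 0 < r → r ≤ 1 →
      ∃ c m : ℝ, ∀ y, pdist y x ≤ r → |frozenPart v a σ u x y - c - m * (y - x) 0|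
        ≤ (C * (L ^ (-(2 * α)) + L ^ (-(2 - 2 * α))) * M
          + C * L ^ 4 * (K + ∑ i, s i * N i + U₀ + δ * U₁)) * r ^ (2 * α) := by
  obtain ⟨C, hC, hT⟩ := conv_taylor lam hlam
  have hk := kerConst_nonneg
  refine ⟨kerConst + C * (kerConst + 1) + 2 * kerConst * C₀ * (1 + C)
    + C * (3 + kerConst + kerConst * C₀), by positivity, ?_⟩
  intro I δ K N s F v a σ u ν M U₀ U₁ L r x h hM0 hM hU₀ hU₁0 hU₁ hL hr hr1
  have hα0 : 0 < α := by linarith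
  have hX := h.X_nonneg
  set X := ∑ i, s i * N i with hXdef
  have hK := h.K_nonneg
  have hδ := h.δ_nonneg
  have hU0 : 0 ≤ U₀ := (abs_nonneg _).trans (hU₀ 0)
  set w := frozenPart v a σ u x with hw
  have hwc : Continuous w := h.continuous_frozenPart hα0 x
  have hwB : ∀ y, |w y| ≤ U₀ + C₀ * X := h.abs_frozenPart_le hU₀ x
  have hL0 : 0 < L := by linarith
  set ρ := r / L with hρdef
  have hρ : 0 < ρ := by positivity
  have hρr : ρ ≤ r := div_le_self hr.le (by linarith)
  have hρ1 : ρ ≤ 1 := hρr.trans hr1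
  set R := L * r with hRdef
  have hR : 0 < R := by positivity
  have hrR : r ≤ R / 2 := by rw [hRdef]; nlinarith
  have hρR : ρ ≤ R := by linarith
  have hmoll := h.abs_conv_frozenPart_sub_le (ν := ν) hα0 hα' hM0 hM hρ x
  rw [← hw, ← hXdef] at hmoll
  have hheat := h.abs_heat_frozenPart_le hα0 hα' hU₀ hU₁0 hU₁ hρ hρ1 x
  rw [← hw, ← hXdef] at hheat
  set k := kerConst
  -- The affine part `w x + ν x (y - x)₁` is removed first, so the data are of order `2α`. The slope
  -- bound is dropped because the slope is identified later by comparing scales.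
  obtain ⟨c', m', -, hcm⟩ := hT (a x) (U₀ + C₀ * X) w (ker ρ hρ) x (w x) (ν x) R
    (((k + 1) * M + 2 * k * C₀ * X) * R ^ (2 * α))
    (K * ρ ^ (2 * α - 2) + (2 * X + k * δ * U₁) * R ^ α * ρ ^ (α - 2) + k * (U₀ + C₀ * X))
    (h.a_mem x).1 (h.a_mem x).2 hwc hwB hR (by positivity) (by positivity)
    (fun z hz => by
      have hd := pdist_eq_of_time hR hz
      set t := |(z - x) 0| / R with ht
      have ht0 : 0 ≤ t := by positivity
      have h1 := hmoll z
      have h2 : |w z - w x - ν x * (z - x) 0| ≤ M * pdist z x ^ (2 * α) := by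
        have := h.abs_frozenPart_sub_le hM x x z
        rwa [pdist_self, Real.zero_rpow hα0.ne', mul_zero, zero_mul, add_zero] at this
      have h3 := mul_rpow_le_mul_sq hR ht0 (pdist_nonneg z x) hd.le
        (by linarith : 0 ≤ 2 * α) (by linarith)
      have h4 : ρ ^ (2 * α) ≤ R ^ (2 * α) * (1 + t) ^ 2 :=
        mul_rpow_le_mul_sq hR ht0 hρ.le (by nlinarith) (by linarith) (by linarith)
      have h5 : pdist z x ^ α * ρ ^ α ≤ R ^ (2 * α) * (1 + t) ^ 2 := by
        have e : R ^ (2 * α) = R ^ α * R ^ α := by rw [← Real.rpow_add hR]; ring_nf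
        rw [e]
        calc pdist z x ^ α * ρ ^ α ≤ (R ^ α * (1 + t) ^ 2) * R ^ α := by
              gcongr
              exact mul_rpow_le_mul_sq hR ht0 (pdist_nonneg z x) hd.le hα0.le (by linarith)
          _ = _ := by ring
      have h6 := mul_le_mul_of_nonneg_left h3 hM0
      have h7 := mul_le_mul_of_nonneg_left h4 (mul_nonneg hk hM0)
      have h8 := mul_le_mul_of_nonneg_left h5 (by positivity : 0 ≤ 2 * k * C₀ * X)
      have e : conv w (ker ρ hρ) z - w x - ν x * (z - x) 0
          = (conv w (ker ρ hρ) z - w z) + (w z - w x - ν x * (z - x) 0) := by ring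
      rw [e]
      refine (abs_add_le _ _).trans ?_
      linarith)
    (fun z hz => by
      have hd := pdist_le_of_time hR hz
      set t := |(z - x) 0| / R with ht
      have ht0 : 0 ≤ t := by positivity
      have h1 := mul_rpow_le_mul_sq hR ht0 (pdist_nonneg z x) hd hα0.le (by linarith)
      have h2 : 1 ≤ (1 + t) ^ 2 := one_le_pow₀ (by linarith)
      refine (hheat z).trans ?_
      have q1 : K * ρ ^ (2 * α - 2) ≤ K * ρ ^ (2 * α - 2) * (1 + t) ^ 2 :=
        le_mul_of_one_le_right (by positivity) h2
      have q2 : k * (U₀ + C₀ * X) ≤ k * (U₀ + C₀ * X) * (1 + t) ^ 2 :=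
        le_mul_of_one_le_right (by positivity) h2
      have q3 : (2 * X + k * δ * U₁) * pdist z x ^ α * ρ ^ (α - 2)
          ≤ (2 * X + k * δ * U₁) * (R ^ α * (1 + t) ^ 2) * ρ ^ (α - 2) := by gcongr
      linarith)
  refine ⟨c', m', fun y hy => ?_⟩
  have e1 := hcm r y hr hrR hy
  have e2 := hmoll y
  -- powers
  have hrp : 0 < r ^ (2 * α) := by positivity
  have hL4 : 1 ≤ L ^ 4 := one_le_pow₀ (by linarith)
  set P := L ^ (-(2 * α)) * r ^ (2 * α) with hP
  set Q := L ^ (-(2 - 2 * α)) * r ^ (2 * α) with hQ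
  set S := L ^ 4 * r ^ (2 * α) with hS
  have hP0 : 0 ≤ P := by positivity
  have hQ0 : 0 ≤ Q := by positivity
  have hS0 : 0 ≤ S := by positivity
  have hrS : r ^ (2 * α) ≤ S := le_mul_of_one_le_left hrp.le hL4
  have p1 : ρ ^ (2 * α) = P := by
    rw [hP, hρdef, Real.div_rpow hr.le hL0.le, Real.rpow_neg hL0.le]; field_simp
  have rr : r ^ (2 * α) = r ^ α * r ^ α := by rw [← Real.rpow_add hr]; ring_nf
  have p2 : pdist y x ^ α * ρ ^ α ≤ S := by
    refine le_trans ?_ hrS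
    rw [rr]
    have := pdist_nonneg y x
    gcongr
  have p3 : R ^ (2 * α) * (r / R) ^ 2 = Q := by
    rw [hQ, hRdef, Real.mul_rpow hL0.le hr.le, neg_sub, Real.rpow_sub hL0,
      show (2 : ℝ) = ((2 : ℕ) : ℝ) by norm_num]
    simp only [Real.rpow_natCast]
    field_simp
  have p4 : Q ≤ S := by
    rw [hQ, hS]
    gcongr
    calc L ^ (-(2 - 2 * α)) ≤ L ^ (0 : ℝ) :=
          Real.rpow_le_rpow_of_exponent_le (by linarith) (by linarith)
      _ = 1 := Real.rpow_zero L
      _ ≤ L ^ 4 := hL4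
  have hLp : ∀ β : ℝ, β ≤ 4 → L ^ β ≤ L ^ 4 := fun β hβ => by
    calc L ^ β ≤ L ^ (4 : ℝ) := Real.rpow_le_rpow_of_exponent_le (by linarith) hβ
      _ = L ^ 4 := by norm_cast
  have p5 : R ^ 2 * ρ ^ (2 * α - 2) ≤ S := by
    have : R ^ 2 * ρ ^ (2 * α - 2) = L ^ (4 - 2 * α) * r ^ (2 * α) := by
      rw [hρdef, hRdef, Real.div_rpow hr.le hL0.le, Real.rpow_sub hr, Real.rpow_sub hL0,
        Real.rpow_sub hL0]
      have e4 : L ^ (4 : ℝ) = L ^ 4 := by norm_cast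
      have e2 : L ^ (2 : ℝ) = L ^ 2 := by norm_cast
      have e2' : r ^ (2 : ℝ) = r ^ 2 := by norm_cast
      rw [e4, e2, e2']
      field_simp
    rw [this]
    exact mul_le_mul_of_nonneg_right (hLp _ (by linarith)) hrp.le
  have p6 : R ^ 2 * (R ^ α * ρ ^ (α - 2)) ≤ S := by
    have : R ^ 2 * (R ^ α * ρ ^ (α - 2)) = S := by
      rw [hS, hρdef, hRdef, Real.div_rpow hr.le hL0.le, Real.rpow_sub hr, Real.rpow_sub hL0,
        Real.mul_rpow hL0.le hr.le, rr]
      have e2 : L ^ (2 : ℝ) = L ^ 2 := by norm_cast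
      have e2' : r ^ (2 : ℝ) = r ^ 2 := by norm_cast
      rw [e2, e2']
      field_simp
    exact this.le
  have p7 : R ^ 2 ≤ S := by
    rw [hRdef, hS, mul_pow]
    refine mul_le_mul (pow_le_pow_right₀ (by linarith) (by norm_num)) ?_ (by positivity)
      (by positivity)
    calc r ^ 2 = r ^ (2 : ℝ) := by norm_cast
      _ ≤ r ^ (2 * α) := Real.rpow_le_rpow_of_exponent_ge hr hr1 (by linarith)
  rw [p1] at e2
  have b2 : 2 * C₀ * X * pdist y x ^ α * ρ ^ α ≤ 2 * C₀ * X * S := by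
    rw [mul_assoc]; gcongr
  have b1 : ((k + 1) * M + 2 * k * C₀ * X) * R ^ (2 * α) * (r / R) ^ 2
      ≤ (k + 1) * M * Q + 2 * k * C₀ * X * S := by
    rw [mul_assoc, p3, add_mul]
    gcongr
  have b3 : R ^ 2 * (K * ρ ^ (2 * α - 2) + (2 * X + k * δ * U₁) * R ^ α * ρ ^ (α - 2)
      + k * (U₀ + C₀ * X)) ≤ K * S + (2 * X + k * δ * U₁) * S + k * (U₀ + C₀ * X) * S := by
    calc _ = K * (R ^ 2 * ρ ^ (2 * α - 2))
          + (2 * X + k * δ * U₁) * (R ^ 2 * (R ^ α * ρ ^ (α - 2)))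
          + k * (U₀ + C₀ * X) * R ^ 2 := by ring
      _ ≤ _ := by gcongr
  have tri : |w y - c' - m' * (y - x) 0| ≤ k * (M * P + 2 * C₀ * X * S)
      + C * (((k + 1) * M * Q + 2 * k * C₀ * X * S)
        + (K * S + (2 * X + k * δ * U₁) * S + k * (U₀ + C₀ * X) * S)) := by
    have e : w y - c' - m' * (y - x) 0 = -(conv w (ker ρ hρ) y - w y)
        + (conv w (ker ρ hρ) y - c' - m' * (y - x) 0) := by ring
    rw [e]
    refine (abs_add_le _ _).trans (add_le_add ?_ ?_)
    · rw [abs_neg]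
      exact e2.trans (by gcongr)
    · exact e1.trans (by gcongr)
  refine tri.trans ?_
  set D := k + C * (k + 1) + 2 * k * C₀ * (1 + C) + C * (3 + k + k * C₀) with hD
  have fin : (D * (L ^ (-(2 * α)) + L ^ (-(2 - 2 * α))) * M
          + D * L ^ 4 * (K + X + U₀ + δ * U₁)) * r ^ (2 * α)
      = D * (M * P + M * Q + K * S + X * S + U₀ * S + δ * U₁ * S) := by
    rw [hP, hQ, hS]; ring
  rw [fin]
  have t1 : k * (M * P) ≤ D * (M * P) := by
    gcongr
    rw [hD]
    have : 0 ≤ C * (k + 1) + 2 * k * C₀ * (1 + C) + C * (3 + k + k * C₀) := by positivity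
    linarith
  have t2 : C * (k + 1) * (M * Q) ≤ D * (M * Q) := by
    gcongr
    rw [hD]
    have : 0 ≤ k + 2 * k * C₀ * (1 + C) + C * (3 + k + k * C₀) := by positivity
    linarith
  have t3 : C * (K * S) ≤ D * (K * S) := by
    gcongr
    rw [hD]
    have : 0 ≤ k + C * k + 2 * k * C₀ * (1 + C) + C * (3 + k + k * C₀) := by positivity
    linarith
  have t4 : (2 * k * C₀ + C * (2 * k * C₀) + C * 2 + C * (k * C₀)) * (X * S) ≤ D * (X * S) := by
    gcongr
    rw [hD]
    have : 0 ≤ k + C * (k + 1) + C * (1 + k) := by positivity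
    linarith
  have t5 : C * k * (U₀ * S) ≤ D * (U₀ * S) := by
    gcongr
    rw [hD]
    have : 0 ≤ k + C * 1 + 2 * k * C₀ * (1 + C) + C * (3 + k + k * C₀) := by positivity
    linarith
  have t6 : C * k * (δ * U₁ * S) ≤ D * (δ * U₁ * S) := by
    gcongr
    rw [hD]
    have : 0 ≤ k + C * 1 + 2 * k * C₀ * (1 + C) + C * (3 + k + k * C₀) := by positivity
    linarith
  linarith

end ModelData

/-! ### Identification of the slope across dyadic scales. -/

theorem pdist_add_smul_e₁ (x : Plane) {r : ℝ} (hr : 0 ≤ r) : pdist (x + r • e₁) x = r := by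
  simp [pdist, e₁, abs_of_nonneg hr]

/-- Affine approximation at all small scales identifies the derivative. -/
theorem abs_sub_le_of_affine_approx {α : ℝ} (hα : 1 / 2 < α) {w : Plane → ℝ} {x : Plane}
    {ν E M : ℝ} (hE : 0 ≤ E) (hM : 0 ≤ M)
    (h1 : ∀ r, 0 < r → r ≤ 1 → ∃ c m : ℝ, ∀ y, pdist y x ≤ r →
      |w y - c - m * (y - x) 0| ≤ E * r ^ (2 * α))
    (h2 : ∀ y, |w y - w x - ν * (y - x) 0| ≤ M * pdist y x ^ (2 * α)) {y : Plane}
    (hy : pdist y x ≤ 1) :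
    |w y - w x - ν * (y - x) 0|
      ≤ (2 + 8 / (1 - (2 : ℝ) ^ (1 - 2 * α))) * E * pdist y x ^ (2 * α) := by
  set q : ℝ := (2 : ℝ) ^ (1 - 2 * α) with hq
  have hq0 : 0 ≤ q := by positivity
  have hq1 : q < 1 := Real.rpow_lt_one_of_one_lt_of_neg (by norm_num) (by linarith)
  choose! c m hcm using h1
  -- Evaluation at the base point replaces the constant `c r` by `w x` at the price of a factor two.
  have hm : ∀ r, 0 < r → r ≤ 1 → ∀ y, pdist y x ≤ r →
      |w y - w x - m r * (y - x) 0| ≤ 2 * E * r ^ (2 * α) := by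
    intro r hr hr1 y hy
    have a1 := abs_le.1 (hcm r hr hr1 y hy)
    have a2 := hcm r hr hr1 x (by rw [pdist_self]; exact hr.le)
    rw [sub_self, PiLp.zero_apply, mul_zero, sub_zero] at a2
    have a2 := abs_le.1 a2
    exact abs_le.2 ⟨by linarith [a1.1, a2.2], by linarith [a1.2, a2.1]⟩
  have hpow : ∀ r : ℝ, 0 < r → r ^ (2 * α) = r ^ (2 * α - 1) * r := fun r hr => by
    rw [Real.rpow_sub hr, Real.rpow_one]; field_simp
  have he : ∀ r : ℝ, ((x + r • e₁) - x) 0 = r := fun r => by simp [e₁]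
  -- The slopes at `r` and `r/2` differ by at most `8 E r^{2α-1}`. Halving the scale contracts by `q
  -- = 2^{1-2α} < 1`, which is where `α > 1/2` enters; `h2` supplies only the finite starting
  -- constant `2E + M`.
  have hP : ∀ r, 0 < r → r ≤ 1 → |m r - ν| ≤ 8 * E / (1 - q) * r ^ (2 * α - 1) := by
    refine absorb (P := fun V => ∀ r, 0 < r → r ≤ 1 → |m r - ν| ≤ V * r ^ (2 * α - 1)) ?_ ?_
      hq0 hq1 (by positivity) (U₀ := 2 * E + M) (by positivity) ?_ ?_
    · intro V h r hr hr1
      exact le_of_forall_pos_le_add_mul (by positivity) fun ε hε => h ε hε r hr hr1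
    · intro V W hVW h r hr hr1
      exact (h r hr hr1).trans (by gcongr)
    · intro r hr hr1
      have a1 := abs_le.1 (hm r hr hr1 (x + r • e₁) (pdist_add_smul_e₁ x hr.le).le)
      have a2 := abs_le.1 (h2 (x + r • e₁))
      rw [he, pdist_add_smul_e₁ x hr.le] at a2
      rw [he] at a1
      have : |m r - ν| * r ≤ (2 * E + M) * r ^ (2 * α) := by
        rw [← abs_of_pos hr, ← abs_mul, abs_of_pos hr]
        exact abs_le.2 ⟨by linarith [a1.2, a2.1], by linarith [a1.1, a2.2]⟩
      rw [hpow r hr, ← mul_assoc] at this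
      exact le_of_mul_le_mul_right this hr
    · intro V hV h r hr hr1
      have hr2 : 0 < r / 2 := by positivity
      have a0 := h (r / 2) hr2 (by linarith)
      have a1 := abs_le.1 (hm r hr hr1 (x + (r / 2) • e₁)
        (by rw [pdist_add_smul_e₁ x hr2.le]; linarith))
      have a2 := abs_le.1 (hm (r / 2) hr2 (by linarith) (x + (r / 2) • e₁)
        (pdist_add_smul_e₁ x hr2.le).le)
      rw [he] at a1 a2
      have b1 : (r / 2) ^ (2 * α) ≤ r ^ (2 * α) :=
        Real.rpow_le_rpow hr2.le (by linarith) (by linarith)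
      have b2 := mul_le_mul_of_nonneg_left b1 hE
      have b3 : |m r - m (r / 2)| * r ≤ 8 * E * r ^ (2 * α) := by
        have : |m r - m (r / 2)| * (r / 2) ≤ 4 * E * r ^ (2 * α) := by
          rw [← abs_of_pos hr2, ← abs_mul, abs_of_pos hr2]
          exact abs_le.2 ⟨by linarith [a1.2, a2.1], by linarith [a1.1, a2.2]⟩
        linarith
      rw [hpow r hr, ← mul_assoc] at b3
      have b4 := le_of_mul_le_mul_right b3 hr
      have b5 : (r / 2) ^ (2 * α - 1) = q * r ^ (2 * α - 1) := by
        rw [Real.div_rpow hr.le (by norm_num), hq, show 1 - 2 * α = -(2 * α - 1) by ring,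
          Real.rpow_neg (by norm_num)]
        field_simp
      rw [b5] at a0
      calc |m r - ν| ≤ |m r - m (r / 2)| + |m (r / 2) - ν| := abs_sub_le _ _ _
        _ ≤ _ := add_le_add b4 a0
        _ = _ := by ring
  rcases eq_or_ne y x with rfl | hne
  · simp [pdist_self, Real.zero_rpow (by linarith : 2 * α ≠ 0)]
  have hd := pdist_pos hne
  set d := pdist y x with hddef
  have a1 := abs_le.1 (hm d hd hy y le_rfl)
  have a2 := hP d hd hy
  have a3 : |(m d - ν) * (y - x) 0| ≤ 8 * E / (1 - q) * d ^ (2 * α) := by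
    rw [abs_mul, hpow d hd, ← mul_assoc]
    have h1q : 0 < 1 - q := by linarith
    exact mul_le_mul a2 (abs_apply_zero_le_pnorm _) (abs_nonneg _) (by positivity)
  have a3 := abs_le.1 a3
  have e : (2 + 8 / (1 - q)) * E * d ^ (2 * α)
      = 2 * E * d ^ (2 * α) + 8 * E / (1 - q) * d ^ (2 * α) := by ring
  rw [e]
  exact abs_le.2 ⟨by linarith [a1.1, a3.1], by linarith [a1.2, a3.2]⟩

/-! ### Bounds for the modelling constant, the supremum and the Hölder constant, and their
combination. -/

namespace ModelData

/-- Testing with `y = x + e₁`, at distance one, periodicity removes the increments of `u` and of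
every `v i`, leaving only `ν x`. -/
theorem abs_ν_le {I : ℕ} {α lam C₀ δ K : ℝ} {N s : Fin I → ℝ} {F : Fin I → ℝ → ℝ → Plane → ℝ}
    {v : Fin I → ℝ → Plane → ℝ} {a : Plane → ℝ} {σ : Fin I → Plane → ℝ} {u ν : Plane → ℝ}
    (h : ModelData α lam C₀ δ K N s F v a σ u) {M : ℝ} {x : Plane}
    (hM : ∀ y, pdist y x ≤ 1 →
      |u y - u x - ∑ i, σ i x * (v i (a x) y - v i (a x) x) - ν x * (y - x) 0|
        ≤ M * pdist y x ^ (2 * α)) : |ν x| ≤ M := by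
  have h1 := pdist_add_smul_e₁ x zero_le_one
  rw [one_smul] at h1
  have h2 := hM (x + e₁) h1.le
  have h3 : (e₁ : Plane) 0 = 1 := by simp [e₁]
  have h4 : ∀ i, σ i x * (v i (a x) (x + e₁) - v i (a x) x) = 0 := fun i => by
    rw [h.v_periodic i _ (h.a_mem x), sub_self, mul_zero]
  simpa [h1, h3, h4, h.u_periodic] using h2

/-- For distances up to one, affine approximation at all scales returns half of any admissible
constant plus the data. Beyond one, the supremum of the frozen part and the bound on `ν` suffice
because `d ≤ d^{2α}`. -/
theorem modelled_bound (α lam C₀ : ℝ) (hα : 1 / 2 < α) (hα' : α < 1) (hlam : 0 < lam)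
    (hC₀ : 0 ≤ C₀) : ∃ C : ℝ, 0 < C ∧ ∀ (I : ℕ) (δ K : ℝ) (N s : Fin I → ℝ)
      (F : Fin I → ℝ → ℝ → Plane → ℝ) (v : Fin I → ℝ → Plane → ℝ) (a : Plane → ℝ)
      (σ : Fin I → Plane → ℝ) (u ν : Plane → ℝ) (M U₀ U₁ : ℝ),
      ModelData α lam C₀ δ K N s F v a σ u → 0 ≤ M → Modelled α u v a σ ν M →
      (∀ x, |u x| ≤ U₀) → 0 ≤ U₁ → (∀ x y, |u x - u y| ≤ U₁ * pdist x y ^ α) →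
      Modelled α u v a σ ν (C * (K + ∑ i, s i * N i + U₀ + δ * U₁)) := by
  obtain ⟨C, hC, happ⟩ := exists_affine_approx α lam C₀ hα hα' hlam hC₀
  have hq1 : (2 : ℝ) ^ (1 - 2 * α) < 1 :=
    Real.rpow_lt_one_of_one_lt_of_neg (by norm_num) (by linarith)
  set b : ℝ := 2 + 8 / (1 - (2 : ℝ) ^ (1 - 2 * α)) with hb
  have hb0 : 0 < b := by
    have : 0 < 1 - (2 : ℝ) ^ (1 - 2 * α) := by linarith
    positivity
  obtain ⟨L, hL, hLs⟩ := exists_large_scale (a := b * C) (b := b * C)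
    (by linarith : 0 < 2 * α) (by linarith : 0 < 2 - 2 * α) (by norm_num : (0 : ℝ) < 1 / 2)
  have hL0 : 0 < L := by linarith
  refine ⟨2 * (b * C * L ^ 4 + 2 + 2 * C₀), by positivity, ?_⟩
  intro I δ K N s F v a σ u ν M U₀ U₁ h hM0 hM hU₀ hU₁0 hU₁
  have hα0 : 0 < α := by linarith
  have hX := h.X_nonneg
  set X := ∑ i, s i * N i
  have hK := h.K_nonneg
  have hδ := h.δ_nonneg
  have hU0 : 0 ≤ U₀ := (abs_nonneg _).trans (hU₀ 0)
  have hdu : 0 ≤ δ * U₁ := mul_nonneg hδ hU₁0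
  set Y := K + X + U₀ + δ * U₁ with hY
  have hY0 : 0 ≤ Y := by positivity
  have key := absorb (P := fun V => Modelled α u v a σ ν V) (q := 1 / 2)
    (K := (b * C * L ^ 4 + 2 + 2 * C₀) * Y) ?_ ?_
    (by norm_num) (by norm_num) (by positivity) hM0 hM ?_
  · have e : (b * C * L ^ 4 + 2 + 2 * C₀) * Y / (1 - 1 / 2)
        = 2 * (b * C * L ^ 4 + 2 + 2 * C₀) * Y := by ring
    rwa [e] at key
  · intro V hV x y
    exact le_of_forall_pos_le_add_mul (Real.rpow_nonneg (pdist_nonneg y x) _)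
      fun ε hε => hV ε hε x y
  · intro V W hVW hV x y
    exact (hV x y).trans
      (mul_le_mul_of_nonneg_right hVW (Real.rpow_nonneg (pdist_nonneg y x) _))
  · intro V hV0 hV x y
    set E := C * (L ^ (-(2 * α)) + L ^ (-(2 - 2 * α))) * V + C * L ^ 4 * Y with hE
    have hE0 : 0 ≤ E := by positivity
    have ediff : ∀ y, frozenPart v a σ u x y - frozenPart v a σ u x x
        = u y - u x - ∑ i, σ i x * (v i (a x) y - v i (a x) x) := fun y => by
      simp only [frozenPart, mul_sub, Finset.sum_sub_distrib]; ring
    have loc : ∀ y, pdist y x ≤ 1 →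
        |u y - u x - ∑ i, σ i x * (v i (a x) y - v i (a x) x) - ν x * (y - x) 0|
          ≤ b * E * pdist y x ^ (2 * α) := by
      intro y hy
      have := abs_sub_le_of_affine_approx hα (w := frozenPart v a σ u x) (ν := ν x) hE0 hV0
        (fun r hr hr1 => happ I δ K N s F v a σ u ν V U₀ U₁ L r x h hV0 hV hU₀ hU₁0 hU₁ hL hr hr1)
        (fun y => by rw [ediff]; exact hV x y) hy
      rwa [ediff] at this
    have hbE : b * E ≤ 1 / 2 * V + b * C * L ^ 4 * Y := by
      have := mul_le_mul_of_nonneg_right hLs hV0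
      rw [hE]; linarith
    rcases le_or_gt (pdist y x) 1 with hy | hy
    · refine (loc y hy).trans
        (mul_le_mul_of_nonneg_right ?_ (Real.rpow_nonneg (pdist_nonneg y x) _))
      have : 0 ≤ (2 + 2 * C₀) * Y := by positivity
      linarith
    · have hν := h.abs_ν_le loc
      set d := pdist y x with hd
      have hd1 : 1 ≤ d ^ (2 * α) := Real.one_le_rpow hy.le (by linarith)
      have hd2 : d ≤ d ^ (2 * α) := by
        calc d = d ^ (1 : ℝ) := (Real.rpow_one d).symm
          _ ≤ _ := Real.rpow_le_rpow_of_exponent_le hy.le (by linarith)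
      have a1 : |ν x * (y - x) 0| ≤ b * E * d ^ (2 * α) := by
        rw [abs_mul]
        exact mul_le_mul hν ((abs_apply_zero_le_pnorm _).trans hd2) (abs_nonneg _) (by positivity)
      have a2 := h.abs_frozenPart_le hU₀ x y
      have a3 := h.abs_frozenPart_le hU₀ x x
      have a4 : |u y - u x - ∑ i, σ i x * (v i (a x) y - v i (a x) x)|
          ≤ (2 + 2 * C₀) * Y * d ^ (2 * α) := by
        rw [← ediff]
        refine (abs_sub _ _).trans ((add_le_add a2 a3).trans ?_)
        have h1 : U₀ + C₀ * X + (U₀ + C₀ * X) ≤ (2 + 2 * C₀) * Y := by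
          have h2 : C₀ * X ≤ C₀ * Y := mul_le_mul_of_nonneg_left (by linarith) hC₀
          linarith
        exact h1.trans (le_mul_of_one_le_right (by positivity) hd1)
      refine (abs_sub _ _).trans ((add_le_add a4 a1).trans ?_)
      have := mul_le_mul_of_nonneg_right hbE (by linarith : 0 ≤ d ^ (2 * α))
      linarith

/-- The maximum principle with the variable coefficient `a` bounds `u_ρ`; the Hölder constant
controls the distance from `u_ρ` to `u`. -/
theorem sup_bound {I : ℕ} {α lam C₀ δ K : ℝ} (hα : 0 < α) (hα' : α < 1) (hlam : 0 < lam)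
    {N s : Fin I → ℝ}
    {F : Fin I → ℝ → ℝ → Plane → ℝ} {v : Fin I → ℝ → Plane → ℝ} {a : Plane → ℝ}
    {σ : Fin I → Plane → ℝ} {u : Plane → ℝ} (h : ModelData α lam C₀ δ K N s F v a σ u) {U₁ : ℝ}
    (hU₁0 : 0 ≤ U₁) (hU₁ : ∀ x y, |u x - u y| ≤ U₁ * pdist x y ^ α) {ρ : ℝ} (hρ : 0 < ρ)
    (hρ1 : ρ ≤ 1) (x : Plane) :
    |u x| ≤ (K + ∑ i, s i * N i) * ρ ^ (α - 2) + kerConst * (U₁ * ρ ^ α) := by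
  obtain ⟨B, hB⟩ := h.u_bounded
  have h1 : ∀ x, |mollOp (a x) u ρ hρ x| ≤ (K + ∑ i, s i * N i) * ρ ^ (α - 2) := by
    intro x
    have e1 := h.approx ρ hρ hρ1 x
    have e2 : |∑ i, σ i x * F i (a x) ρ x| ≤ ρ ^ (α - 2) * ∑ i, s i * N i := by
      refine abs_sum_le_mul fun i => ?_
      rw [abs_mul]
      calc _ ≤ s i * (N i * ρ ^ (α - 2)) := mul_le_mul (h.σ_bound i x)
            (h.F_bound i _ (h.a_mem x) ρ hρ hρ1 x) (abs_nonneg _) (h.s_nonneg i)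
        _ = _ := by ring
    have e3 : ρ ^ (2 * α - 2) ≤ ρ ^ (α - 2) :=
      Real.rpow_le_rpow_of_exponent_ge hρ hρ1 (by linarith)
    have e4 := mul_le_mul_of_nonneg_left e3 h.K_nonneg
    have e5 := abs_sub_abs_le_abs_sub (mollOp (a x) u ρ hρ x) (∑ i, σ i x * F i (a x) ρ x)
    linarith
  have h2 := abs_le.1 (abs_conv_le_of_parabolicOp h.u_continuous hB (ker ρ hρ) a
    (fun x => hlam.le.trans (h.a_mem x).1) (fun x => (h.a_mem x).2) h1 x)
  have h3 := abs_le.1 (abs_conv_ker_sub_self_le hα (by linarith) hB hU₁0 hU₁ hρ x)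
  exact abs_le.2 ⟨by linarith [h2.1, h3.2], by linarith [h2.2, h3.1]⟩

/-- Up to distance one each term of the model is at most of order `d^α`, with `ν` bounded by
periodicity; beyond one the supremum is enough. -/
theorem holder_bound {I : ℕ} {α lam C₀ δ K : ℝ} (hα : 0 < α)
    {N s : Fin I → ℝ}
    {F : Fin I → ℝ → ℝ → Plane → ℝ} {v : Fin I → ℝ → Plane → ℝ} {a : Plane → ℝ}
    {σ : Fin I → Plane → ℝ} {u ν : Plane → ℝ} (h : ModelData α lam C₀ δ K N s F v a σ u)
    (hα' : α < 1) {M U₀ : ℝ} (hM0 : 0 ≤ M) (hM : Modelled α u v a σ ν M) (hU₀ : ∀ x, |u x| ≤ U₀)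
    (x y : Plane) :
    |u x - u y| ≤ (2 * M + C₀ * (∑ i, s i * N i) + 2 * U₀) * pdist x y ^ α := by
  have hC := h.C₀_nonneg
  have hX := h.X_nonneg
  have hU0 : 0 ≤ U₀ := (abs_nonneg _).trans (hU₀ 0)
  have hd : 0 ≤ pdist x y ^ α := Real.rpow_nonneg (pdist_nonneg x y) α
  rcases eq_or_ne x y with rfl | hne
  · simp [pdist_self, Real.zero_rpow hα.ne']
  have hpos := pdist_pos hne
  rcases le_or_gt (pdist x y) 1 with h1 | h1
  · have hν : |ν y| ≤ M := h.abs_ν_le fun z _ => hM y z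
    have b1 := hM y x
    have b2 : |∑ i, σ i y * (v i (a y) x - v i (a y) y)|
        ≤ (C₀ * pdist x y ^ α) * ∑ i, s i * N i := by
      refine abs_sum_le_mul fun i => ?_
      rw [abs_mul]
      calc _ ≤ s i * (C₀ * N i * pdist x y ^ α) := mul_le_mul (h.σ_bound i y)
            (h.v_holder i _ (h.a_mem y) x y) (abs_nonneg _) (h.s_nonneg i)
        _ = _ := by ring
    have p1 : pdist x y ^ (2 * α) ≤ pdist x y ^ α :=
      Real.rpow_le_rpow_of_exponent_ge hpos h1 (by linarith)
    have p2 : pdist x y ≤ pdist x y ^ α := by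
      calc pdist x y = pdist x y ^ (1 : ℝ) := (Real.rpow_one _).symm
        _ ≤ _ := Real.rpow_le_rpow_of_exponent_ge hpos h1 hα'.le
    have b3 : |ν y * (x - y) 0| ≤ M * pdist x y ^ α := by
      rw [abs_mul]
      exact mul_le_mul hν ((abs_apply_zero_le_pnorm _).trans p2) (abs_nonneg _) hM0
    have b4 := mul_le_mul_of_nonneg_left p1 hM0
    have b5 : 0 ≤ 2 * U₀ * pdist x y ^ α := by positivity
    have c1 := abs_le.1 (b1.trans b4)
    have c2 := abs_le.1 b2
    have c3 := abs_le.1 b3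
    exact abs_le.2 ⟨by linarith [c1.1, c2.1, c3.1], by linarith [c1.2, c2.2, c3.2]⟩
  · have h2 : 1 ≤ pdist x y ^ α := Real.one_le_rpow h1.le hα.le
    have h3 : |u x - u y| ≤ 2 * U₀ :=
      (abs_sub _ _).trans (by linarith [hU₀ x, hU₀ y])
    have h4 : 2 * U₀ ≤ 2 * U₀ * pdist x y ^ α := le_mul_of_one_le_right (by positivity) h2
    have h5 : 0 ≤ (2 * M + C₀ * ∑ i, s i * N i) * pdist x y ^ α := by positivity
    linarith

/-- The a priori estimate with real constants. -/
theorem estimate (α lam C₀ : ℝ) (hα : 1 / 2 < α) (hα' : α < 1) (hlam : 0 < lam)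
    (hC₀ : 0 ≤ C₀) : ∃ δ C : ℝ, 0 < δ ∧ δ ≤ 1 ∧ 0 < C ∧ ∀ (I : ℕ) (K : ℝ) (N s : Fin I → ℝ)
      (F : Fin I → ℝ → ℝ → Plane → ℝ) (v : Fin I → ℝ → Plane → ℝ) (a : Plane → ℝ)
      (σ : Fin I → Plane → ℝ) (u ν : Plane → ℝ) (M U₀ U₁ : ℝ),
      ModelData α lam C₀ δ K N s F v a σ u → 0 ≤ M → Modelled α u v a σ ν M →
      (∀ x, |u x| ≤ U₀) → 0 ≤ U₁ → (∀ x y, |u x - u y| ≤ U₁ * pdist x y ^ α) →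
      Modelled α u v a σ ν (C * (K + ∑ i, s i * N i)) ∧
      (∀ x, |u x| ≤ C * (K + ∑ i, s i * N i)) ∧
      ∀ x y, |u x - u y| ≤ C * (K + ∑ i, s i * N i) * pdist x y ^ α := by
  have hα0 : 0 < α := by linarith
  obtain ⟨A, hA, hmod⟩ := modelled_bound α lam C₀ hα hα' hlam hC₀
  have hk := kerConst_nonneg
  -- the Hölder constant is controlled by `D * (Y + U₀)`
  set D := 2 * (2 * A + C₀ + 2) with hD
  have hD0 : 0 < D := by positivity
  -- At scale `1/L` the part of the supremum bound that returns the supremum itself has coefficient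
  -- at most one half.
  obtain ⟨L, hL, hLs⟩ := exists_large_scale (a := kerConst * D) (b := 0) hα0 hα0
    (by norm_num : (0 : ℝ) < 1 / 2)
  have hL0 : 0 < L := by linarith
  set Q := 2 * (L ^ (-(α - 2)) + 1) with hQ
  have hQ0 : 0 < Q := by positivity
  -- `holder_bound` doubles the modelling constant, so `A δ ≤ 1/4` leaves the factor one half for
  -- absorption.
  refine ⟨min 1 (1 / (4 * A)), D * (1 + Q) + Q + A * (1 + Q + D * (1 + Q)), by positivity,
    min_le_left _ _, by positivity, ?_⟩
  intro I K N s F v a σ u ν M U₀ U₁ h hM0 hM hU₀ hU₁0 hU₁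
  set δ := min 1 (1 / (4 * A)) with hδ
  have hδ0 : 0 ≤ δ := h.δ_nonneg
  have hδA : A * δ ≤ 1 / 4 := by
    calc A * δ ≤ A * (1 / (4 * A)) := mul_le_mul_of_nonneg_left (min_le_right _ _) hA.le
      _ = 1 / 4 := by field_simp
  have hX := h.X_nonneg
  set X := ∑ i, s i * N i
  have hK := h.K_nonneg
  have hrp : ∀ x y : Plane, 0 ≤ pdist x y ^ α := fun x y => Real.rpow_nonneg (pdist_nonneg x y) α
  -- Hölder seminorm
  have step1 : ∀ V₀, (∀ x, |u x| ≤ V₀) →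
      ∀ x y, |u x - u y| ≤ D * (K + X + V₀) * pdist x y ^ α := by
    intro V₀ hV₀
    have hV0 : 0 ≤ V₀ := (abs_nonneg _).trans (hV₀ 0)
    have key := absorb (P := fun V => ∀ x y, |u x - u y| ≤ V * pdist x y ^ α) (q := 1 / 2)
      (K := (2 * A + C₀ + 2) * (K + X + V₀)) ?_ ?_
      (by norm_num) (by norm_num) (by positivity) hU₁0 hU₁ ?_
    · have e : (2 * A + C₀ + 2) * (K + X + V₀) / (1 - 1 / 2) = D * (K + X + V₀) := by
        rw [hD]; ring
      rwa [e] at key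
    · intro V hV x y
      exact le_of_forall_pos_le_add_mul (hrp x y) fun ε hε => hV ε hε x y
    · intro V W hVW hV x y
      exact (hV x y).trans (mul_le_mul_of_nonneg_right hVW (hrp x y))
    · intro V hV0' hV x y
      have hm := hmod I δ K N s F v a σ u ν M V₀ V h hM0 hM hV₀ hV0' hV
      have hb := h.holder_bound hα0 hα' (by positivity) hm hV₀ x y
      refine hb.trans (mul_le_mul_of_nonneg_right ?_ (hrp x y))
      have e1 : A * δ * V ≤ 1 / 4 * V := mul_le_mul_of_nonneg_right hδA hV0'
      have e2 : C₀ * X ≤ C₀ * (K + X + V₀) := mul_le_mul_of_nonneg_left (by linarith) hC₀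
      linarith
  -- supremum
  have step2 : ∀ x, |u x| ≤ Q * (K + X) := by
    have key := absorb (P := fun V => ∀ x, |u x| ≤ V) (q := 1 / 2)
      (K := (L ^ (-(α - 2)) + 1) * (K + X)) ?_ ?_
      (by norm_num) (by norm_num) (by positivity) ((abs_nonneg _).trans (hU₀ 0)) hU₀ ?_
    · have e : (L ^ (-(α - 2)) + 1) * (K + X) / (1 - 1 / 2) = Q * (K + X) := by rw [hQ]; ring
      rwa [e] at key
    · intro V hV x
      exact le_of_forall_pos_le_add fun ε hε => hV ε hε x
    · intro V W hVW hV x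
      exact (hV x).trans hVW
    · intro V hV0 hV x
      have hρ1 : L⁻¹ ≤ 1 := inv_le_one_of_one_le₀ (by linarith)
      have hb := h.sup_bound hα0 hα' hlam (by positivity) (step1 V hV) (inv_pos.2 hL0) hρ1 x
      rw [Real.inv_rpow hL0.le, ← Real.rpow_neg hL0.le, Real.inv_rpow hL0.le,
        ← Real.rpow_neg hL0.le] at hb
      have e1 : kerConst * D * L ^ (-α) * (K + X + V) ≤ 1 / 2 * (K + X + V) :=
        mul_le_mul_of_nonneg_right (by linarith) (by positivity)
      refine hb.trans ?_
      have : 0 ≤ K + X := by positivity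
      linarith
  have hY0 : 0 ≤ K + X := by positivity
  have step3 := step1 _ step2
  have step4 := hmod I δ K N s F v a σ u ν M _ _ h hM0 hM step2 (by positivity) step3
  have n1 : 0 ≤ D * (1 + Q) * (K + X) := by positivity
  have n2 : 0 ≤ Q * (K + X) := by positivity
  have n3 : 0 ≤ A * (1 + Q + D * (1 + Q)) * (K + X) := by positivity
  refine ⟨fun x y => (step4 x y).trans (mul_le_mul_of_nonneg_right ?_
    (Real.rpow_nonneg (pdist_nonneg y x) _)), fun x => (step2 x).trans ?_, fun x y =>
    (step3 x y).trans (mul_le_mul_of_nonneg_right ?_ (hrp x y))⟩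
  · have e1 : A * (δ * (D * (K + X + Q * (K + X)))) ≤ A * (1 * (D * (K + X + Q * (K + X)))) := by
      gcongr
      exact h.δ_le_one
    linarith
  · linarith
  · linarith

end ModelData

/-! ### Translation of the extended norms -/

theorem abs_le_of_supNorm_le {g : Plane → ℝ} {c : ℝ} (hc : 0 ≤ c)
    (h : supNorm g ≤ ENNReal.ofReal c) (x : Plane) : |g x| ≤ c :=
  (ENNReal.ofReal_le_ofReal_iff hc).1 ((le_iSup (fun x => ENNReal.ofReal |g x|) x).trans h)

theorem supNorm_le {g : Plane → ℝ} {c : ℝ} (h : ∀ x, |g x| ≤ c) :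
    supNorm g ≤ ENNReal.ofReal c :=
  iSup_le fun x => ENNReal.ofReal_le_ofReal (h x)

theorem abs_sub_le_of_holderSeminorm_le {α c : ℝ} {g : Plane → ℝ} (hα : 0 < α) (hc : 0 ≤ c)
    (h : holderSeminorm α g ≤ ENNReal.ofReal c) (x y : Plane) :
    |g x - g y| ≤ c * pdist x y ^ α := by
  rcases eq_or_ne x y with rfl | hne
  · simp [pdist_self, Real.zero_rpow hα.ne']
  · have h1 : ENNReal.ofReal (|g x - g y| / pdist x y ^ α) ≤ ENNReal.ofReal c :=
      iSup_le_iff.1 (iSup_le_iff.1 (iSup_le_iff.1 h x) y) hne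
    have := (ENNReal.ofReal_le_ofReal_iff hc).1 h1
    rwa [div_le_iff₀ (Real.rpow_pos_of_pos (pdist_pos hne) α)] at this

theorem holderSeminorm_le {α c : ℝ} {g : Plane → ℝ}
    (h : ∀ x y, |g x - g y| ≤ c * pdist x y ^ α) : holderSeminorm α g ≤ ENNReal.ofReal c :=
  iSup_le fun x => iSup_le fun y => iSup_le fun hne => ENNReal.ofReal_le_ofReal <| by
    rw [div_le_iff₀ (Real.rpow_pos_of_pos (pdist_pos hne) α)]
    exact h x y

theorem MemHolder.bounds {α : ℝ} {g : Plane → ℝ} (hα : 0 < α) (h : MemHolder α g) :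
    (∀ x, |g x| ≤ (holderNorm α g).toReal) ∧
      ∀ x y, |g x - g y| ≤ (holderNorm α g).toReal * pdist x y ^ α := by
  have e : ENNReal.ofReal (holderNorm α g).toReal = holderNorm α g := ENNReal.ofReal_toReal h.ne
  exact ⟨abs_le_of_supNorm_le ENNReal.toReal_nonneg (le_self_add.trans e.ge),
    abs_sub_le_of_holderSeminorm_le hα ENNReal.toReal_nonneg (le_add_self.trans e.ge)⟩

theorem modelled_of_modellingConst_le {I : ℕ} {α M : ℝ} (hα : 0 < α) {u : Plane → ℝ}
    {v : Fin I → ℝ → Plane → ℝ} {a : Plane → ℝ} {σ : Fin I → Plane → ℝ} {ν : Plane → ℝ}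
    (hM : 0 ≤ M) (h : modellingConst α u v a σ ν ≤ ENNReal.ofReal M) :
    Modelled α u v a σ ν M := by
  intro x y
  rcases eq_or_ne x y with rfl | hne
  · simp [pdist_self, Real.zero_rpow (by linarith : 2 * α ≠ 0)]
  · have h1 : ENNReal.ofReal (|u y - u x - ∑ i, σ i x * (v i (a x) y - v i (a x) x)
        - ν x * (y - x) 0| / pdist x y ^ (2 * α)) ≤ ENNReal.ofReal M :=
      iSup_le_iff.1 (iSup_le_iff.1 (iSup_le_iff.1 h x) y) hne
    have := (ENNReal.ofReal_le_ofReal_iff hM).1 h1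
    rwa [div_le_iff₀ (Real.rpow_pos_of_pos (pdist_pos hne) _), pdist_comm] at this

theorem modellingConst_le_of_modelled {I : ℕ} {α M : ℝ} {u : Plane → ℝ}
    {v : Fin I → ℝ → Plane → ℝ} {a : Plane → ℝ} {σ : Fin I → Plane → ℝ} {ν : Plane → ℝ}
    (h : Modelled α u v a σ ν M) : modellingConst α u v a σ ν ≤ ENNReal.ofReal M :=
  iSup_le fun x => iSup_le fun y => iSup_le fun hne => ENNReal.ofReal_le_ofReal <| by
    rw [div_le_iff₀ (Real.rpow_pos_of_pos (pdist_pos hne) _), pdist_comm]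
    exact h x y

theorem rpow_quarter_pow_four {ρ : ℝ} (hρ : 0 < ρ) : (ρ ^ 4) ^ (1 / 4 : ℝ) = ρ := by
  rw [← Real.rpow_natCast, ← Real.rpow_mul hρ.le]; norm_num

theorem abs_le_of_scaled_supNorm_le {g : Plane → ℝ} {ρ β c : ℝ} (hρ : 0 < ρ) (hc : 0 ≤ c)
    (h : ENNReal.ofReal (((ρ ^ 4) ^ (1 / 4 : ℝ)) ^ β) * supNorm g ≤ ENNReal.ofReal c) (x : Plane) :
    |g x| ≤ c * ρ ^ (-β) := by
  rw [rpow_quarter_pow_four hρ] at h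
  have h1 : ENNReal.ofReal (ρ ^ β * |g x|) ≤ ENNReal.ofReal c := by
    rw [ENNReal.ofReal_mul (by positivity)]
    exact le_trans (by gcongr; exact le_iSup (fun x => ENNReal.ofReal |g x|) x) h
  have h2 := (ENNReal.ofReal_le_ofReal_iff hc).1 h1
  rw [Real.rpow_neg hρ.le, ← div_eq_mul_inv, le_div_iff₀ (by positivity)]
  linarith

theorem abs_mollify_le_of_negNorm_le {f : Distr} {β c : ℝ} (hc : 0 ≤ c)
    (h : negNorm β f ≤ ENNReal.ofReal c) {ρ : ℝ} (hρ : 0 < ρ) (hρ1 : ρ ≤ 1) (x : Plane) :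
    |f.mollify (ρ ^ 4) (pow_pos hρ 4) x| ≤ c * ρ ^ (-β) :=
  abs_le_of_scaled_supNorm_le hρ hc
    (iSup_le_iff.1 (iSup_le_iff.1 (iSup_le_iff.1 h (ρ ^ 4)) (pow_pos hρ 4))
      (pow_le_one₀ hρ.le hρ1)) x

/-! ### Mollified equations -/

/-- The factor `c` records the sign from each reflection, so the statement can be applied again to
reach second derivatives. -/
theorem lineDerivOp_reflect {φ χ : 𝓢(Plane, ℝ)} {x : Plane} {c : ℝ}
    (h : ∀ y, φ y = c * χ (x - y)) (m y : Plane) : (∂_{m} φ) y = -c * (∂_{m} χ) (x - y) := by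
  have h1 : HasFDerivAt (fun y : Plane => x - y) (-ContinuousLinearMap.id ℝ Plane) y :=
    (hasFDerivAt_id y).const_sub x
  have h2 := ((χ.hasFDerivAt (x - y)).comp y h1).const_mul c
  have h3 : (φ : Plane → ℝ) = fun y => c * (χ ∘ fun y => x - y) y := funext h
  rw [SchwartzMap.lineDerivOp_apply_eq_fderiv, SchwartzMap.lineDerivOp_apply_eq_fderiv, h3,
    h2.fderiv]
  simp

/-- The weak equation tested with the reflected kernel centred at `x`: reflection reverses the sign
of the time derivative and preserves that of the second space derivative. -/
theorem SolvesFrozen.mollOp_eq {a₀ : ℝ} {f : Distr} {v : Plane → ℝ} (h : SolvesFrozen a₀ f v)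
    (hv : Continuous v) {B : ℝ} (hB : ∀ x, |v x| ≤ B) {ρ : ℝ} (hρ : 0 < ρ) (x : Plane) :
    mollOp a₀ v ρ hρ x = f.mollify (ρ ^ 4) (pow_pos hρ 4) x := by
  rw [Distr.mollify, ← h]
  have e0 : ∀ y, psiAt (ρ ^ 4) (pow_pos hρ 4) x y = 1 * ker ρ hρ (x - y) := fun y => by
    rw [psiAt_apply, one_mul, ker]
  have e1 := lineDerivOp_reflect e0
  have e2 := lineDerivOp_reflect (e1 e₁) e₁
  have i1 := integrable_conv hv hB (∂_{e₂} (ker ρ hρ)) x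
  have i2 := (integrable_conv hv hB (∂_{e₁} (∂_{e₁} (ker ρ hρ))) x).const_mul a₀
  have i3 := integrable_conv hv hB (ker ρ hρ) x
  have i12 : Integrable (fun y => v y * (∂_{e₂} (ker ρ hρ)) (x - y)
    - a₀ * (v y * (∂_{e₁} (∂_{e₁} (ker ρ hρ))) (x - y))) := i1.sub i2
  rw [mollOp, conv, conv, conv, ← integral_const_mul, ← integral_sub i1 i2, ← integral_add i12 i3]
  congr 1; ext y
  rw [e0, e1, e2]
  ring

theorem parabolicOp_mollify_eq {u : Plane → ℝ} (hu : Continuous u) {B : ℝ} (hB : ∀ x, |u x| ≤ B)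
    (a : Plane → ℝ) {ρ : ℝ} (hρ : 0 < ρ) (x : Plane) :
    parabolicOp a (mollify u (ρ ^ 4) (pow_pos hρ 4)) x = mollOp (a x) u ρ hρ x := by
  have e : mollify u (ρ ^ 4) (pow_pos hρ 4) = conv u (ker ρ hρ) := rfl
  have e1 : (fun z => lineDeriv ℝ (conv u (ker ρ hρ)) z e₁) = conv u (∂_{e₁} (ker ρ hρ)) :=
    funext fun z => lineDeriv_conv hu hB _ z e₁
  rw [parabolicOp, e, e1, lineDeriv_conv hu hB, lineDeriv_conv hu hB, mollOp]

/-! ### Constant-coefficient estimates for families -/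

theorem mollOp_sub {a₀ a₁ : ℝ} {v w : Plane → ℝ} (hv : Continuous v) (hw : Continuous w)
    {B B' : ℝ} (hB : ∀ x, |v x| ≤ B) (hB' : ∀ x, |w x| ≤ B') {ρ : ℝ} (hρ : 0 < ρ) (x : Plane) :
    mollOp a₀ (fun y => v y - w y) ρ hρ x = mollOp a₀ v ρ hρ x - mollOp a₁ w ρ hρ x
      + (a₀ - a₁) * conv w (∂_{e₁} (∂_{e₁} (ker ρ hρ))) x := by
  have e := fun φ => conv_sub_left φ x (integrable_conv hv hB φ x) (integrable_conv hw hB' φ x)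
  simp only [mollOp, e]
  ring

/-- The difference of two solutions solves the equation for `a₀` with right-hand side `F a₀ - F a₁ +
(a₀ - a₁) ∂₁² v a₁`. Both parts are of size `|a₀ - a₁| ρ^{α-2}`, so `schauder_const` applies a
second time. -/
theorem schauder_family (α lam : ℝ) (hα : 0 < α) (hα' : α < 1) (hlam : 0 < lam) :
    ∃ C : ℝ, 0 < C ∧ ∀ (N : ℝ) (F : ℝ → ℝ → Plane → ℝ) (v : ℝ → Plane → ℝ), 0 ≤ N →
      (∀ a₀ ∈ Set.Icc lam 1, MemHolder α (v a₀)) →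
      (∀ a₀ ∈ Set.Icc lam 1, ∀ ρ, 0 < ρ → ρ ≤ 1 → ∀ x, |F a₀ ρ x| ≤ N * ρ ^ (α - 2)) →
      (∀ a₀ ∈ Set.Icc lam 1, ∀ a₁ ∈ Set.Icc lam 1, ∀ ρ, 0 < ρ → ρ ≤ 1 → ∀ x,
        |F a₀ ρ x - F a₁ ρ x| ≤ N * |a₀ - a₁| * ρ ^ (α - 2)) →
      (∀ a₀ ∈ Set.Icc lam 1, ∀ ρ (hρ : 0 < ρ) x, mollOp a₀ (v a₀) ρ hρ x = F a₀ ρ x) →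
      (∀ a₀ ∈ Set.Icc lam 1, ∀ x, |v a₀ x| ≤ C * N) ∧
      (∀ a₀ ∈ Set.Icc lam 1, ∀ x y, |v a₀ x - v a₀ y| ≤ C * N * pdist x y ^ α) ∧
      (∀ a₀ ∈ Set.Icc lam 1, ∀ a₁ ∈ Set.Icc lam 1, ∀ x y,
        |(v a₀ x - v a₀ y) - (v a₁ x - v a₁ y)| ≤ C * N * |a₀ - a₁| * pdist x y ^ α) := by
  obtain ⟨C, hC, hS⟩ := schauder_const α lam hα hα' hlam
  have hk := kerConst_nonneg
  refine ⟨C + C * (1 + kerConst * C), by positivity, ?_⟩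
  intro N F v hN hv hF hFl hE
  have base : ∀ a₀ ∈ Set.Icc lam 1, (∀ x, |v a₀ x| ≤ C * N) ∧
      ∀ x y, |v a₀ x - v a₀ y| ≤ C * N * pdist x y ^ α := fun a₀ ha =>
    hS a₀ (v a₀) _ _ N ha.1 ha.2 ENNReal.toReal_nonneg hN ((hv a₀ ha).bounds hα).1
      ((hv a₀ ha).bounds hα).2 fun ρ hρ hρ1 x => by rw [hE a₀ ha]; exact hF a₀ ha ρ hρ hρ1 x
  have hCN : C * N ≤ (C + C * (1 + kerConst * C)) * N := by
    have : 0 ≤ C * (1 + kerConst * C) * N := by positivity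
    linarith
  have hrp : ∀ x y : Plane, 0 ≤ pdist x y ^ α := fun x y => Real.rpow_nonneg (pdist_nonneg x y) α
  refine ⟨fun a₀ ha x => ((base a₀ ha).1 x).trans hCN, fun a₀ ha x y =>
    ((base a₀ ha).2 x y).trans (mul_le_mul_of_nonneg_right hCN (hrp x y)), ?_⟩
  intro a₀ h0 a₁ h1 x y
  obtain ⟨b0, c0⟩ := base a₀ h0
  obtain ⟨b1, c1⟩ := base a₁ h1
  have key := (hS a₀ (fun y => v a₀ y - v a₁ y) (C * N + C * N) (C * N + C * N)
    ((1 + kerConst * C) * N * |a₀ - a₁|) h0.1 h0.2 (by positivity) (by positivity)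
    (fun x => (abs_sub _ _).trans (add_le_add (b0 x) (b1 x)))
    (fun x y => by
      have e : v a₀ x - v a₁ x - (v a₀ y - v a₁ y)
        = (v a₀ x - v a₀ y) - (v a₁ x - v a₁ y) := by ring
      rw [e, add_mul]
      exact (abs_sub _ _).trans (add_le_add (c0 x y) (c1 x y)))
    (fun ρ hρ hρ1 x => by
      rw [mollOp_sub (a₁ := a₁) (continuous_of_holder hα c0) (continuous_of_holder hα c1) b0 b1,
        hE a₀ h0, hE a₁ h1]
      have d1 := hFl a₀ h0 a₁ h1 ρ hρ hρ1 x
      have d2 := abs_conv_deriv_deriv_ker_le (continuous_of_holder hα c1) b1 hρ (x := x) hα.le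
        (by linarith) (by positivity) (fun z => c1 z x)
      have d3 := mul_le_mul_of_nonneg_left d2 (abs_nonneg (a₀ - a₁))
      rw [← abs_mul] at d3
      refine (abs_add_le _ _).trans ?_
      linarith)).2 x y
  have e : (v a₀ x - v a₀ y) - (v a₁ x - v a₁ y) = v a₀ x - v a₁ x - (v a₀ y - v a₁ y) := by ring
  rw [e]
  refine key.trans (mul_le_mul_of_nonneg_right ?_ (hrp x y))
  have : 0 ≤ C * N * |a₀ - a₁| := by positivity
  linarith

/-- Mean value inequality in the parameter, with the mollifier as a fixed test function. -/
theorem abs_mollify_sub_le {lam α c : ℝ} {f f' : ℝ → Distr} (hf : HasParamDeriv lam f f')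
    (hc : 0 ≤ c) (h : ∀ a₀ ∈ Set.Icc lam 1, negNorm (2 - α) (f' a₀) ≤ ENNReal.ofReal c)
    {a₀ a₁ : ℝ} (h0 : a₀ ∈ Set.Icc lam 1) (h1 : a₁ ∈ Set.Icc lam 1) {ρ : ℝ} (hρ : 0 < ρ)
    (hρ1 : ρ ≤ 1) (x : Plane) :
    |(f a₀).mollify (ρ ^ 4) (pow_pos hρ 4) x - (f a₁).mollify (ρ ^ 4) (pow_pos hρ 4) x|
      ≤ c * |a₀ - a₁| * ρ ^ (α - 2) := by
  have main := (convex_Icc lam 1).norm_image_sub_le_of_norm_hasDerivWithin_le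
    (f := fun b => f b (psiAt (ρ ^ 4) (pow_pos hρ 4) x)) (C := c * ρ ^ (-(2 - α)))
    (fun b hb => hf b hb _)
    (fun b hb => abs_mollify_le_of_negNorm_le hc (h b hb) hρ hρ1 x) h1 h0
  rw [neg_sub] at main
  refine main.trans (le_of_eq ?_)
  rw [Real.norm_eq_abs]; ring

/-- The Schauder bounds enter as the hypothesis `hS`, so that `C₀` is fixed before `δ` and before
the data. The full norm of each `σ i` serves at once as supremum and Hölder bound. -/
theorem modelData_of_hypotheses {α lam C₀ δ : ℝ} (hα : 1 / 2 < α) (hα' : α < 1) (hδ0 : 0 ≤ δ)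
    (hδ1 : δ ≤ 1) (hC₀ : 0 ≤ C₀)
    (hS : ∀ (N : ℝ) (F : ℝ → ℝ → Plane → ℝ) (v : ℝ → Plane → ℝ), 0 ≤ N →
      (∀ a₀ ∈ Set.Icc lam 1, MemHolder α (v a₀)) →
      (∀ a₀ ∈ Set.Icc lam 1, ∀ ρ, 0 < ρ → ρ ≤ 1 → ∀ x, |F a₀ ρ x| ≤ N * ρ ^ (α - 2)) →
      (∀ a₀ ∈ Set.Icc lam 1, ∀ a₁ ∈ Set.Icc lam 1, ∀ ρ, 0 < ρ → ρ ≤ 1 → ∀ x,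
        |F a₀ ρ x - F a₁ ρ x| ≤ N * |a₀ - a₁| * ρ ^ (α - 2)) →
      (∀ a₀ ∈ Set.Icc lam 1, ∀ ρ (hρ : 0 < ρ) x, mollOp a₀ (v a₀) ρ hρ x = F a₀ ρ x) →
      (∀ a₀ ∈ Set.Icc lam 1, ∀ x, |v a₀ x| ≤ C₀ * N) ∧
      (∀ a₀ ∈ Set.Icc lam 1, ∀ x y, |v a₀ x - v a₀ y| ≤ C₀ * N * pdist x y ^ α) ∧
      (∀ a₀ ∈ Set.Icc lam 1, ∀ a₁ ∈ Set.Icc lam 1, ∀ x y,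
        |(v a₀ x - v a₀ y) - (v a₁ x - v a₁ y)| ≤ C₀ * N * |a₀ - a₁| * pdist x y ^ α))
    {I : ℕ} {f f' : Fin I → ℝ → Distr} {N : Fin I → ℝ} {v : Fin I → ℝ → Plane → ℝ}
    {a : Plane → ℝ} {σ : Fin I → Plane → ℝ} {u : Plane → ℝ} {K : ℝ} (hN0 : ∀ i, 0 ≤ N i)
    (hK0 : 0 ≤ K)
    (hf : ∀ i, HasParamDeriv lam (f i) (f' i))
    (hN : ∀ i, negNormOne lam (2 - α) (f i) (f' i) ≤ ENNReal.ofReal (N i))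
    (ha : ∀ x, a x ∈ Set.Icc lam 1) (haδ : holderSeminorm α a ≤ ENNReal.ofReal δ)
    (hv : ∀ i, ∀ a₀ ∈ Set.Icc lam 1, MemHolder α (v i a₀) ∧ IsSpaceTimePeriodic (v i a₀) ∧
      SolvesFrozen a₀ (f i a₀) (v i a₀))
    (hσ : ∀ i, MemHolder α (σ i)) (hu : MemHolder α u) (hper : IsX₁Periodic u)
    (hK : approxError α u a σ f ≤ ENNReal.ofReal K) :
    ModelData α lam C₀ δ K N (fun i => (holderNorm α (σ i)).toReal)
      (fun i a₀ ρ x => if hρ : 0 < ρ then (f i a₀).mollify (ρ ^ 4) (pow_pos hρ 4) x else 0)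
      v a σ u := by
  have hα0 : 0 < α := by linarith
  have hmax : ∀ i, ∀ a₀ ∈ Set.Icc lam 1,
      max (negNorm (2 - α) (f i a₀)) (negNorm (2 - α) (f' i a₀)) ≤ ENNReal.ofReal (N i) :=
    fun i a₀ h0 => le_trans (le_iSup₂_of_le a₀ h0 le_rfl) (hN i)
  have hub := hu.bounds hα0
  have huc := continuous_of_holder hα0 hub.2
  have hF : ∀ i, ∀ a₀ ∈ Set.Icc lam 1, ∀ ρ, 0 < ρ → ρ ≤ 1 → ∀ x,
      |(if hρ : 0 < ρ then (f i a₀).mollify (ρ ^ 4) (pow_pos hρ 4) x else 0)|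
        ≤ N i * ρ ^ (α - 2) := by
    intro i a₀ h0 ρ hρ hρ1 x
    rw [dif_pos hρ]
    have := abs_mollify_le_of_negNorm_le (hN0 i) ((le_max_left _ _).trans (hmax i a₀ h0)) hρ hρ1 x
    rwa [neg_sub] at this
  have hFl : ∀ i, ∀ a₀ ∈ Set.Icc lam 1, ∀ a₁ ∈ Set.Icc lam 1, ∀ ρ, 0 < ρ → ρ ≤ 1 → ∀ x,
      |(if hρ : 0 < ρ then (f i a₀).mollify (ρ ^ 4) (pow_pos hρ 4) x else 0)
        - (if hρ : 0 < ρ then (f i a₁).mollify (ρ ^ 4) (pow_pos hρ 4) x else 0)|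
        ≤ N i * |a₀ - a₁| * ρ ^ (α - 2) := by
    intro i a₀ h0 a₁ h1 ρ hρ hρ1 x
    rw [dif_pos hρ, dif_pos hρ]
    exact abs_mollify_sub_le (hf i) (hN0 i)
      (fun b hb => (le_max_right _ _).trans (hmax i b hb)) h0 h1 hρ hρ1 x
  have hE : ∀ i, ∀ a₀ ∈ Set.Icc lam 1, ∀ ρ (hρ : 0 < ρ) x, mollOp a₀ (v i a₀) ρ hρ x
      = if hρ : 0 < ρ then (f i a₀).mollify (ρ ^ 4) (pow_pos hρ 4) x else 0 := by
    intro i a₀ h0 ρ hρ x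
    rw [dif_pos hρ]
    obtain ⟨hb, -, hs⟩ := hv i a₀ h0
    have hb := hb.bounds hα0
    exact hs.mollOp_eq (continuous_of_holder hα0 hb.2) hb.1 hρ x
  have fam := fun i => hS (N i)
    (fun a₀ ρ x => if hρ : 0 < ρ then (f i a₀).mollify (ρ ^ 4) (pow_pos hρ 4) x else 0) (v i)
    (hN0 i) (fun a₀ h0 => (hv i a₀ h0).1) (hF i) (hFl i) (hE i)
  exact
    { N_nonneg := hN0
      s_nonneg := fun i => ENNReal.toReal_nonneg
      K_nonneg := hK0
      C₀_nonneg := hC₀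
      δ_nonneg := hδ0
      δ_le_one := hδ1
      a_mem := ha
      a_holder := abs_sub_le_of_holderSeminorm_le hα0 hδ0 haδ
      σ_bound := fun i => ((hσ i).bounds hα0).1
      σ_holder := fun i => ((hσ i).bounds hα0).2
      F_bound := hF
      F_lip := hFl
      v_eq := hE
      v_bound := fun i => (fam i).1
      v_holder := fun i => (fam i).2.1
      v_lip := fun i => (fam i).2.2
      v_periodic := fun i a₀ h0 x => ((hv i a₀ h0).2.1 x).1
      u_continuous := huc
      u_bounded := ⟨_, hub.1⟩
      u_periodic := hper
      approx := fun ρ hρ hρ1 x => by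
        have h1 := abs_le_of_scaled_supNorm_le (β := 2 - 2 * α)
          (g := fun x => parabolicOp a (mollify u (ρ ^ 4) (pow_pos hρ 4)) x
            - ∑ i, σ i x * (f i (a x)).mollify (ρ ^ 4) (pow_pos hρ 4) x) hρ hK0
          (iSup_le_iff.1 (iSup_le_iff.1 (iSup_le_iff.1 hK (ρ ^ 4)) (pow_pos hρ 4))
            (pow_le_one₀ hρ.le hρ1)) x
        rw [parabolicOp_mollify_eq huc hub.1, neg_sub] at h1
        simpa only [dif_pos hρ] using h1 }

end

end ParabolicSafonov

open ParabolicSafonov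
theorem mainTheorem6 (α lam : ℝ) (hα : 1 / 2 < α) (hα' : α < 1) (hlam : 0 < lam) :
    ∃ δ : ℝ, 0 < δ ∧ ∃ C : ℝ, 0 < C ∧
      ∀ (I : ℕ) (f f' : Fin I → ℝ → Distr) (N : Fin I → ℝ) (v : Fin I → ℝ → Plane → ℝ)
        (a : Plane → ℝ) (σ : Fin I → Plane → ℝ) (u ν : Plane → ℝ) (K : ℝ),
        (∀ i, ∀ a₀ ∈ Set.Icc lam 1, (f i a₀).IsPeriodic) →
        (∀ i, HasParamDeriv lam (f i) (f' i)) →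
        (∀ i, negNormOne lam (2 - α) (f i) (f' i) ≤ ENNReal.ofReal (N i)) →
        (∀ x, a x ∈ Set.Icc lam 1) →
        holderSeminorm α a ≤ ENNReal.ofReal δ →
        (∀ i, ∀ a₀ ∈ Set.Icc lam 1, MemHolder α (v i a₀) ∧ IsSpaceTimePeriodic (v i a₀) ∧
          SolvesFrozen a₀ (f i a₀) (v i a₀)) →
        (∀ i, MemHolder α (σ i)) →
        MemHolder α u →
        IsX₁Periodic u →
        modellingConst α u v a σ ν < ⊤ →
        approxError α u a σ f ≤ ENNReal.ofReal K →
        modellingConst α u v a σ ν + holderNorm α u ≤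
          ENNReal.ofReal C *
            (ENNReal.ofReal K + ∑ i, holderNorm α (σ i) * ENNReal.ofReal (N i)) := by
  have hα0 : 0 < α := by linarith
  obtain ⟨C₀, hC₀, hS⟩ := schauder_family α lam hα0 hα' hlam
  obtain ⟨δ, C, hδ, hδ1, hC, hmain⟩ := ModelData.estimate α lam C₀ hα hα' hlam hC₀.le
  -- The factor three accounts for the modelling constant, the supremum and the Hölder seminorm.
  refine ⟨δ, hδ, 3 * C, by positivity, ?_⟩
  intro I f f' N v a σ u ν K _ hf hN ha haδ hv hσ hu hper hM hK
  -- Negative `N i` and `K` are truncated to zero, which changes nothing after passing to extended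
  -- nonnegative reals.
  have eN : ∀ i, ENNReal.ofReal (max (N i) 0) = ENNReal.ofReal (N i) := fun i => by
    rw [ENNReal.ofReal_max]; simp
  have eK : ENNReal.ofReal (max K 0) = ENNReal.ofReal K := by rw [ENNReal.ofReal_max]; simp
  have data := modelData_of_hypotheses (N := fun i => max (N i) 0) (K := max K 0) hα hα' hδ.le hδ1
    hC₀.le hS (fun i => le_max_right _ _) (le_max_right _ _) hf (fun i => by rw [eN]; exact hN i)
    ha haδ hv hσ hu hper (by rw [eK]; exact hK)
  have hub := hu.bounds hα0
  obtain ⟨r1, r2, r3⟩ := hmain I _ _ _ _ v a σ u ν (modellingConst α u v a σ ν).toReal _ _ data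
    ENNReal.toReal_nonneg
    (modelled_of_modellingConst_le hα0 ENNReal.toReal_nonneg (ENNReal.ofReal_toReal hM.ne).ge)
    hub.1 ENNReal.toReal_nonneg hub.2
  have eX : ENNReal.ofReal K + ∑ i, holderNorm α (σ i) * ENNReal.ofReal (N i)
      = ENNReal.ofReal (max K 0 + ∑ i, (holderNorm α (σ i)).toReal * max (N i) 0) := by
    rw [ENNReal.ofReal_add (le_max_right _ _) data.X_nonneg, eK, ENNReal.ofReal_sum_of_nonneg
      fun i _ => mul_nonneg ENNReal.toReal_nonneg (le_max_right _ _)]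
    congr 1
    refine Finset.sum_congr rfl fun i _ => ?_
    rw [ENNReal.ofReal_mul ENNReal.toReal_nonneg, ENNReal.ofReal_toReal (hσ i).ne, eN]
  have hY : 0 ≤ C * (max K 0 + ∑ i, (holderNorm α (σ i)).toReal * max (N i) 0) :=
    mul_nonneg hC.le (add_nonneg (le_max_right _ _) data.X_nonneg)
  rw [eX, ← ENNReal.ofReal_mul (by positivity)]
  calc _ ≤ ENNReal.ofReal _ + (ENNReal.ofReal _ + ENNReal.ofReal _) :=
        add_le_add (modellingConst_le_of_modelled r1)
          (add_le_add (supNorm_le r2) (holderSeminorm_le r3))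
    _ = _ := by
        rw [← ENNReal.ofReal_add hY hY, ← ENNReal.ofReal_add hY (add_nonneg hY hY)]
        congr 1
        ring
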